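/- Let $M$ be a complete, non-compact Riemannian manifold with Riemannian measure $\mu$, fix $x_0\in M$, put $r(x)=\mathrm{dist}(x_0,x)$, let $B_R$ be the ball of radius $R$ centred at $x_0$, and let $S=M\times(0,\infty)$. Let $p>1$, $m\ge 1$, $q>\max(p+m-2,1)$, let $a:M\to\mathbb R$ be locally Lipschitz with $a>0$ a.e., write $d\mu_a=a\,d\mu$, and let $\Phi$ be measurable with $0\le\Phi\le K$ on $[0,\infty)$ for some $K>0$. Let $V\in L^1_{\mathrm{loc}}(S)$ and consider $$\partial_t u\ \ge\ \frac1{a}\,\mathrm{div}\big(a\,u^{m-1}|\nabla u|^{p-2}\Phi(|\nabla u|)\nabla u\big)+V u^q\qquad\text{in }S.\qquad(*)$$ A (global nonnegative) weak solution of $(*)$ is a function $u\ge 0$ a.e. on $S$ such that $u\in L^q_{\mathrm{loc}}(S;V\,d\mu_a dt)$, such that $u^{p+m-1}$, $|\nabla u|^p u^{m-1}$ and $u\,\partial_t u$ belong to $L^1_{\mathrm{loc}}(S;d\mu_a dt)$, and such that for every nonnegative, locally Lipschitz $\psi$ with compact support in $S$ $$\iint_S\psi u^qV\,d\mu_a dt\le\iint_S\langle\nabla\psi,\nabla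 u\rangle u^{m-1}|\nabla u|^{p-2}\Phi(|\nabla u|)\,d\mu_a dt-\iint_S(\partial_t\psi)\,u\,d\mu_a dt .$$ Here the weak derivatives $\nabla u,\partial_t u$ are understood in the sense of weighted Sobolev spaces defined by completion: there are nonnegative locally Lipschitz functions $u_k$ on $S$ with $u_k\to u$, $\partial_t u_k\to\partial_t u$ and $\nabla u_k\to\nabla u$ in $L^1_{\mathrm{loc}}(S;d\mu_a dt)$, and $\nabla u_k\to\nabla u$ also in $L^p_{\mathrm{loc}}(S;u^{m-1}d\mu_a dt)$. Suppose that $V(x,t)\ge f(t)h(x)$ for a.e. $(x,t)\in S$, for some measurable functions $h:M\to\mathbb R$ and $f:(0,\infty)\to\mathbb R$, and that there are constants $C>0$ and $\alpha_1,\alpha_2,\sigma_1,\dots,\sigma_4,\delta_1,\dots,\delta_4\ge 0$ such that $$C^{-1}(1+r(x))^{-\alpha_1}\le h(x)\le C(1+r(x))^{\alpha_1}\ \text{ for a.e. }x\in M,\qquad C^{-1}(1+t)^{-\alpha_2}\le f(t)\le C(1+t)^{\alpha_2}\ \text{ for a.e. }t>0,$$ and, for all sufficiently large $R$ and $T$,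 $$\int_{B_R}h^{-\frac1{q-1}}d\mu_a\le CR^{\sigma_1}(\log R)^{\delta_1},\qquad \int_0^Tf^{-\frac1{q-1}}dt\le CT^{\sigma_2}(\log T)^{\delta_2},$$ $$\int_{B_R}h^{-\frac{p+m-2}{q-p-m+2}}d\mu_a\le CR^{\sigma_3}(\log R)^{\delta_3},\qquad \int_0^Tf^{-\frac{p+m-2}{q-p-m+2}}dt\le CT^{\sigma_4}(\log T)^{\delta_4}.$$ Assume that all of the following hold: (i) $\delta_1+\delta_2\le\frac1{q-1}$ and $\delta_3+\delta_4\le\frac{p+m-2}{q-p-m+2}$; (ii) $0\le\sigma_2\le\frac q{q-1}$ and $0\le\sigma_3\le\frac{pq}{q-p-m+2}$; (iii) if $\sigma_2=\frac q{q-1}$ then $\sigma_1=0$, and if $\sigma_3=\frac{pq}{q-p-m+2}$ then $\sigma_4=0$; (iv) $\sigma_1\sigma_4\le\big(\frac q{q-1}-\sigma_2\big)\big(\frac{pq}{q-p-m+2}-\sigma_3\big)$. Then $(*)$ has no global nonnegative weak solution which is nontrivial, that is, not a.e. equal to $0$ on $S$. -/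

import Mathlib

open MeasureTheory Set Filter Topology Bundle
open scoped Manifold ContDiff ENNReal NNReal

noncomputable section

namespace DoublyNonlinear

/-- The space-time `S = M × (0, ∞)`, as a subset of `M × ℝ`. -/
def spaceTime (M : Type*) : Set (M × ℝ) := univ ×ˢ Ioi (0 : ℝ)

section Measures

variable (N : ℕ) {M : Type*} [MetricSpace M] [MeasurableSpace M] [BorelSpace M]

/-- The weighted measure `μ_a = a μ`, where `μ` is the Riemannian measure of the `N`-dimensional
Riemannian manifold `M`, i.e. the `N`-dimensional Hausdorff measure of the Riemannian distance,
normalized so as to be the Lebesgue measure on `ℝ^N`. -/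
def weightedMeasure (a : M → ℝ) : Measure M :=
  (μHE[N] : Measure M).withDensity fun x => ENNReal.ofReal (a x)

/-- The measure `dμ_a dt` on `M × ℝ`. -/
def weightedSpaceTimeMeasure (a : M → ℝ) : Measure (M × ℝ) :=
  (weightedMeasure N a).prod volume

end Measures

/-- The functions `d n` tend to zero in `L^s_loc(S; ν)`. -/
def TendstoZeroLpLoc {M : Type*} [TopologicalSpace M] [MeasurableSpace M] (s : ℝ)
    (ν : Measure (M × ℝ)) (d : ℕ → M × ℝ → ℝ) : Prop :=
  ∀ A : Set (M × ℝ), A ⊆ spaceTime M → IsCompact A →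
    Tendsto (fun n => ∫⁻ z in A, ENNReal.ofReal (|d n z| ^ s) ∂ν) atTop (𝓝 0)

/-- The time derivative `∂_t ψ` of a function on space-time. -/
def timeDeriv {M : Type*} (ψ : M × ℝ → ℝ) (z : M × ℝ) : ℝ :=
  deriv (fun s => ψ (z.1, s)) z.2

section Manifold

variable {N : ℕ} {M : Type*} [MetricSpace M]
  [ChartedSpace (EuclideanSpace ℝ (Fin N)) M] [IsManifold (𝓡 N) ∞ M]
  [RiemannianBundle (fun x : M => TangentSpace (𝓡 N) x)]

/-- The Riemannian gradient `∇ψ(·, t)` at `x`, `z = (x, t)`, of a function on space-time: the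
tangent vector at `x` that represents the differential of `ψ(·, t)` at `x`. -/
def spaceGrad (ψ : M × ℝ → ℝ) (z : M × ℝ) : TangentSpace (𝓡 N) z.1 :=
  haveI : FiniteDimensional ℝ (TangentSpace (𝓡 N) z.1) :=
    inferInstanceAs (FiniteDimensional ℝ (EuclideanSpace ℝ (Fin N)))
  haveI : CompleteSpace (TangentSpace (𝓡 N) z.1) := FiniteDimensional.complete ℝ _
  (InnerProductSpace.toDual ℝ (TangentSpace (𝓡 N) z.1)).symm
    (mfderiv (𝓡 N) 𝓘(ℝ, ℝ) (fun y => ψ (y, z.2)) z.1)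

variable [MeasurableSpace M] [BorelSpace M]

/-- `X = ∇u` and `v = ∂_t u` in the sense of weighted Sobolev spaces, these being defined (as usual
for weights which may degenerate) by completion: `u` is a limit of nonnegative locally Lipschitz
functions on `S`, with convergence of the functions and of their first derivatives in
`L^1_loc(S; dμ_a dt)`, the gradients converging also in `L^p_loc(S; u^(m-1) dμ_a dt)`, the
space in which a weak solution of the inequality is required to have its gradient.
In particular, `X` and `v` are the distributional derivatives of `u` where `a > 0`. -/
structure HasWeakDerivatives (p m : ℝ) (a : M → ℝ) (u : M × ℝ → ℝ)
    (X : ∀ z : M × ℝ, TangentSpace (𝓡 N) z.1) (v : M × ℝ → ℝ) : Prop where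
  aestronglyMeasurable :
    AEStronglyMeasurable u ((weightedSpaceTimeMeasure N a).restrict (spaceTime M))
  aestronglyMeasurable_grad :
    AEStronglyMeasurable (fun z => (⟨z.1, X z⟩ : TangentBundle (𝓡 N) M))
      ((weightedSpaceTimeMeasure N a).restrict (spaceTime M))
  aestronglyMeasurable_timeDeriv :
    AEStronglyMeasurable v ((weightedSpaceTimeMeasure N a).restrict (spaceTime M))
  exists_approx : ∃ U : ℕ → M × ℝ → ℝ,
    (∀ n, LocallyLipschitzOn (spaceTime M) (U n)) ∧
    (∀ n, ∀ z ∈ spaceTime M, 0 ≤ U n z) ∧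
    TendstoZeroLpLoc 1 (weightedSpaceTimeMeasure N a) (fun n z => U n z - u z) ∧
    TendstoZeroLpLoc 1 (weightedSpaceTimeMeasure N a) (fun n z => timeDeriv (U n) z - v z) ∧
    TendstoZeroLpLoc 1 (weightedSpaceTimeMeasure N a) (fun n z => ‖spaceGrad (U n) z - X z‖) ∧
    TendstoZeroLpLoc p
      ((weightedSpaceTimeMeasure N a).withDensity fun z => ENNReal.ofReal (u z ^ (m - 1)))
      (fun n z => ‖spaceGrad (U n) z - X z‖)

/-- Global nonnegative weak solutions `u` of
`∂_t u ≥ (1/a) div (a u^(m-1) |∇u|^(p-2) Φ(|∇u|) ∇u) + V u^q` in `M × (0, ∞)`. -/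
def IsWeakSolution (p q m : ℝ) (a : M → ℝ) (Φ : ℝ → ℝ) (V : M × ℝ → ℝ) (u : M × ℝ → ℝ) : Prop :=
  ∃ (X : ∀ z : M × ℝ, TangentSpace (𝓡 N) z.1) (v : M × ℝ → ℝ),
    HasWeakDerivatives p m a u X v ∧
    (∀ᵐ z ∂((weightedSpaceTimeMeasure N a).restrict (spaceTime M)), 0 ≤ u z) ∧
    LocallyIntegrableOn (fun z => u z ^ q * V z) (spaceTime M) (weightedSpaceTimeMeasure N a) ∧
    LocallyIntegrableOn (fun z => u z ^ (p + m - 1)) (spaceTime M)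
      (weightedSpaceTimeMeasure N a) ∧
    LocallyIntegrableOn (fun z => ‖X z‖ ^ p * u z ^ (m - 1)) (spaceTime M)
      (weightedSpaceTimeMeasure N a) ∧
    LocallyIntegrableOn (fun z => u z * v z) (spaceTime M) (weightedSpaceTimeMeasure N a) ∧
    ∀ ψ : M × ℝ → ℝ, LocallyLipschitz ψ → HasCompactSupport ψ → tsupport ψ ⊆ spaceTime M →
      (∀ z, 0 ≤ ψ z) →
      ∫ z in spaceTime M, ψ z * u z ^ q * V z ∂(weightedSpaceTimeMeasure N a) ≤
        (∫ z in spaceTime M,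
          inner ℝ (spaceGrad ψ z) (X z) * u z ^ (m - 1) * ‖X z‖ ^ (p - 2) * Φ ‖X z‖
            ∂(weightedSpaceTimeMeasure N a))
        - ∫ z in spaceTime M, timeDeriv ψ z * u z ∂(weightedSpaceTimeMeasure N a)

end Manifold

end DoublyNonlinear

end

/-! The proof is a nonlinear capacity argument at the critical exponents, with cutoffs that are
linear in a logarithmic variable. Let ℓ = `logScale` be the larger of log r and (log t)/θ, both
truncated at 0. The test functions are η = ξ φ^s, where φ decreases linearly in ℓ/n from 1 at ℓ = n
to 0 at ℓ = 2n, and ξ vanishes near t = 0. Then |∇φ| and |∂_t φ| are at most constant multiples of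
e^(-ℓ)/n and e^(-θℓ)/n, and they vanish off the annulus n ≤ ℓ ≤ 2n. Since ξ increases in time, its
derivative enters with a favourable sign, so nothing is needed about u near t = 0.

Testing with η (u + ε)^(-e) gives `energy_inequality`: source + e · energy ≤ flux, where the source
is the integral of η (u + ε)^(-e) u^q V and the energy contains |∇u|^p. Put α = 1/n. Young's
inequality splits the gradient flux into a small multiple of α · energy and a power of u with
coefficient G = α^(-(p-1)) |∇φ|^p, of order e^(-pℓ)/n. A second use of Young's inequality, against
the source, leaves G^(1+β₂) W^(-β₂) + τ^(1+β₁) W^(-β₁), where W = f h, τ bounds |∂_t φ|, β₁ =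
1/(q-1) and β₂ = (p+m-2)/(q-p-m+2). The exponents that actually occur differ from β₁, β₂ by O(1/n).
The polynomial bounds on h and f make log(G/W) and log(τ/W) of size O(n) on the annulus, so this
discrepancy costs a bounded factor (`flux_term_le`, `exists_abs_log_le`).

Conditions (iii) and (iv) provide a time scale θ with σ₁ + θσ₂ ≤ θ(1+β₁) and σ₃ + θσ₄ ≤ p(1+β₂)
(`exists_time_scale`). Cut the annulus into about n shells of unit width in ℓ. By (i) each
contributes O(n^β) to the weighted integral, in total O(n^(1+β)), which is exactly cancelled by the
factor n^(-(1+β)) coming from the slope of the cutoff. Hence the capacity terms are bounded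
uniformly in n (`exists_lintegral_capacityWeight_le`).

Finally, e = 1/n bounds α · energy uniformly in n, and then e = 0 gives ∫ η u^q V ≤ κ₁ C₁ + B(κ₁) (κ
c ∫_annulus η u^q V + P(κ) C₂), with P(κ) → 0 as κ → ∞ (`cutoff_bound`). A small κ shows that u^q V
is integrable on S, so the annulus integrals tend to 0. Letting n → ∞, then κ → ∞, then κ₁ → 0
yields ∫ u^q V = 0 (`lintegral_eq_zero_of_cutoff_bound`), and V > 0 a.e. forces u = 0.

The geometric input is the Hopf–Rinow theorem, which makes the cutoffs compactly supported, and
Rademacher's theorem in charts, which justifies the product rule and the measurability of the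
pairings of gradients. -/

noncomputable section

set_option linter.unusedSectionVars false

namespace DoublyNonlinear

/-! ### Hopf–Rinow theorem for length spaces -/

section HopfRinow

/-- The approximate midpoint property of length spaces. -/
def HasIntermediatePoints (X : Type*) [MetricSpace X] : Prop :=
  ∀ (x y : X) (r s : ℝ), 0 < r → 0 < s → dist x y < r + s → ∃ z, dist x z < r ∧ dist z y < s

variable {X : Type*} [MetricSpace X]

/-- A point of the ball of radius ρ lies within 2δ ≤ ε/2 of the compact ball of radius ρ - δ, so a
finite ε/2-net of the smaller ball is an ε-net of the larger one. Completeness turns total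
boundedness into compactness. -/
theorem HasIntermediatePoints.isCompact_closedBall_of_forall_lt [CompleteSpace X]
    (hX : HasIntermediatePoints X) (x : X) {ρ : ℝ} (hρ : 0 < ρ)
    (h : ∀ r < ρ, IsCompact (Metric.closedBall x r)) : IsCompact (Metric.closedBall x ρ) := by
  suffices h : TotallyBounded (Metric.closedBall x ρ) from
    isCompact_iff_totallyBounded_isComplete.2 ⟨h, Metric.isClosed_closedBall.isComplete⟩
  rw [Metric.totallyBounded_iff]
  intro ε hε
  set δ := min (ε / 4) (ρ / 2) with hδ
  have hδ0 : 0 < δ := by positivity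
  have hδε : δ ≤ ε / 4 := min_le_left _ _
  have hδρ : δ ≤ ρ / 2 := min_le_right _ _
  obtain ⟨t, ht, hcov⟩ := Metric.totallyBounded_iff.1 (h (ρ - δ) (by linarith)).totallyBounded
    (ε / 2) (by positivity)
  refine ⟨t, ht, fun y hy => ?_⟩
  rw [Metric.mem_closedBall, dist_comm] at hy
  obtain ⟨z, hxz, hzy⟩ := hX x y (ρ - δ) (2 * δ) (by linarith) (by linarith) (by linarith)
  have hz : z ∈ Metric.closedBall x (ρ - δ) := by
    rw [Metric.mem_closedBall, dist_comm]; exact hxz.le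
  obtain ⟨w, hw, hzw⟩ := mem_iUnion₂.1 (hcov hz)
  refine mem_iUnion₂.2 ⟨w, hw, ?_⟩
  rw [Metric.mem_ball] at hzw ⊢
  have := dist_triangle y z w
  rw [dist_comm y z] at this
  linarith

/-- Hopf–Rinow theorem for complete locally compact length spaces. -/
theorem HasIntermediatePoints.properSpace [CompleteSpace X] [LocallyCompactSpace X]
    (hX : HasIntermediatePoints X) : ProperSpace X := by
  refine ⟨fun x r => ?_⟩
  by_contra hr
  set S : Set ℝ := {r | IsCompact (Metric.closedBall x r)} with hS
  have hdown : ∀ a b, a ≤ b → b ∈ S → a ∈ S := fun a b hab hb =>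
    IsCompact.of_isClosed_subset hb Metric.isClosed_closedBall
      (Metric.closedBall_subset_closedBall hab)
  have hbdd : ∀ s ∈ S, s ≤ r := fun s hs => by
    by_contra hlt
    exact hr (hdown r s (not_le.1 hlt).le hs)
  obtain ⟨K, hK, hKx⟩ := exists_compact_mem_nhds x
  obtain ⟨ε, hε, hεK⟩ := Metric.nhds_basis_closedBall.mem_iff.1 hKx
  have hεS : ε ∈ S := hK.of_isClosed_subset Metric.isClosed_closedBall hεK
  have hBA : BddAbove S := ⟨r, hbdd⟩
  set ρ := sSup S with hρ
  have hερ : ε ≤ ρ := le_csSup hBA hεS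
  have hρ0 : 0 < ρ := hε.trans_le hερ
  have hρS : IsCompact (Metric.closedBall x ρ) := by
    refine hX.isCompact_closedBall_of_forall_lt x hρ0 fun s hs => ?_
    obtain ⟨s', hs', hlt⟩ := exists_lt_of_lt_csSup ⟨ε, hεS⟩ hs
    exact hdown s s' hlt.le hs'
  -- The supremum ρ of the radii of compact balls is attained. A compact ball has a compact
  -- thickening in a locally compact space, and by the midpoint property that thickening contains a
  -- ball of radius larger than ρ, a contradiction.
  obtain ⟨δ, hδ, hδc⟩ := hρS.exists_isCompact_cthickening
  have : ρ + δ / 2 ∈ S := by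
    refine hδc.of_isClosed_subset Metric.isClosed_closedBall fun y hy => ?_
    rw [Metric.mem_closedBall, dist_comm] at hy
    obtain ⟨z, hxz, hzy⟩ := hX x y ρ δ hρ0 hδ (by linarith)
    refine Metric.mem_cthickening_of_dist_le y z δ _ ?_ (by rw [dist_comm]; exact hzy.le)
    rw [Metric.mem_closedBall, dist_comm]; exact hxz.le
  have := le_csSup hBA this
  linarith

end HopfRinow

/-! ### Riemannian manifolds as length spaces -/

section Riemannian

variable {N : ℕ} {M : Type*} [MetricSpace M]
  [ChartedSpace (EuclideanSpace ℝ (Fin N)) M] [IsManifold (𝓡 N) ∞ M]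
  [RiemannianBundle (fun x : M => TangentSpace (𝓡 N) x)]

theorem isContinuousRiemannianBundle
    [h : IsContMDiffRiemannianBundle (𝓡 N) ∞ (EuclideanSpace ℝ (Fin N))
      (fun x : M => TangentSpace (𝓡 N) x)] :
    IsContinuousRiemannianBundle (EuclideanSpace ℝ (Fin N))
      (fun x : M => TangentSpace (𝓡 N) x) := by
  rcases h.exists_contMDiff with ⟨g, g_smooth, hg⟩
  exact ⟨g, g_smooth.continuous, hg⟩

/-- The Riemannian distance is an infimum of lengths. On a C¹ path from x to y of length less than r
+ s, the point at distance exactly r from x leaves less than s of length to reach y. -/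
theorem hasIntermediatePoints (N : ℕ) (M : Type*) [MetricSpace M]
    [ChartedSpace (EuclideanSpace ℝ (Fin N)) M] [IsManifold (𝓡 N) ∞ M]
    [RiemannianBundle (fun x : M => TangentSpace (𝓡 N) x)]
    [IsRiemannianManifold (𝓡 N) M] : HasIntermediatePoints M := by
  intro x y r₀ s hr₀ hs hxy
  by_cases hcase : dist x y < r₀
  · exact ⟨y, hcase, by simpa using hs⟩
  -- The point found below has distance equal to the chosen radius, whereas the conclusion is
  -- strict. So r₀ is first lowered to the midpoint of r₀ and dist x y - s, or to r₀/2 if that is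
  -- larger.
  obtain ⟨r, hr, hrr₀, hxy⟩ : ∃ r, 0 < r ∧ r < r₀ ∧ dist x y < r + s :=
    ⟨max (r₀ / 2) ((dist x y - s + r₀) / 2), by positivity,
      max_lt (by linarith) (by linarith),
      by linarith [le_max_right (r₀ / 2) ((dist x y - s + r₀) / 2)]⟩
  have hxy' : r ≤ dist x y := hrr₀.le.trans (not_lt.1 hcase)
  have h1 : Manifold.riemannianEDist (𝓡 N) x y < ENNReal.ofReal (r + s) := by
    rw [← IsRiemannianManifold.out (I := 𝓡 N) x y, edist_dist]
    exact (ENNReal.ofReal_lt_ofReal_iff (by positivity)).2 hxy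
  obtain ⟨γ, h0, hγ1, hγ, hlen⟩ := Manifold.exists_lt_of_riemannianEDist_lt h1
  have hle : ∀ a b : ℝ, 0 ≤ a → a ≤ b → b ≤ 1 →
      edist (γ a) (γ b) ≤ Manifold.pathELength (𝓡 N) γ a b := fun a b ha hab hb => by
    rw [IsRiemannianManifold.out (I := 𝓡 N)]
    exact Manifold.riemannianEDist_le_pathELength (hγ.mono (Icc_subset_Icc ha hb)) rfl rfl hab
  obtain ⟨t, ht, hrt⟩ : r ∈ (fun t => dist x (γ t)) '' Icc 0 1 := by
    refine intermediate_value_Icc (f := fun t => dist x (γ t)) zero_le_one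
      (continuous_const.dist continuous_id |>.comp_continuousOn hγ.continuousOn) ⟨?_, ?_⟩
    · simp [h0, hr.le]
    · simpa [hγ1] using hxy'
  have hsum : edist x (γ t) + edist (γ t) y < ENNReal.ofReal (r + s) := by
    refine lt_of_le_of_lt ?_ hlen
    rw [← Manifold.pathELength_add ht.1 ht.2]
    refine add_le_add ?_ ?_
    · simpa [h0] using hle 0 t le_rfl ht.1 ht.2
    · simpa [hγ1] using hle t 1 ht.1 ht.2 le_rfl
  rw [edist_dist, edist_dist, ← ENNReal.ofReal_add dist_nonneg dist_nonneg,
    ENNReal.ofReal_lt_ofReal_iff (by positivity)] at hsum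
  simp only at hrt
  exact ⟨γ t, by linarith, by linarith⟩

/-- A complete Riemannian manifold is a proper metric space. -/
theorem properSpace_of_complete (N : ℕ) (M : Type*) [MetricSpace M]
    [ChartedSpace (EuclideanSpace ℝ (Fin N)) M] [IsManifold (𝓡 N) ∞ M]
    [RiemannianBundle (fun x : M => TangentSpace (𝓡 N) x)]
    [IsRiemannianManifold (𝓡 N) M] [CompleteSpace M] : ProperSpace M :=
  haveI : LocallyCompactSpace M := Manifold.locallyCompact_of_finiteDimensional (𝓡 N)
  (hasIntermediatePoints N M).properSpace

end Riemannian

/-! ### Charts, Lipschitz bounds and the Riemannian measure -/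

theorem euclideanHausdorffMeasure_image_eq_zero {N : ℕ} {M : Type*} [MetricSpace M]
    [MeasurableSpace M] [BorelSpace M]
    {C : ℝ≥0} {F : EuclideanSpace ℝ (Fin N) → M} {s : Set (EuclideanSpace ℝ (Fin N))}
    (hF : LipschitzOnWith C F s) (hs : volume s = 0) : (μHE[N] : Measure M) (F '' s) = 0 := by
  rw [← EuclideanSpace.euclideanHausdorffMeasure_eq_volume,
    Measure.euclideanHausdorffMeasure_def, Measure.smul_apply, smul_eq_zero] at hs
  have hs' := hs.resolve_left
    (Measure.addHaarScalarFactor_volume_hausdorffMeasure_ne_zero N)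
  rw [Measure.euclideanHausdorffMeasure_def, Measure.smul_apply, smul_eq_zero]
  right
  refine le_antisymm ((hF.hausdorffMeasure_image_le (Nat.cast_nonneg N)).trans ?_) zero_le
  rw [hs', mul_zero]

section Chart

variable {N : ℕ} {M : Type*} [MetricSpace M]
  [ChartedSpace (EuclideanSpace ℝ (Fin N)) M] [IsManifold (𝓡 N) ∞ M]

/-- The derivative of a function on the manifold in the direction of a tangent vector. -/
def spaceDeriv (f : M → ℝ) (x : M) (w : TangentSpace (𝓡 N) x) : ℝ :=
  mfderiv (𝓡 N) 𝓘(ℝ, ℝ) f x w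

/-- The velocity of the image of an affine line under the inverse of an extended chart. -/
theorem mfderiv_extChartAt_symm_line (x : M) (y w : EuclideanSpace ℝ (Fin N)) (s : ℝ)
    (h : y + s • w ∈ (extChartAt (𝓡 N) x).target) :
    mfderiv 𝓘(ℝ, ℝ) (𝓡 N) (fun s : ℝ => (extChartAt (𝓡 N) x).symm (y + s • w)) s (1 : ℝ) =
      (trivializationAt (EuclideanSpace ℝ (Fin N)) (TangentSpace (𝓡 N)) x).symmL ℝ
        ((extChartAt (𝓡 N) x).symm (y + s • w)) w := by
  have hsrc : (extChartAt (𝓡 N) x).symm (y + s • w) ∈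
      (chartAt (EuclideanSpace ℝ (Fin N)) x).source := by
    simpa using (extChartAt (𝓡 N) x).map_target h
  rw [TangentBundle.symmL_trivializationAt hsrc, (extChartAt (𝓡 N) x).right_inv h]
  have h1 : HasMFDerivAt 𝓘(ℝ, ℝ) 𝓘(ℝ, EuclideanSpace ℝ (Fin N))
      (fun s : ℝ => y + s • w) s ((1 : ℝ →L[ℝ] ℝ).smulRight w) := by
    have : HasDerivAt (fun s : ℝ => y + s • w) w s := by
      simpa using ((hasDerivAt_id s).smul_const w).const_add y
    exact this.hasFDerivAt.hasMFDerivAt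
  have h2 : HasMFDerivAt 𝓘(ℝ, EuclideanSpace ℝ (Fin N)) (𝓡 N) (extChartAt (𝓡 N) x).symm
      (y + s • w) (mfderivWithin 𝓘(ℝ, EuclideanSpace ℝ (Fin N)) (𝓡 N)
        (extChartAt (𝓡 N) x).symm (range (𝓡 N)) (y + s • w)) :=
    (mdifferentiableWithinAt_extChartAt_symm h).hasMFDerivWithinAt.hasMFDerivAt (by simp)
  have h3 := (HasMFDerivAt.comp s h2 h1).mfderiv
  refine (congrArg (fun A => A (1 : ℝ)) h3).trans ?_
  set A := mfderivWithin 𝓘(ℝ, EuclideanSpace ℝ (Fin N)) (𝓡 N)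
        (extChartAt (𝓡 N) x).symm (range (𝓡 N)) (y + s • w)
  change A ((1 : ℝ) • w) = A w
  rw [one_smul]

theorem contMDiffOn_extChartAt_symm_line (x : M) (y w : EuclideanSpace ℝ (Fin N)) (s : Set ℝ)
    (h : ∀ t ∈ s, y + t • w ∈ (extChartAt (𝓡 N) x).target) :
    ContMDiffOn 𝓘(ℝ, ℝ) (𝓡 N) 1 (fun s : ℝ => (extChartAt (𝓡 N) x).symm (y + s • w)) s := by
  have : ContMDiff 𝓘(ℝ, ℝ) 𝓘(ℝ, EuclideanSpace ℝ (Fin N)) 1 (fun s : ℝ => y + s • w) := by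
    rw [contMDiff_iff_contDiff]
    fun_prop
  exact (contMDiffOn_extChartAt_symm (n := 1) x).comp this.contMDiffOn h

variable [RiemannianBundle (fun x : M => TangentSpace (𝓡 N) x)]

/-- The distance is at most the length of the image of the coordinate segment, whose velocity is w
read in the trivialization at x. -/
theorem dist_extChartAt_symm_line_le [IsRiemannianManifold (𝓡 N) M]
    (x : M) (y w : EuclideanSpace ℝ (Fin N)) {a b C : ℝ} (hab : a ≤ b) (hC : 0 ≤ C)
    (h : ∀ s ∈ Icc a b, y + s • w ∈ (extChartAt (𝓡 N) x).target)
    (hn : ∀ s ∈ Icc a b, ‖(trivializationAt (EuclideanSpace ℝ (Fin N))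
      (TangentSpace (𝓡 N)) x).symmL ℝ
        ((extChartAt (𝓡 N) x).symm (y + s • w)) w‖ ≤ C) :
    dist ((extChartAt (𝓡 N) x).symm (y + a • w)) ((extChartAt (𝓡 N) x).symm (y + b • w))
      ≤ C * (b - a) := by
  have h0 : edist ((extChartAt (𝓡 N) x).symm (y + a • w)) ((extChartAt (𝓡 N) x).symm (y + b • w))
      ≤ ENNReal.ofReal (C * (b - a)) := by
    rw [IsRiemannianManifold.out (I := 𝓡 N)]
    refine (Manifold.riemannianEDist_le_pathELength
      (contMDiffOn_extChartAt_symm_line x y w (Icc a b) h) rfl rfl hab).trans ?_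
    rw [Manifold.pathELength_eq_lintegral_mfderiv_Icc]
    refine (setLIntegral_mono' (g := fun _ => ENNReal.ofReal C) measurableSet_Icc
      (fun t ht => ?_)).trans ?_
    · have := mfderiv_extChartAt_symm_line x y w t (h t ht)
      refine (le_of_eq (congrArg enorm this)).trans ?_
      rw [← ofReal_norm]
      exact ENNReal.ofReal_le_ofReal (hn t ht)
    · rw [lintegral_const, Measure.restrict_apply_univ, Real.volume_Icc, ENNReal.ofReal_mul hC]
  rw [edist_dist] at h0
  exact (ENNReal.ofReal_le_ofReal_iff (mul_nonneg hC (sub_nonneg.2 hab))).1 h0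

variable [IsContinuousRiemannianBundle (EuclideanSpace ℝ (Fin N))
      (fun x : M => TangentSpace (𝓡 N) x)]

theorem continuous_norm_tangentBundle :
    Continuous (fun v : TangentBundle (𝓡 N) M => ‖v.2‖) := by
  have h : Continuous (fun v : TangentBundle (𝓡 N) M => inner ℝ v.2 v.2) :=
    Continuous.inner_bundle (F := EuclideanSpace ℝ (Fin N))
      (E := (TangentSpace (𝓡 N) : M → Type)) (b := fun v : TangentBundle (𝓡 N) M => v.1)
      (v := fun v => v.2) (w := fun v => v.2) continuous_id continuous_id
  refine (Real.continuous_sqrt.comp h).congr fun v => ?_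
  simp

/-- Local boundedness of this norm makes charts Lipschitz; its continuity at the base point is what
gives the exact constant L in `abs_spaceDeriv_le`. -/
theorem continuousAt_norm_symmL (x : M) (w : EuclideanSpace ℝ (Fin N)) :
    ContinuousAt (fun y : M =>
      ‖(trivializationAt (EuclideanSpace ℝ (Fin N)) (TangentSpace (𝓡 N)) x).symmL ℝ y w‖) x := by
  set e := trivializationAt (EuclideanSpace ℝ (Fin N)) (TangentSpace (𝓡 N) : M → Type) x
  have hx : x ∈ e.baseSet := FiberBundle.mem_baseSet_trivializationAt' x
  have h2 : ContinuousAt (fun y : M => e.toOpenPartialHomeomorph.symm (y, w)) x := by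
    have h3 : ContinuousAt e.toOpenPartialHomeomorph.symm (x, w) :=
      e.toOpenPartialHomeomorph.symm.continuousAt (by simpa [e.target_eq] using hx)
    exact h3.comp (f := fun y : M => (y, w)) (Continuous.continuousAt (by fun_prop))
  have h4 : ContinuousAt (fun y : M => ‖(e.toOpenPartialHomeomorph.symm (y, w)).2‖) x :=
    continuous_norm_tangentBundle.continuousAt.comp h2
  refine h4.congr ?_
  filter_upwards [e.open_baseSet.mem_nhds hx] with y hy
  have h5 := e.mk_symm hy w
  have h6 := Trivialization.symmL_apply (R := ℝ)
    (trivializationAt (EuclideanSpace ℝ (Fin N)) (TangentSpace (𝓡 N) : M → Type) x) hy w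
  refine Eq.trans ?_ (congrArg norm h6.symm)
  change ‖(e.toOpenPartialHomeomorph.symm (y, w)).2‖ = ‖e.symm y w‖
  rw [← h5]

variable [IsRiemannianManifold (𝓡 N) M]

/-- The inverse of an extended chart is locally Lipschitz. -/
theorem exists_lipschitzOnWith_extChartAt_symm (x : M) :
    ∃ C : ℝ≥0, ∃ r > 0, Metric.ball (extChartAt (𝓡 N) x x) r ⊆ (extChartAt (𝓡 N) x).target ∧
      LipschitzOnWith C (extChartAt (𝓡 N) x).symm (Metric.ball (extChartAt (𝓡 N) x x) r) := by
  obtain ⟨C, hC0, hC⟩ := eventually_norm_symmL_trivializationAt_lt (EuclideanSpace ℝ (Fin N))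
    (fun x : M => TangentSpace (𝓡 N) x) x
  have h1 : ∀ᶠ y in 𝓝 (extChartAt (𝓡 N) x x), y ∈ (extChartAt (𝓡 N) x).target ∧
      ‖(trivializationAt (EuclideanSpace ℝ (Fin N)) (TangentSpace (𝓡 N)) x).symmL ℝ
        ((extChartAt (𝓡 N) x).symm y)‖ < C := by
    refine Filter.Eventually.and (extChartAt_target_mem_nhds (I := 𝓡 N) x) ?_
    have := (continuousAt_extChartAt_symm (I := 𝓡 N) x).tendsto
    rw [extChartAt_to_inv] at this
    exact this.eventually hC
  obtain ⟨r, hr, hball⟩ := Metric.eventually_nhds_iff_ball.1 h1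
  refine ⟨⟨C, hC0.le⟩, r, hr, fun y hy => (hball y hy).1, ?_⟩
  refine LipschitzOnWith.of_dist_le_mul fun y hy z hz => ?_
  have hseg : ∀ s ∈ Icc (0 : ℝ) 1, y + s • (z - y) ∈ Metric.ball (extChartAt (𝓡 N) x x) r :=
    fun s hs => (convex_ball _ _).add_smul_sub_mem hy hz hs
  have := dist_extChartAt_symm_line_le (N := N) x y (z - y) (a := 0) (b := 1)
    (C := C * ‖z - y‖) zero_le_one (by positivity) (fun s hs => (hball _ (hseg s hs)).1)
    (fun s hs => ?_)
  · simp only [zero_smul, add_zero, one_smul, add_sub_cancel, sub_zero, mul_one] at this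
    rwa [dist_comm y z, dist_eq_norm z y]
  · refine (ContinuousLinearMap.le_opNorm _ _).trans ?_
    gcongr
    exact (hball _ (hseg s hs)).2.le

/-- The directional derivative of a function is bounded by its Lipschitz constant. -/
theorem abs_spaceDeriv_le (f : M → ℝ) (x : M) {L : ℝ} (hL : 0 ≤ L)
    (h : ∀ᶠ y in 𝓝 x, |f y - f x| ≤ L * dist x y) (w : TangentSpace (𝓡 N) x) :
    |spaceDeriv f x w| ≤ L * ‖w‖ := by
  by_cases hf : MDifferentiableAt (𝓡 N) 𝓘(ℝ, ℝ) f x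
  swap
  · have : spaceDeriv f x w = 0 := by
      rw [spaceDeriv, mfderiv_zero_of_not_mdifferentiableAt hf]; rfl
    rw [this, abs_zero]; positivity
  set e := trivializationAt (EuclideanSpace ℝ (Fin N)) (TangentSpace (𝓡 N) : M → Type) x with he
  have hx : x ∈ e.baseSet := FiberBundle.mem_baseSet_trivializationAt' x
  set φ := extChartAt (𝓡 N) x with hφ
  set w' : EuclideanSpace ℝ (Fin N) := e.continuousLinearMapAt ℝ x w with hw'
  have hww' : e.symmL ℝ x w' = w := e.symmL_continuousLinearMapAt hx w
  -- A curve through x with initial velocity w. Its speed stays below ‖w‖ + δ for small times, so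
  -- the difference quotients of f along it are at most L (‖w‖ + δ), and δ is arbitrary.
  set γ : ℝ → M := fun s => φ.symm (φ x + s • w') with hγ
  have hγ0 : γ 0 = x := by simp [hγ, hφ]
  have hline : Continuous (fun s : ℝ => φ x + s • w') := by fun_prop
  have hl0 : φ x + (0 : ℝ) • w' = φ x := by simp
  have hline0 : Tendsto (fun s : ℝ => φ x + s • w') (𝓝 0) (𝓝 (φ x)) := by
    simpa using hline.tendsto 0
  have htarget : ∀ᶠ s in 𝓝 (0 : ℝ), φ x + s • w' ∈ φ.target :=
    hline0.eventually (extChartAt_target_mem_nhds x)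
  have hγc : Tendsto γ (𝓝 0) (𝓝 x) := by
    have := (continuousAt_extChartAt_symm (I := 𝓡 N) x).tendsto
    rw [extChartAt_to_inv] at this
    exact this.comp hline0
  have hγd : MDifferentiableAt 𝓘(ℝ, ℝ) (𝓡 N) γ 0 := by
    obtain ⟨u, hu, huo, h0u⟩ := eventually_nhds_iff.1 htarget
    have hu' := contMDiffOn_extChartAt_symm_line x (φ x) w' {s | φ x + s • w' ∈ φ.target}
      (fun t ht => ht)
    exact (hu'.contMDiffAt htarget).mdifferentiableAt one_ne_zero
  have hder : HasDerivAt (f ∘ γ) (spaceDeriv f x w) 0 := by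
    have h1 : HasMFDerivAt (𝓡 N) 𝓘(ℝ, ℝ) f (γ 0) (mfderiv (𝓡 N) 𝓘(ℝ, ℝ) f (γ 0)) := by
      rw [hγ0]; exact hf.hasMFDerivAt
    have h2 := (HasMFDerivAt.comp (0 : ℝ) h1 hγd.hasMFDerivAt)
    rw [hasMFDerivAt_iff_hasFDerivAt] at h2
    have h3 : HasDerivAt (f ∘ γ) (spaceDeriv f (γ 0) (mfderiv 𝓘(ℝ, ℝ) (𝓡 N) γ 0 (1 : ℝ))) 0 :=
      HasFDerivAt.hasDerivAt (𝕜 := ℝ) (F := ℝ) h2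
    have h4 := mfderiv_extChartAt_symm_line x (φ x) w' 0
      (by rw [hl0]; exact mem_extChartAt_target x)
    have h5 : ∀ y, y = x → spaceDeriv f y (e.symmL ℝ y w') = spaceDeriv f x w := by
      rintro y rfl
      rw [hww']
    rw [← h5 (γ 0) hγ0]
    convert h3 using 1
    exact (congrArg (spaceDeriv f (γ 0)) h4).symm
  refine le_of_forall_pos_le_add fun ε hε => ?_
  obtain ⟨δ, hδ, hδε⟩ : ∃ δ > 0, L * δ ≤ ε := by
    refine ⟨ε / (L + 1), by positivity, ?_⟩
    rw [mul_div_assoc', div_le_iff₀ (by positivity)]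
    nlinarith
  have hnorm : ∀ᶠ s in 𝓝 (0 : ℝ), ‖e.symmL ℝ (γ s) w'‖ < ‖w‖ + δ := by
    have h1 : Tendsto (fun s => ‖e.symmL ℝ (γ s) w'‖) (𝓝 0) (𝓝 ‖e.symmL ℝ x w'‖) :=
      (continuousAt_norm_symmL x w').tendsto.comp hγc
    rw [hww'] at h1
    exact h1.eventually_lt_const (by linarith)
  obtain ⟨r, hr, hball⟩ := Metric.eventually_nhds_iff_ball.1 (hnorm.and htarget)
  have hlim := hder.tendsto_slope_zero_right.abs
  have hbound : ∀ᶠ s in 𝓝[>] (0 : ℝ), |s⁻¹ • ((f ∘ γ) (0 + s) - (f ∘ γ) 0)| ≤ L * (‖w‖ + δ) := by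
    filter_upwards [self_mem_nhdsWithin, nhdsWithin_le_nhds (hγc.eventually h),
      nhdsWithin_le_nhds (Metric.ball_mem_nhds (0 : ℝ) hr)] with s hs hfs hsr
    have hs0 : (0 : ℝ) < s := hs
    have hmem : ∀ t ∈ Icc (0 : ℝ) s, t ∈ Metric.ball (0 : ℝ) r := fun t ht => by
      rw [Metric.mem_ball, Real.dist_eq, sub_zero, abs_of_nonneg] at hsr ⊢ <;>
        linarith [ht.1, ht.2]
    have hd := dist_extChartAt_symm_line_le x (φ x) w' hs0.le (C := ‖w‖ + δ) (by positivity)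
      (fun t ht => (hball t (hmem t ht)).2) (fun t ht => (hball t (hmem t ht)).1.le)
    have hd' : dist x (γ s) ≤ (‖w‖ + δ) * s := by
      have hd2 : dist (γ 0) (γ s) ≤ (‖w‖ + δ) * (s - 0) := hd
      rw [sub_zero] at hd2
      rwa [hγ0] at hd2
    simp only [zero_add, Function.comp_apply, hγ0, smul_eq_mul, abs_mul, abs_inv, abs_of_pos hs0]
    rw [inv_mul_le_iff₀ hs0]
    calc _ ≤ L * dist x (γ s) := hfs
      _ ≤ L * ((‖w‖ + δ) * s) := by gcongr
      _ = _ := by ring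
  have := le_of_tendsto hlim hbound
  linarith

theorem inner_spaceGrad (ψ : M × ℝ → ℝ) (z : M × ℝ) (w : TangentSpace (𝓡 N) z.1) :
    inner ℝ (spaceGrad ψ z) w = spaceDeriv (fun y => ψ (y, z.2)) z.1 w := by
  have : FiniteDimensional ℝ (TangentSpace (𝓡 N) z.1) :=
    inferInstanceAs (FiniteDimensional ℝ (EuclideanSpace ℝ (Fin N)))
  have : CompleteSpace (TangentSpace (𝓡 N) z.1) := FiniteDimensional.complete ℝ _
  exact InnerProductSpace.toDual_symm_apply

/-- The bound for directional derivatives is applied in the direction of the gradient itself. -/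
theorem norm_spaceGrad_le (ψ : M × ℝ → ℝ) (z : M × ℝ) {L : ℝ} (hL : 0 ≤ L)
    (h : ∀ᶠ y in 𝓝 z.1, |ψ (y, z.2) - ψ z| ≤ L * dist z.1 y) :
    ‖(spaceGrad ψ z : TangentSpace (𝓡 N) z.1)‖ ≤ L := by
  have h1 := abs_spaceDeriv_le (N := N) (fun y => ψ (y, z.2)) z.1 hL h (spaceGrad ψ z)
  rw [← inner_spaceGrad, real_inner_self_eq_norm_sq, abs_of_nonneg (by positivity)] at h1
  by_contra hlt
  push Not at hlt
  nlinarith [norm_nonneg (spaceGrad ψ z : TangentSpace (𝓡 N) z.1)]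

/-- The Riemannian measure of a Riemannian manifold is locally finite. -/
theorem isLocallyFiniteMeasure_euclideanHausdorffMeasure [MeasurableSpace M] [BorelSpace M] :
    IsLocallyFiniteMeasure (μHE[N] : Measure M) := by
  refine ⟨fun x => ?_⟩
  obtain ⟨C, r, hr, hball, hlip⟩ := exists_lipschitzOnWith_extChartAt_symm (N := N) x
  refine ⟨(extChartAt (𝓡 N) x).symm '' Metric.ball (extChartAt (𝓡 N) x x) r, ?_, ?_⟩
  · have : (extChartAt (𝓡 N) x) ⁻¹' Metric.ball (extChartAt (𝓡 N) x x) r ∈ 𝓝 x :=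
      (continuousAt_extChartAt x).preimage_mem_nhds (Metric.ball_mem_nhds _ hr)
    filter_upwards [this, extChartAt_source_mem_nhds (I := 𝓡 N) x] with y hy hy'
    exact ⟨_, hy, (extChartAt (𝓡 N) x).left_inv hy'⟩
  · rw [Measure.euclideanHausdorffMeasure_def, Measure.smul_apply]
    refine ENNReal.mul_lt_top ENNReal.coe_lt_top ?_
    refine (hlip.hausdorffMeasure_image_le (Nat.cast_nonneg N)).trans_lt ?_
    exact ENNReal.mul_lt_top (ENNReal.rpow_lt_top_of_nonneg (Nat.cast_nonneg N) (by simp))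
      measure_ball_lt_top

end Chart

/-! ### Rademacher's theorem and measurability of gradients on space-time -/

section Measurability

/-- Meant for g a local trivialization of the tangent bundle, which is continuous only over its base
set. The composition of g with a simple function is simple whatever g is off U, and continuity on U
suffices to pass to the limit. -/
theorem aemeasurable_comp_of_continuousOn {α β F : Type*} [MeasurableSpace α] {μ : Measure α}
    [TopologicalSpace β] [TopologicalSpace F] [TopologicalSpace.PseudoMetrizableSpace F]
    [MeasurableSpace F] [BorelSpace F] {f : α → β} (hf : AEStronglyMeasurable f μ)
      {g : β → F} {U : Set β}
    (hU : IsOpen U) (hg : ContinuousOn g U) (hfU : ∀ᵐ x ∂μ, f x ∈ U) :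
    AEMeasurable (fun x => g (f x)) μ := by
  obtain ⟨f', hf', hff'⟩ := hf
  have h1 : AEMeasurable (fun x => g (f' x)) μ := by
    refine aemeasurable_of_tendsto_metrizable_ae atTop
      (f := fun n x => g (hf'.approx n x)) (fun n => ?_) ?_
    · exact ((hf'.approx n).map g).measurable.aemeasurable
    · filter_upwards [hfU, hff'] with x hx hx'
      rw [hx'] at hx
      exact (hg.continuousAt (hU.mem_nhds hx)).tendsto.comp (hf'.tendsto_approx x)
  refine h1.congr ?_
  filter_upwards [hff'] with x hx
  rw [hx]

theorem measurableSet_inter_preimage_of_continuousOn {α β : Type*} [TopologicalSpace α]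
    [MeasurableSpace α] [OpensMeasurableSpace α] [TopologicalSpace β] [MeasurableSpace β]
    [BorelSpace β] {f : α → β} {O : Set α} (hO : IsOpen O) (hf : ContinuousOn f O) {B : Set β}
    (hB : MeasurableSet B) : MeasurableSet (O ∩ f ⁻¹' B) := by
  have h1 : Measurable (O.domRestrict f) := hf.domRestrict.measurable
  have h2 := hO.measurableSet.subtype_image (h1 hB)
  convert h2 using 1
  ext x
  simp [Set.domRestrict_apply, and_comm]

end Measurability

/-- A real-valued Lipschitz function on a product of balls extends to the whole space. The global
extension can be fed to Rademacher's theorem and to the measurability of derivatives depending on a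
parameter. -/
theorem _root_.LocallyLipschitz.exists_lipschitz_comp {X Y : Type*} [MetricSpace X]
    [MetricSpace Y] {ψ : X × ℝ → ℝ} (hψ : LocallyLipschitz ψ) {F : Y → X} {C : ℝ≥0} {y₀ : Y}
    {r : ℝ} (hr : 0 < r) (hlip : LipschitzOnWith C F (Metric.ball y₀ r)) (t₀ : ℝ) :
    ∃ (δ : ℝ) (K : ℝ≥0) (g : ℝ × Y → ℝ), 0 < δ ∧ δ ≤ r ∧ LipschitzWith K g ∧
      ∀ y ∈ Metric.ball y₀ δ, ∀ t ∈ Metric.ball t₀ δ, ψ (F y, t) = g (t, y) := by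
  obtain ⟨K, T, hT, hK⟩ := hψ (F y₀, t₀)
  have hF : ContinuousAt F y₀ := hlip.continuousOn.continuousAt (Metric.ball_mem_nhds _ hr)
  have h1 : Tendsto (fun p : ℝ × Y => (F p.2, p.1)) (𝓝 (t₀, y₀)) (𝓝 (F y₀, t₀)) := by
    have h2 : Tendsto (fun p : ℝ × Y => F p.2) (𝓝 (t₀, y₀)) (𝓝 (F y₀)) :=
      hF.tendsto.comp (continuous_snd.tendsto (t₀, y₀))
    exact h2.prodMk_nhds (continuous_fst.tendsto (t₀, y₀))
  obtain ⟨δ, hδ, hδT⟩ := Metric.nhds_basis_ball.mem_iff.1 (h1 hT)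
  have hρ : 0 < min r δ := lt_min hr hδ
  have hsub : Metric.ball y₀ (min r δ) ⊆ Metric.ball y₀ r :=
    Metric.ball_subset_ball (min_le_left _ _)
  have h3 : LipschitzOnWith (K * max C 1) (ψ ∘ fun p : ℝ × Y => (F p.2, p.1))
      (Metric.ball t₀ (min r δ) ×ˢ Metric.ball y₀ (min r δ)) := by
    refine hK.comp ?_ ?_
    · refine LipschitzOnWith.of_dist_le_mul fun p hp p' hp' => ?_
      have hC : (C : ℝ) ≤ max (C : ℝ) 1 := le_max_left _ _
      have h1' : (1 : ℝ) ≤ max (C : ℝ) 1 := le_max_right _ _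
      rw [Prod.dist_eq, NNReal.coe_max, NNReal.coe_one]
      refine max_le ?_ ?_
      · refine (hlip.dist_le_mul _ (hsub hp.2) _ (hsub hp'.2)).trans ?_
        exact mul_le_mul hC (le_max_right _ _) dist_nonneg (by positivity)
      · calc dist p.1 p'.1 = 1 * dist p.1 p'.1 := (one_mul _).symm
          _ ≤ _ := mul_le_mul h1' (le_max_left _ _) dist_nonneg (by positivity)
    · rintro p ⟨hp1, hp2⟩
      refine hδT ?_
      rw [← ball_prod_same]
      exact ⟨Metric.ball_subset_ball (min_le_right _ _) hp1,
        Metric.ball_subset_ball (min_le_right _ _) hp2⟩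
  obtain ⟨g, hg, hgeq⟩ := h3.extend_real
  exact ⟨min r δ, K * max C 1, g, hρ, min_le_left _ _, hg, fun y hy t ht =>
    hgeq (x := (t, y)) ⟨ht, hy⟩⟩

section Rademacher

variable {N : ℕ} {M : Type*} [MetricSpace M]
  [ChartedSpace (EuclideanSpace ℝ (Fin N)) M] [IsManifold (𝓡 N) ∞ M]
  [RiemannianBundle (fun x : M => TangentSpace (𝓡 N) x)]
  [IsContinuousRiemannianBundle (EuclideanSpace ℝ (Fin N))
      (fun x : M => TangentSpace (𝓡 N) x)]
  [IsRiemannianManifold (𝓡 N) M]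

/-- A locally Lipschitz function on space-time is, in a chart, a Lipschitz function. -/
theorem exists_lipschitz_chart_representation {ψ : M × ℝ → ℝ} (hψ : LocallyLipschitz ψ)
    (z₀ : M × ℝ) :
    ∃ (r : ℝ) (C K : ℝ≥0) (g : ℝ × EuclideanSpace ℝ (Fin N) → ℝ), 0 < r ∧ LipschitzWith K g ∧
      LipschitzOnWith C (extChartAt (𝓡 N) z₀.1).symm
        (Metric.ball (extChartAt (𝓡 N) z₀.1 z₀.1) r) ∧
      ∀ y ∈ Metric.ball (extChartAt (𝓡 N) z₀.1 z₀.1) r, ∀ t ∈ Metric.ball z₀.2 r,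
        ψ ((extChartAt (𝓡 N) z₀.1).symm y, t) = g (t, y) := by
  obtain ⟨C, r, hr, -, hlip⟩ := exists_lipschitzOnWith_extChartAt_symm (N := N) z₀.1
  obtain ⟨δ, K, g, hδ, hδr, hg, hgψ⟩ := hψ.exists_lipschitz_comp hr hlip z₀.2
  exact ⟨δ, C, K, g, hδ, hg, hlip.mono (Metric.ball_subset_ball hδr), hgψ⟩

/-- The domain in space-time of a chart at a point. -/
def chartBox (N : ℕ) {M : Type*} [MetricSpace M] [ChartedSpace (EuclideanSpace ℝ (Fin N)) M]
    (z₀ : M × ℝ) (r : ℝ) : Set (M × ℝ) :=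
  ((extChartAt (𝓡 N) z₀.1).source ∩
    extChartAt (𝓡 N) z₀.1 ⁻¹' Metric.ball (extChartAt (𝓡 N) z₀.1 z₀.1) r) ×ˢ Metric.ball z₀.2 r

theorem isOpen_chartBox (z₀ : M × ℝ) (r : ℝ) : IsOpen (chartBox N z₀ r) := by
  refine IsOpen.prod ?_ Metric.isOpen_ball
  exact isOpen_extChartAt_preimage' (I := 𝓡 N) z₀.1 Metric.isOpen_ball

theorem mem_chartBox (z₀ : M × ℝ) {r : ℝ} (hr : 0 < r) : z₀ ∈ chartBox N z₀ r :=
  ⟨⟨mem_extChartAt_source _, by simpa using hr⟩, by simpa using hr⟩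

theorem eventuallyEq_of_mem_chartBox {ψ : M × ℝ → ℝ} {z₀ : M × ℝ} {r : ℝ}
    {g : ℝ × EuclideanSpace ℝ (Fin N) → ℝ}
    (h : ∀ y ∈ Metric.ball (extChartAt (𝓡 N) z₀.1 z₀.1) r, ∀ t ∈ Metric.ball z₀.2 r,
        ψ ((extChartAt (𝓡 N) z₀.1).symm y, t) = g (t, y)) {z : M × ℝ} (hz : z ∈ chartBox N z₀ r) :
    (fun y => ψ (y, z.2)) =ᶠ[𝓝 z.1] (fun y => g (z.2, y)) ∘ extChartAt (𝓡 N) z₀.1 := by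
  have ho := isOpen_extChartAt_preimage' (I := 𝓡 N) z₀.1
    (Metric.isOpen_ball (x := extChartAt (𝓡 N) z₀.1 z₀.1) (ε := r))
  filter_upwards [ho.mem_nhds hz.1] with y hy
  have := h _ hy.2 _ hz.2
  rwa [(extChartAt (𝓡 N) z₀.1).left_inv hy.1] at this

/-- The direction is read in the trivialization at the fixed centre z₀, not at z, so that all terms
depend measurably on z in the box. -/
theorem mdifferentiableAt_of_mem_chartBox {ψ : M × ℝ → ℝ} {z₀ : M × ℝ} {r : ℝ}
    {g : ℝ × EuclideanSpace ℝ (Fin N) → ℝ}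
    (h : ∀ y ∈ Metric.ball (extChartAt (𝓡 N) z₀.1 z₀.1) r, ∀ t ∈ Metric.ball z₀.2 r,
        ψ ((extChartAt (𝓡 N) z₀.1).symm y, t) = g (t, y)) {z : M × ℝ} (hz : z ∈ chartBox N z₀ r)
    (hg : DifferentiableAt ℝ (fun y => g (z.2, y)) (extChartAt (𝓡 N) z₀.1 z.1)) :
    MDifferentiableAt (𝓡 N) 𝓘(ℝ, ℝ) (fun y => ψ (y, z.2)) z.1 ∧
    ∀ w : TangentSpace (𝓡 N) z.1, spaceDeriv (fun y => ψ (y, z.2)) z.1 w =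
      fderiv ℝ (fun y => g (z.2, y)) (extChartAt (𝓡 N) z₀.1 z.1)
        (trivializationAt (EuclideanSpace ℝ (Fin N)) (TangentSpace (𝓡 N)) z₀.1 ⟨z.1, w⟩).2 := by
  have hsrc : z.1 ∈ (chartAt (EuclideanSpace ℝ (Fin N)) z₀.1).source := by
    simpa using hz.1.1
  have h1 := eventuallyEq_of_mem_chartBox h hz
  have h2 : HasMFDerivAt (𝓡 N) 𝓘(ℝ, EuclideanSpace ℝ (Fin N)) (extChartAt (𝓡 N) z₀.1) z.1
      (mfderiv (𝓡 N) 𝓘(ℝ, EuclideanSpace ℝ (Fin N)) (extChartAt (𝓡 N) z₀.1) z.1) :=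
    (mdifferentiableAt_extChartAt hsrc).hasMFDerivAt
  have h3 := (HasMFDerivAt.comp z.1 hg.hasFDerivAt.hasMFDerivAt h2).congr_of_eventuallyEq h1
  refine ⟨h3.mdifferentiableAt, fun w => ?_⟩
  have h4 := congrArg (fun A => A w) h3.mfderiv
  have h5 := TangentBundle.continuousLinearMapAt_trivializationAt (I := 𝓡 N) hsrc
  have h6 := Trivialization.continuousLinearMapAt_apply_of_mem (R := ℝ)
    (trivializationAt (EuclideanSpace ℝ (Fin N)) (TangentSpace (𝓡 N) : M → Type) z₀.1)
    (b := z.1) hsrc w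
  refine h4.trans ?_
  refine congrArg (fderiv ℝ (fun y => g (z.2, y)) (extChartAt (𝓡 N) z₀.1 z.1)) ?_
  exact (congrArg (fun A => A w) h5.symm).trans h6

variable [MeasurableSpace M] [BorelSpace M] [SecondCountableTopology M]

theorem continuousOn_chartBox (z₀ : M × ℝ) (r : ℝ) :
    ContinuousOn (fun z : M × ℝ => (z.2, extChartAt (𝓡 N) z₀.1 z.1)) (chartBox N z₀ r) := by
  refine continuousOn_snd.prodMk ?_
  exact (continuousOn_extChartAt (I := 𝓡 N) z₀.1).comp continuousOn_fst fun z hz => hz.1.1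

/-- For fixed t, Rademacher's theorem in ℝ^N gives a Lebesgue null set, which the Lipschitz inverse
chart maps to a null set of M. Fubini's theorem then applies because the exceptional set is
measurable. -/
theorem ae_differentiableAt_of_mem_chartBox [SFinite (μHE[N] : Measure M)] {z₀ : M × ℝ} {r : ℝ}
    {C K : ℝ≥0} {g : ℝ × EuclideanSpace ℝ (Fin N) → ℝ} (hg : LipschitzWith K g)
    (hlip : LipschitzOnWith C (extChartAt (𝓡 N) z₀.1).symm
        (Metric.ball (extChartAt (𝓡 N) z₀.1 z₀.1) r)) :
    ∀ᵐ z ∂((μHE[N] : Measure M).prod volume), z ∈ chartBox N z₀ r →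
      DifferentiableAt ℝ (fun y => g (z.2, y)) (extChartAt (𝓡 N) z₀.1 z.1) := by
  set D : Set (ℝ × EuclideanSpace ℝ (Fin N)) :=
    {p | DifferentiableAt ℝ (fun y => g (p.1, y)) p.2} with hD
  have hDm : MeasurableSet D :=
    measurableSet_of_differentiableAt_with_param ℝ (f := fun t y => g (t, y)) hg.continuous
  set B : Set (M × ℝ) :=
    chartBox N z₀ r ∩ (fun z : M × ℝ => (z.2, extChartAt (𝓡 N) z₀.1 z.1)) ⁻¹' Dᶜ with hB
  have hBm : MeasurableSet B := measurableSet_inter_preimage_of_continuousOn (isOpen_chartBox z₀ r)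
    (continuousOn_chartBox z₀ r) hDm.compl
  refine measure_mono_null (t := B) ?_ ?_
  · intro z hz
    have hz' := Classical.not_imp.1 hz
    exact ⟨hz'.1, hz'.2⟩
  · rw [Measure.prod_apply_symm hBm, lintegral_eq_zero_iff (measurable_measure_prodMk_right hBm)]
    refine Eventually.of_forall fun t => ?_
    have hgt : LipschitzWith (K * 1) (fun y => g (t, y)) :=
      hg.comp (LipschitzWith.prodMk_left (β := EuclideanSpace ℝ (Fin N)) t)
    have hnull : volume {y : EuclideanSpace ℝ (Fin N) |
        ¬ DifferentiableAt ℝ (fun y => g (t, y)) y} = 0 := hgt.ae_differentiableAt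
    refine measure_mono_null (t := (extChartAt (𝓡 N) z₀.1).symm ''
      (Metric.ball (extChartAt (𝓡 N) z₀.1 z₀.1) r ∩
        {y | ¬ DifferentiableAt ℝ (fun y => g (t, y)) y})) ?_ ?_
    · rintro x ⟨⟨hx1, hx2⟩, hxD⟩
      exact ⟨_, ⟨hx1.2, hxD⟩, (extChartAt (𝓡 N) z₀.1).left_inv hx1.1⟩
    · exact euclideanHausdorffMeasure_image_eq_zero (hlip.mono inter_subset_left)
        (measure_mono_null inter_subset_right hnull)

/-- Rademacher's theorem on slices: a locally Lipschitz function on space-time is differentiable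
in space almost everywhere. -/
theorem ae_mdifferentiableAt [SFinite (μHE[N] : Measure M)]
    {ψ : M × ℝ → ℝ} (hψ : LocallyLipschitz ψ) :
    ∀ᵐ z ∂((μHE[N] : Measure M).prod volume),
      MDifferentiableAt (𝓡 N) 𝓘(ℝ, ℝ) (fun y => ψ (y, z.2)) z.1 := by
  refine measure_null_of_locally_null _ fun z₀ _ => ?_
  obtain ⟨r, C, K, g, hr, hg, hlip, h⟩ :=
    exists_lipschitz_chart_representation (N := N) hψ z₀
  refine ⟨_, inter_mem_nhdsWithin _
    ((isOpen_chartBox (N := N) z₀ r).mem_nhds (mem_chartBox z₀ hr)), ?_⟩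
  refine measure_mono_null ?_ (ae_differentiableAt_of_mem_chartBox hg hlip)
  rintro z ⟨hz, hzO⟩ hzD
  exact hz (mdifferentiableAt_of_mem_chartBox h hzO (hzD hzO)).1

/-- A locally Lipschitz function on space-time is differentiable in time almost everywhere. -/
theorem ae_differentiableAt_time {X : Type*} [MetricSpace X] [MeasurableSpace X] [BorelSpace X]
    [SecondCountableTopology X] {μ : Measure X}
    {ψ : X × ℝ → ℝ} (hψ : LocallyLipschitz ψ) :
    ∀ᵐ z ∂(μ.prod volume), DifferentiableAt ℝ (fun s => ψ (z.1, s)) z.2 := by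
  have hm : MeasurableSet {z : X × ℝ | DifferentiableAt ℝ (fun s => ψ (z.1, s)) z.2} :=
    measurableSet_of_differentiableAt_with_param ℝ (f := fun x s => ψ (x, s)) hψ.continuous
  refine (Measure.measure_prod_null hm.compl).2 (Eventually.of_forall fun x => ?_)
  refine measure_null_of_locally_null _ fun t _ => ?_
  obtain ⟨K, T, hT, hK⟩ := hψ (x, t)
  have hS : (fun s : ℝ => (x, s)) ⁻¹' T ∈ 𝓝 t :=
    (Continuous.continuousAt (by fun_prop)).preimage_mem_nhds hT
  obtain ⟨δ, hδ, hδT⟩ := Metric.nhds_basis_ball.mem_iff.1 hS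
  refine ⟨_, inter_mem_nhdsWithin _ (Metric.ball_mem_nhds t hδ), ?_⟩
  have hlip : LipschitzOnWith (K * 1) (fun s => ψ (x, s)) (Metric.ball t δ) :=
    hK.comp ((LipschitzWith.prodMk_left (β := ℝ) x).lipschitzOnWith) hδT
  refine measure_mono_null ?_ (hlip.ae_differentiableWithinAt_of_mem (μ := volume))
  rintro s ⟨hs, hsb⟩ hd
  exact hs ((hd hsb).differentiableAt (Metric.isOpen_ball.mem_nhds hsb))

/-- In a chart the pairing is the Fréchet derivative of a Lipschitz function, with t as parameter,
applied to the coordinates of X. Countably many chart boxes cover space-time. -/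
theorem aemeasurable_inner_spaceGrad [SFinite (μHE[N] : Measure M)]
    {ψ : M × ℝ → ℝ} (hψ : LocallyLipschitz ψ)
    {ν : Measure (M × ℝ)} (hν : ν ≪ (μHE[N] : Measure M).prod volume)
    {X : ∀ z : M × ℝ, TangentSpace (𝓡 N) z.1}
    (hX : AEStronglyMeasurable (fun z => (⟨z.1, X z⟩ : TangentBundle (𝓡 N) M)) ν) :
    AEMeasurable (fun z => (inner ℝ (spaceGrad ψ z) (X z) : ℝ)) ν := by
  have hloc : ∀ z₀ : M × ℝ, ∃ O : Set (M × ℝ), IsOpen O ∧ z₀ ∈ O ∧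
      AEMeasurable (fun z => (inner ℝ (spaceGrad ψ z) (X z) : ℝ)) (ν.restrict O) := by
    intro z₀
    obtain ⟨r, C, K, g, hr, hg, hlip, h⟩ :=
      exists_lipschitz_chart_representation (N := N) hψ z₀
    have hO := isOpen_chartBox (N := N) z₀ r
    refine ⟨chartBox N z₀ r, hO, mem_chartBox z₀ hr, ?_⟩
    set e := trivializationAt (EuclideanSpace ℝ (Fin N)) (TangentSpace (𝓡 N) : M → Type) z₀.1
    have h1 : AEMeasurable (fun z : M × ℝ => (z.2, extChartAt (𝓡 N) z₀.1 z.1))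
        (ν.restrict (chartBox N z₀ r)) :=
      (continuousOn_chartBox z₀ r).aemeasurable hO.measurableSet
    have h2 : AEMeasurable (fun z : M × ℝ => (e ⟨z.1, X z⟩).2) (ν.restrict (chartBox N z₀ r)) := by
      refine aemeasurable_comp_of_continuousOn (g := fun v : TangentBundle (𝓡 N) M => (e v).2)
        hX.restrict e.open_source (continuous_snd.comp_continuousOn e.continuousOn) ?_
      filter_upwards [ae_restrict_mem hO.measurableSet] with z hz
      rw [e.mem_source]
      have h0 : z.1 ∈ (chartAt (EuclideanSpace ℝ (Fin N)) z₀.1).source := by simpa using hz.1.1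
      exact h0
    have h3 : AEMeasurable (fun z : M × ℝ =>
        fderiv ℝ (fun y => g (z.2, y)) (extChartAt (𝓡 N) z₀.1 z.1))
          (ν.restrict (chartBox N z₀ r)) :=
      (measurable_fderiv_with_param ℝ (f := fun t y => g (t, y)) hg.continuous).comp_aemeasurable h1
    have h4 : AEMeasurable (fun z : M × ℝ =>
        fderiv ℝ (fun y => g (z.2, y)) (extChartAt (𝓡 N) z₀.1 z.1) (e ⟨z.1, X z⟩).2)
        (ν.restrict (chartBox N z₀ r)) :=
      (isBoundedBilinearMap_apply (𝕜 := ℝ) (E := EuclideanSpace ℝ (Fin N))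
        (F := ℝ)).continuous.measurable.comp_aemeasurable (h3.prodMk h2)
    refine h4.congr ?_
    filter_upwards [ae_restrict_mem hO.measurableSet,
      ae_restrict_of_ae (hν (ae_differentiableAt_of_mem_chartBox hg hlip))] with z hz hzD
    rw [inner_spaceGrad, (mdifferentiableAt_of_mem_chartBox h hz (hzD hz)).2]
  choose O hO hzO hOm using hloc
  obtain ⟨s, hs, hcov⟩ := TopologicalSpace.countable_cover_nhds
    (fun z => (hO z).mem_nhds (hzO z))
  have : AEMeasurable (fun z => (inner ℝ (spaceGrad ψ z) (X z) : ℝ))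
    (ν.restrict (⋃ z ∈ s, O z)) := by
    have := hs.to_subtype
    rw [biUnion_eq_iUnion, aemeasurable_iUnion_iff]
    exact fun z => hOm z
  rwa [hcov, Measure.restrict_univ] at this

end Rademacher

/-! ### Limits of integrals and calculus of locally Lipschitz functions -/

section Tools

theorem _root_.LocallyLipschitz.mul_real {X : Type*} [MetricSpace X] {f g : X → ℝ}
    (hf : LocallyLipschitz f) (hg : LocallyLipschitz g) : LocallyLipschitz fun x => f x * g x :=
  (contDiff_mul (𝕜 := ℝ) (𝔸 := ℝ) (n := 1)).locallyLipschitz.comp (hf.prodMk hg)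

theorem _root_.LipschitzOnWith.comp_locallyLipschitz {X : Type*} [MetricSpace X] {f : X → ℝ}
    {G : ℝ → ℝ} {s : Set ℝ} {K : ℝ≥0} (hG : LipschitzOnWith K G s) (hf : LocallyLipschitz f)
    (hs : ∀ x, f x ∈ s) : LocallyLipschitz fun x => G (f x) := by
  intro x
  obtain ⟨C, T, hT, hC⟩ := hf x
  exact ⟨K * C, T, hT, hG.comp hC fun y _ => hs y⟩

theorem _root_.IsCompact.exists_forall_le_of_eventually {X : Type*} [TopologicalSpace X] {s : Set X}
    (hs : IsCompact s) {F : X → ℝ} (h : ∀ x, ∃ C, ∀ᶠ y in 𝓝 x, F y ≤ C) :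
    ∃ C, 0 ≤ C ∧ ∀ x ∈ s, F x ≤ C := by
  refine hs.induction_on (p := fun s => ∃ C, 0 ≤ C ∧ ∀ x ∈ s, F x ≤ C) ⟨0, le_rfl, by simp⟩ ?_ ?_ ?_
  · rintro s t hst ⟨C, hC0, hC⟩
    exact ⟨C, hC0, fun x hx => hC x (hst hx)⟩
  · rintro s t ⟨C, hC0, hC⟩ ⟨D, hD0, hD⟩
    refine ⟨max C D, hC0.trans (le_max_left _ _), ?_⟩
    rintro x (hx | hx)
    · exact (hC x hx).trans (le_max_left _ _)
    · exact (hD x hx).trans (le_max_right _ _)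
  · intro x _
    obtain ⟨C, hC⟩ := h x
    exact ⟨_, mem_nhdsWithin_of_mem_nhds hC, max C 0, le_max_right _ _,
      fun y hy => le_trans hy (le_max_left _ _)⟩

/-- Write bₙ fₙ = bₙ f' + bₙ (fₙ - f'): dominated convergence handles the first term, and the
uniform bound on bₙ the second. Every passage to the limit in the weak formulation has this form. -/
theorem tendsto_integral_mul {α : Type*} [MeasurableSpace α] {μ : Measure α} {b : ℕ → α → ℝ}
    {b' : α → ℝ} {f : ℕ → α → ℝ} {f' : α → ℝ} {C : ℝ} (hC : 0 ≤ C)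
    (hbm : ∀ n, AEStronglyMeasurable (b n) μ)
    (hbC : ∀ n, ∀ᵐ x ∂μ, |b n x| ≤ C) (hb : ∀ᵐ x ∂μ, Tendsto (fun n => b n x) atTop (𝓝 (b' x)))
    (hfm : ∀ n, AEStronglyMeasurable (f n) μ) (hf' : Integrable f' μ)
    (hf : Tendsto (fun n => ∫⁻ x, ENNReal.ofReal |f n x - f' x| ∂μ) atTop (𝓝 0)) :
    Tendsto (fun n => ∫ x, b n x * f n x ∂μ) atTop (𝓝 (∫ x, b' x * f' x ∂μ)) := by
  have h1 : Tendsto (fun n => ∫ x, b n x * f' x ∂μ) atTop (𝓝 (∫ x, b' x * f' x ∂μ)) := by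
    refine tendsto_integral_of_dominated_convergence (fun x => C * |f' x|)
      (fun n => (hbm n).mul hf'.1) (hf'.abs.const_mul C) (fun n => ?_) ?_
    · filter_upwards [hbC n] with x hx
      rw [Real.norm_eq_abs, abs_mul]
      gcongr
    · filter_upwards [hb] with x hx
      exact hx.mul_const _
  have hint : ∀ᶠ n in atTop, Integrable (fun x => f n x - f' x) μ := by
    filter_upwards [hf.eventually_lt_const ENNReal.zero_lt_top] with n hn
    refine ⟨(hfm n).sub hf'.1, ?_⟩
    rw [hasFiniteIntegral_iff_norm]
    exact hn
  have h2 : Tendsto (fun n => ∫ x, b n x * (f n x - f' x) ∂μ) atTop (𝓝 0) := by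
    have h3 : Tendsto (fun n => ENNReal.ofReal C * ∫⁻ x, ENNReal.ofReal |f n x - f' x| ∂μ) atTop
        (𝓝 0) := by
      simpa using ENNReal.Tendsto.const_mul hf (Or.inr ENNReal.ofReal_ne_top)
    have h4 := (ENNReal.tendsto_toReal ENNReal.zero_ne_top).comp h3
    refine squeeze_zero_norm' ?_ h4
    filter_upwards [hf.eventually_lt_const ENNReal.zero_lt_top] with n hn
    refine (norm_integral_le_lintegral_norm _).trans ?_
    refine ENNReal.toReal_mono (ENNReal.mul_ne_top ENNReal.ofReal_ne_top hn.ne) ?_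
    beta_reduce
    rw [← lintegral_const_mul' _ _ ENNReal.ofReal_ne_top]
    refine lintegral_mono_ae ?_
    filter_upwards [hbC n] with x hx
    rw [← ENNReal.ofReal_mul hC, Real.norm_eq_abs, abs_mul]
    gcongr
  have h5 := h1.add h2
  rw [add_zero] at h5
  refine h5.congr' ?_
  filter_upwards [hint] with n hn
  have hi1 : Integrable (fun x => b n x * f' x) μ :=
    hf'.bdd_mul (c := C) (hbm n) (hbC n)
  have hi2 : Integrable (fun x => b n x * (f n x - f' x)) μ :=
    hn.bdd_mul (c := C) (hbm n) (hbC n)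
  rw [← integral_add hi1 hi2]
  congr 1
  ext x
  ring

end Tools

theorem timeDeriv_eq_zero_of_notMem_tsupport {X : Type*} [MetricSpace X] {f : X × ℝ → ℝ} {z : X × ℝ}
    (hz : z ∉ tsupport f) :
    timeDeriv f z = 0 := by
  have h1 : f =ᶠ[𝓝 z] 0 := notMem_tsupport_iff_eventuallyEq.1 hz
  have h2 : (fun s => f (z.1, s)) =ᶠ[𝓝 z.2] fun _ => 0 :=
    (Continuous.tendsto (f := fun s : ℝ => (z.1, s)) (by fun_prop) z.2).eventually h1
  rw [timeDeriv, h2.deriv_eq, deriv_const]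

section Time

variable {X : Type*} [MetricSpace X]

theorem measurable_timeDeriv [MeasurableSpace X] [BorelSpace X] [SecondCountableTopology X]
    {f : X × ℝ → ℝ} (hf : Continuous f) :
    Measurable (timeDeriv f) :=
  measurable_deriv_with_param (f := fun x s => f (x, s)) hf

theorem abs_timeDeriv_le {f : X × ℝ → ℝ} {z : X × ℝ} {L : ℝ} (hL : 0 ≤ L)
    (h : ∀ᶠ s in 𝓝 z.2, |f (z.1, s) - f z| ≤ L * |s - z.2|) : |timeDeriv f z| ≤ L :=
  norm_deriv_le_of_lip' (f := fun s => f (z.1, s)) hL h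

theorem _root_.LocallyLipschitz.eventually_abs_timeDeriv_le
    {f : X × ℝ → ℝ} (hf : LocallyLipschitz f)
    (z₀ : X × ℝ) : ∃ C, ∀ᶠ z in 𝓝 z₀, |timeDeriv f z| ≤ C := by
  obtain ⟨K, T, hT, hK⟩ := hf z₀
  refine ⟨K, ?_⟩
  filter_upwards [eventually_mem_nhds_iff.2 hT] with z hz
  refine abs_timeDeriv_le K.2 ?_
  have hS : (fun s : ℝ => (z.1, s)) ⁻¹' T ∈ 𝓝 z.2 :=
    (Continuous.continuousAt (by fun_prop)).preimage_mem_nhds hz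
  filter_upwards [hS] with s hs
  have := hK.dist_le_mul _ hs _ (mem_of_mem_nhds hz)
  rw [Real.dist_eq] at this
  refine this.trans (le_of_eq ?_)
  rw [Prod.dist_eq]
  simp [Real.dist_eq]

theorem integral_timeDeriv_eq_zero [MeasurableSpace X] [BorelSpace X] [SecondCountableTopology X]
    {μ : Measure X} [SFinite μ] {f : X × ℝ → ℝ} (hf : LocallyLipschitz f)
    (hfc : HasCompactSupport f) : ∫ z, timeDeriv f z ∂(μ.prod volume) = 0 := by
  -- Without integrability the integral is 0 by convention, so no hypothesis on the measure is
  -- needed here.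
  by_cases hint : Integrable (timeDeriv f) (μ.prod volume)
  swap
  · exact integral_undef hint
  rw [integral_prod _ hint]
  refine integral_eq_zero_of_ae (Eventually.of_forall fun x => ?_)
  have hK : IsCompact (Prod.snd '' tsupport f) := hfc.isCompact.image continuous_snd
  obtain ⟨R, hR⟩ := hK.isBounded.subset_ball 0
  have hR' : ∀ t, R ≤ |t| → f (x, t) = 0 := fun t ht => by
    by_contra hne
    have := hR ⟨(x, t), subset_tsupport _ hne, rfl⟩
    simp at this
    linarith
  set a := max R 0 + 1 with ha
  have ha0 : R < a := by linarith [le_max_left R 0]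
  have ha1 : 0 < a := by linarith [le_max_right R 0]
  have hloc : LocallyLipschitz (fun s => f (x, s)) := hf.comp (LocallyLipschitz.prodMk_left x)
  obtain ⟨K, hK⟩ := (hloc.locallyLipschitzOn (s := uIcc (-a) a)).exists_lipschitzOnWith_of_compact
    isCompact_uIcc
  -- On each time line the function is Lipschitz, hence absolutely continuous, and it vanishes at
  -- both ends of [-a, a].
  have hftc := hK.absolutelyContinuousOnInterval.integral_deriv_eq_sub
  rw [hR' a (by rw [abs_of_pos ha1]; exact ha0.le),
    hR' (-a) (by rw [abs_neg, abs_of_pos ha1]; exact ha0.le), sub_zero] at hftc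
  rw [Pi.zero_apply, ← hftc]
  symm
  refine intervalIntegral.integral_eq_integral_of_support_subset ?_
  intro t ht
  by_contra hmem
  refine ht ?_
  have hta : a ≤ |t| := by
    by_contra hlt
    have := abs_lt.1 (not_le.1 hlt)
    exact hmem ⟨this.1, this.2.le⟩
  have : (fun s => f (x, s)) =ᶠ[𝓝 t] fun _ => 0 := by
    have h1 : ∀ᶠ s in 𝓝 t, R < |s| := continuous_abs.continuousAt.eventually_const_lt (by linarith)
    filter_upwards [h1] with s hs using hR' s hs.le
  rw [this.deriv_eq, deriv_const]

end Time

section Space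

variable {N : ℕ} {M : Type*} [MetricSpace M]
  [ChartedSpace (EuclideanSpace ℝ (Fin N)) M] [IsManifold (𝓡 N) ∞ M]
  [RiemannianBundle (fun x : M => TangentSpace (𝓡 N) x)]
  [IsContinuousRiemannianBundle (EuclideanSpace ℝ (Fin N))
      (fun x : M => TangentSpace (𝓡 N) x)]
  [IsRiemannianManifold (𝓡 N) M]

theorem _root_.LocallyLipschitz.eventually_norm_spaceGrad_le
    {f : M × ℝ → ℝ} (hf : LocallyLipschitz f)
    (z₀ : M × ℝ) : ∃ C, ∀ᶠ z in 𝓝 z₀, ‖(spaceGrad f z : TangentSpace (𝓡 N) z.1)‖ ≤ C := by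
  obtain ⟨K, T, hT, hK⟩ := hf z₀
  refine ⟨K, ?_⟩
  filter_upwards [eventually_mem_nhds_iff.2 hT] with z hz
  refine norm_spaceGrad_le _ _ K.2 ?_
  have hS : (fun y : M => (y, z.2)) ⁻¹' T ∈ 𝓝 z.1 :=
    (Continuous.continuousAt (by fun_prop)).preimage_mem_nhds hz
  filter_upwards [hS] with s hs
  have := hK.dist_le_mul _ hs _ (mem_of_mem_nhds hz)
  rw [Real.dist_eq] at this
  refine this.trans (le_of_eq ?_)
  rw [Prod.dist_eq, dist_comm z.1]
  simp

theorem inner_spaceGrad_mul_comp {η U : M × ℝ → ℝ} {G : ℝ → ℝ} {G' : ℝ} {z : M × ℝ}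
    (hη : MDifferentiableAt (𝓡 N) 𝓘(ℝ, ℝ) (fun y => η (y, z.2)) z.1)
    (hU : MDifferentiableAt (𝓡 N) 𝓘(ℝ, ℝ) (fun y => U (y, z.2)) z.1)
    (hG : HasDerivAt G G' (U z)) (w : TangentSpace (𝓡 N) z.1) :
    inner ℝ (spaceGrad (fun z => η z * G (U z)) z) w =
      G (U z) * inner ℝ (spaceGrad η z) w + η z * G' * inner ℝ (spaceGrad U z) w := by
  have h1 : HasMFDerivAt 𝓘(ℝ, ℝ) 𝓘(ℝ, ℝ) G ((fun y => U (y, z.2)) z.1)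
      (ContinuousLinearMap.toSpanSingleton ℝ G') := hG.hasFDerivAt.hasMFDerivAt
  have h2 := (hη.hasMFDerivAt.mul (HasMFDerivAt.comp z.1 h1 hU.hasMFDerivAt)).mfderiv
  have h3 := congrArg (fun A => A w) h2
  rw [inner_spaceGrad, inner_spaceGrad, inner_spaceGrad]
  refine h3.trans ?_
  change η z * (spaceDeriv (fun y => U (y, z.2)) z.1 w * G') +
    G (U z) * spaceDeriv (fun y => η (y, z.2)) z.1 w = _
  ring

theorem timeDeriv_mul_comp {X : Type*} {η U : X × ℝ → ℝ} {G : ℝ → ℝ} {G' : ℝ} {z : X × ℝ}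
    (hη : DifferentiableAt ℝ (fun s => η (z.1, s)) z.2)
    (hU : DifferentiableAt ℝ (fun s => U (z.1, s)) z.2)
    (hG : HasDerivAt G G' (U z)) :
    timeDeriv (fun z => η z * G (U z)) z =
      timeDeriv η z * G (U z) + η z * (G' * timeDeriv U z) := by
  have h1 : HasDerivAt (fun s => G (U (z.1, s))) (G' * timeDeriv U z) z.2 :=
    HasDerivAt.comp (h₂ := G) z.2 hG hU.hasDerivAt
  exact (hη.hasDerivAt.mul h1).deriv

end Space

/-! ### Approximation of weak solutions by Lipschitz functions -/

/-- Here Y = |∇u|, k = ⟨∇Uₙ, ∇u⟩, e = |∇Uₙ - ∇u| and w = u^(m-1). The integrand is at most K e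
Y^(p-1) w, and Hölder's inequality for the measure w dμ pairs e in L^p with Y^(p-1) in the dual
space. -/
theorem tendsto_lintegral_flux {α : Type*} [MeasurableSpace α] {μ : Measure α} {p K : ℝ}
    (hp : 1 < p) {w Y Θ : α → ℝ} {k e : ℕ → α → ℝ}
    (hw : AEMeasurable w μ) (hw0 : ∀ᵐ x ∂μ, 0 ≤ w x) (hY : AEMeasurable Y μ) (hY0 : ∀ x, 0 ≤ Y x)
    (hk : ∀ n, AEMeasurable (k n) μ) (he0 : ∀ n x, 0 ≤ e n x)
    (hke : ∀ n x, |k n x - Y x ^ 2| ≤ e n x * Y x)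
    (hK : 0 ≤ K) (hΘ : ∀ x, 0 ≤ Θ x ∧ Θ x ≤ K)
    (hfin : ∫⁻ x, ENNReal.ofReal (Y x ^ p * w x) ∂μ ≠ ⊤)
    (he : Tendsto (fun n => ∫⁻ x, ENNReal.ofReal (e n x ^ p)
      ∂(μ.withDensity fun x => ENNReal.ofReal (w x))) atTop (𝓝 0)) :
    Tendsto (fun n => ∫⁻ x, ENNReal.ofReal |k n x * (w x * Y x ^ (p - 2) * Θ x)
      - Y x ^ p * w x * Θ x| ∂μ) atTop (𝓝 0) := by
  have hp0 : 0 < p := by linarith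
  set μ' := μ.withDensity fun x => ENNReal.ofReal (w x) with hμ'
  have hac : μ' ≪ μ := withDensity_absolutelyContinuous _ _
  -- A measurable substitute for e, which is not assumed measurable. It is at most e, also where Y =
  -- 0, since division by zero gives 0.
  set b : ℕ → α → ℝ := fun n x => |k n x - Y x ^ 2| / Y x with hb
  have hbm : ∀ n, AEMeasurable (b n) μ := fun n => by
    have : AEMeasurable (fun x => |k n x - Y x ^ 2|) μ := ((hk n).sub (hY.pow_const 2)).abs
    exact this.div hY
  have hb0 : ∀ n x, 0 ≤ b n x := fun n x => div_nonneg (abs_nonneg _) (hY0 x)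
  have hbe : ∀ n x, b n x ≤ e n x := fun n x => by
    rcases (hY0 x).eq_or_lt with h | h
    · simp [hb, ← h, he0]
    · rw [hb]; exact (div_le_iff₀ h).2 (hke n x)
  have hconj : p.HolderConjugate (Real.conjExponent p) := Real.HolderConjugate.conjExponent hp
  set p' := Real.conjExponent p with hp'
  have hpp' : (p - 1) * p' = p := by
    rw [hp', Real.conjExponent]; field_simp [(sub_pos.2 hp).ne']
  set c := (∫⁻ x, ENNReal.ofReal (Y x ^ (p - 1)) ^ p' ∂μ') ^ (1 / p') with hc
  have hcfin : c ≠ ⊤ := by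
    refine ENNReal.rpow_ne_top_of_nonneg (one_div_nonneg.2 hconj.symm.nonneg) ?_
    have : ∫⁻ x, ENNReal.ofReal (Y x ^ (p - 1)) ^ p' ∂μ' =
        ∫⁻ x, ENNReal.ofReal (Y x ^ p * w x) ∂μ := by
      rw [hμ', lintegral_withDensity_eq_lintegral_mul₀ hw.ennreal_ofReal
        ((hY.pow_const (p - 1)).ennreal_ofReal.pow_const p')]
      refine lintegral_congr_ae ?_
      filter_upwards [hw0] with x hx
      rw [Pi.mul_apply, ENNReal.ofReal_rpow_of_nonneg (by have := hY0 x; positivity)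
        hconj.symm.nonneg,
        ← Real.rpow_mul (hY0 x), hpp', ← ENNReal.ofReal_mul hx, mul_comm]
    rwa [this]
  have hupper : Tendsto (fun n => ENNReal.ofReal K *
      ((∫⁻ x, ENNReal.ofReal (e n x ^ p) ∂μ') ^ (1 / p) * c)) atTop (𝓝 0) := by
    have h1 : Tendsto (fun n => (∫⁻ x, ENNReal.ofReal (e n x ^ p) ∂μ') ^ (1 / p)) atTop (𝓝 0) := by
      have := (ENNReal.continuous_rpow_const (y := 1 / p)).tendsto 0 |>.comp he
      simpa [hp0, Function.comp_def] using this
    have h2 := ENNReal.Tendsto.mul_const h1 (Or.inr hcfin)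
    rw [zero_mul] at h2
    have h3 := ENNReal.Tendsto.const_mul (a := ENNReal.ofReal K) h2 (Or.inr ENNReal.ofReal_ne_top)
    rwa [mul_zero] at h3
  refine tendsto_of_tendsto_of_tendsto_of_le_of_le tendsto_const_nhds hupper
    (fun _ => zero_le) fun n => ?_
  calc ∫⁻ x, ENNReal.ofReal |k n x * (w x * Y x ^ (p - 2) * Θ x) - Y x ^ p * w x * Θ x| ∂μ
      ≤ ∫⁻ x, ENNReal.ofReal K * (ENNReal.ofReal (w x) *
          (ENNReal.ofReal (b n x) * ENNReal.ofReal (Y x ^ (p - 1)))) ∂μ := by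
        refine lintegral_mono_ae ?_
        filter_upwards [hw0] with x hx
        have hYx := hY0 x
        rw [← ENNReal.ofReal_mul (hb0 n x), ← ENNReal.ofReal_mul hx, ← ENNReal.ofReal_mul hK]
        refine ENNReal.ofReal_le_ofReal ?_
        have hY2 : Y x ^ p * w x * Θ x = Y x ^ 2 * (w x * Y x ^ (p - 2) * Θ x) := by
          rcases hYx.eq_or_lt with h | h
          · rw [← h, Real.zero_rpow hp0.ne']; ring
          · have : Y x ^ p = Y x ^ 2 * Y x ^ (p - 2) := by
              rw [← Real.rpow_natCast, ← Real.rpow_add h]; norm_num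
            rw [this]; ring
        have hY1 : |k n x - Y x ^ 2| * Y x ^ (p - 2) = b n x * Y x ^ (p - 1) := by
          rcases hYx.eq_or_lt with h | h
          · have := hke n x
            rw [← h, mul_zero] at this
            have h0 := le_antisymm this (abs_nonneg _)
            simp only [hb]
            rw [← h, h0]; simp
          · have : Y x ^ (p - 1) = Y x * Y x ^ (p - 2) := by
              conv_rhs => rw [← Real.rpow_one (Y x), Real.rpow_one, ]
              nth_rewrite 2 [← Real.rpow_one (Y x)]
              rw [← Real.rpow_add h]; congr 1; ring
            simp only [hb]
            rw [this]; field_simp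
        rw [hY2, ← sub_mul, abs_mul, abs_of_nonneg (a := w x * _ * _)
          (mul_nonneg (mul_nonneg hx (by positivity)) (hΘ x).1)]
        calc |k n x - Y x ^ 2| * (w x * Y x ^ (p - 2) * Θ x)
            = (|k n x - Y x ^ 2| * Y x ^ (p - 2)) * w x * Θ x := by ring
          _ = b n x * Y x ^ (p - 1) * w x * Θ x := by rw [hY1]
          _ ≤ b n x * Y x ^ (p - 1) * w x * K := by
            have := hb0 n x
            have := (hΘ x).2
            gcongr
          _ = _ := by ring
    _ = ENNReal.ofReal K * ∫⁻ x, ENNReal.ofReal (b n x) * ENNReal.ofReal (Y x ^ (p - 1)) ∂μ' := by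
        rw [lintegral_const_mul' _ _ ENNReal.ofReal_ne_top, hμ']
        exact congrArg (ENNReal.ofReal K * ·) (lintegral_withDensity_eq_lintegral_mul₀
          hw.ennreal_ofReal ((hbm n).ennreal_ofReal.mul (hY.pow_const (p - 1)).ennreal_ofReal)).symm
    _ ≤ ENNReal.ofReal K * ((∫⁻ x, ENNReal.ofReal (e n x ^ p) ∂μ') ^ (1 / p) * c) := by
        gcongr
        have := ENNReal.lintegral_mul_le_Lp_mul_Lq μ' hconj ((hbm n).ennreal_ofReal.mono_ac hac)
          ((hY.pow_const (p - 1)).ennreal_ofReal.mono_ac hac)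
        refine this.trans ?_
        gcongr with x
        rw [ENNReal.ofReal_rpow_of_nonneg (hb0 n x) hp0.le]
        exact ENNReal.ofReal_le_ofReal (Real.rpow_le_rpow (hb0 n x) (hbe n x) hp0.le)

section Measure

variable {N : ℕ} {M : Type*} [MetricSpace M] [MeasurableSpace M] [BorelSpace M]

theorem weightedSpaceTimeMeasure_absolutelyContinuous [SFinite (μHE[N] : Measure M)] (a : M → ℝ) :
    weightedSpaceTimeMeasure N a ≪ (μHE[N] : Measure M).prod volume :=
  (withDensity_absolutelyContinuous _ _).prod Measure.AbsolutelyContinuous.rfl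

theorem isLocallyFiniteMeasure_weightedSpaceTimeMeasure [SecondCountableTopology M]
    [IsLocallyFiniteMeasure (μHE[N] : Measure M)] {a : M → ℝ} (ha : Continuous a) :
    IsLocallyFiniteMeasure (weightedSpaceTimeMeasure N a) := by
  have : IsLocallyFiniteMeasure (weightedMeasure N a) :=
    IsLocallyFiniteMeasure.withDensity_ofReal ha
  unfold weightedSpaceTimeMeasure
  infer_instance

theorem measurableSet_spaceTime : MeasurableSet (spaceTime M) :=
  MeasurableSet.univ.prod measurableSet_Ioi

end Measure

section Freeze

variable {M : Type*} [MetricSpace M]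

theorem exists_pos_lt_of_isCompact {A : Set (M × ℝ)} (hA : IsCompact A) (hAS : A ⊆ spaceTime M) :
    ∃ τ > 0, ∀ z ∈ A, τ < z.2 := by
  obtain ⟨τ, hτ, h⟩ := hA.exists_forall_le' (f := Prod.snd) continuous_snd.continuousOn
    (a := (0 : ℝ))
    fun z hz => (hAS hz).2
  exact ⟨τ / 2, half_pos hτ, fun z hz => (half_lt_self hτ).trans_le (h z hz)⟩

/-- The function obtained by freezing `U` before the time `τ`. -/
def freeze (τ : ℝ) (U : M × ℝ → ℝ) (z : M × ℝ) : ℝ := U (z.1, max z.2 τ)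

/-- The approximants are controlled only on S, while test functions must be locally Lipschitz on M ×
ℝ. Freezing at a time earlier than a given compact subset of S changes neither values nor
derivatives there. -/
theorem locallyLipschitz_freeze {U : M × ℝ → ℝ} (hU : LocallyLipschitzOn (spaceTime M) U)
    {τ : ℝ} (hτ : 0 < τ) : LocallyLipschitz (freeze τ U) := by
  have hmap : ∀ z : M × ℝ, (z.1, max z.2 τ) ∈ spaceTime M := fun z =>
    ⟨mem_univ _, hτ.trans_le (le_max_right _ _)⟩
  have hF : LipschitzWith 1 (fun z : M × ℝ => (z.1, max z.2 τ)) := by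
    have h1 : LipschitzWith 1 (fun z : M × ℝ => max z.2 τ) := LipschitzWith.prod_snd.max_const τ
    simpa using LipschitzWith.prod_fst.prodMk h1
  intro z
  obtain ⟨K, T, hT, hK⟩ := hU (hmap z)
  have hc : Tendsto (fun z : M × ℝ => (z.1, max z.2 τ)) (𝓝 z) (𝓝[spaceTime M] (z.1, max z.2 τ)) :=
    tendsto_nhdsWithin_iff.2 ⟨hF.continuous.tendsto z, Eventually.of_forall hmap⟩
  exact ⟨K * 1, _, hc hT, hK.comp hF.lipschitzOnWith fun y hy => hy⟩

theorem freeze_eq {U : M × ℝ → ℝ} {τ : ℝ} {z : M × ℝ} (hz : τ < z.2) : freeze τ U z = U z := by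
  rw [freeze, max_eq_left hz.le]

theorem timeDeriv_freeze {U : M × ℝ → ℝ} {τ : ℝ} {z : M × ℝ} (hz : τ < z.2) :
    timeDeriv (freeze τ U) z = timeDeriv U z := by
  refine Filter.EventuallyEq.deriv_eq ?_
  filter_upwards [lt_mem_nhds hz] with s hs
  exact freeze_eq (z := (z.1, s)) hs

end Freeze

section Approximation

variable {N : ℕ} {M : Type*} [MetricSpace M]
  [ChartedSpace (EuclideanSpace ℝ (Fin N)) M] [IsManifold (𝓡 N) ∞ M]
  [RiemannianBundle (fun x : M => TangentSpace (𝓡 N) x)]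

theorem spaceGrad_freeze {U : M × ℝ → ℝ} {τ : ℝ} {z : M × ℝ} (hz : τ < z.2) :
    (spaceGrad (freeze τ U) z : TangentSpace (𝓡 N) z.1) = spaceGrad U z := by
  have h : (fun y => freeze τ U (y, z.2)) = fun y => U (y, z.2) :=
    funext fun y => freeze_eq (z := (y, z.2)) hz
  simp only [spaceGrad]
  rw [h]

variable [IsContinuousRiemannianBundle (EuclideanSpace ℝ (Fin N))
      (fun x : M => TangentSpace (𝓡 N) x)]
  [IsRiemannianManifold (𝓡 N) M]
  [MeasurableSpace M] [BorelSpace M] [SecondCountableTopology M]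
  [IsLocallyFiniteMeasure (μHE[N] : Measure M)]

theorem aemeasurable_norm_section {ν : Measure (M × ℝ)} {X : ∀ z : M × ℝ, TangentSpace (𝓡 N) z.1}
    (hX : AEStronglyMeasurable (fun z => (⟨z.1, X z⟩ : TangentBundle (𝓡 N) M)) ν) :
    AEMeasurable (fun z => ‖X z‖) ν :=
  (continuous_norm_tangentBundle.comp_aestronglyMeasurable hX).aemeasurable

/-- On a compact set, a function with weak derivatives and its derivatives are limits of globally
defined locally Lipschitz functions. -/
theorem HasWeakDerivatives.exists_approx_on_compact {p m K : ℝ} (hp : 1 < p)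
    (hK : 0 ≤ K) {a : M → ℝ}
    {u v : M × ℝ → ℝ} {X : ∀ z : M × ℝ, TangentSpace (𝓡 N) z.1}
    (h : HasWeakDerivatives p m a u X v) {A : Set (M × ℝ)} (hA : IsCompact A)
    (hAS : A ⊆ spaceTime M)
    (hu0 : ∀ᵐ z ∂(weightedSpaceTimeMeasure N a).restrict A, 0 ≤ u z)
    {Θ : M × ℝ → ℝ} (hΘ : ∀ z, 0 ≤ Θ z ∧ Θ z ≤ K)
    (hXu : IntegrableOn (fun z => ‖X z‖ ^ p * u z ^ (m - 1)) A (weightedSpaceTimeMeasure N a)) :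
    ∃ U : ℕ → M × ℝ → ℝ, (∀ n, LocallyLipschitz (U n)) ∧ (∀ n z, 0 ≤ U n z) ∧
      (∀ᵐ z ∂(weightedSpaceTimeMeasure N a).restrict A,
        Tendsto (fun n => U n z) atTop (𝓝 (u z))) ∧
      Tendsto (fun n => ∫⁻ z in A, ENNReal.ofReal |U n z - u z| ∂(weightedSpaceTimeMeasure N a))
        atTop (𝓝 0) ∧
      Tendsto (fun n => ∫⁻ z in A, ENNReal.ofReal |timeDeriv (U n) z - v z|
        ∂(weightedSpaceTimeMeasure N a)) atTop (𝓝 0) ∧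
      Tendsto (fun n => ∫⁻ z in A, ENNReal.ofReal
        |inner ℝ (spaceGrad (U n) z) (X z) * (u z ^ (m - 1) * ‖X z‖ ^ (p - 2) * Θ z)
          - ‖X z‖ ^ p * u z ^ (m - 1) * Θ z| ∂(weightedSpaceTimeMeasure N a)) atTop (𝓝 0) := by
  set ν := weightedSpaceTimeMeasure N a with hν
  have hAm : MeasurableSet A := hA.measurableSet
  obtain ⟨τ, hτ, hτA⟩ := exists_pos_lt_of_isCompact hA hAS
  obtain ⟨U₀, hU₀L, hU₀0, h1, h2, -, h4⟩ := h.exists_approx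
  set U : ℕ → M × ℝ → ℝ := fun n => freeze τ (U₀ n) with hU
  have hUL : ∀ n, LocallyLipschitz (U n) := fun n => locallyLipschitz_freeze (hU₀L n) hτ
  have hU0 : ∀ n z, 0 ≤ U n z := fun n z =>
    hU₀0 n _ ⟨mem_univ _, hτ.trans_le (le_max_right _ _)⟩
  have hmono : ν.restrict A ≤ ν.restrict (spaceTime M) := Measure.restrict_mono hAS le_rfl
  have hum : AEStronglyMeasurable u (ν.restrict A) := h.aestronglyMeasurable.mono_measure hmono
  have hXm := h.aestronglyMeasurable_grad.mono_measure hmono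
  have h1' : Tendsto (fun n => ∫⁻ z in A, ENNReal.ofReal |U n z - u z| ∂ν) atTop (𝓝 0) := by
    refine (h1 A hAS hA).congr fun n => setLIntegral_congr_fun hAm fun z hz => ?_
    simp only [Real.rpow_one, hU, freeze_eq (hτA z hz)]
  have h2' : Tendsto (fun n => ∫⁻ z in A, ENNReal.ofReal |timeDeriv (U n) z - v z| ∂ν) atTop
      (𝓝 0) := by
    refine (h2 A hAS hA).congr fun n => setLIntegral_congr_fun hAm fun z hz => ?_
    simp only [Real.rpow_one, hU, timeDeriv_freeze (hτA z hz)]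
  have hac : ν.restrict A ≪ (μHE[N] : Measure M).prod volume :=
    Measure.restrict_le_self.absolutelyContinuous.trans
      (weightedSpaceTimeMeasure_absolutelyContinuous a)
  have h4' : Tendsto (fun n => ∫⁻ z in A, ENNReal.ofReal
        |inner ℝ (spaceGrad (U n) z) (X z) * (u z ^ (m - 1) * ‖X z‖ ^ (p - 2) * Θ z)
          - ‖X z‖ ^ p * u z ^ (m - 1) * Θ z| ∂ν) atTop (𝓝 0) := by
    refine tendsto_lintegral_flux (e := fun n z => ‖spaceGrad (U n) z - X z‖) hp
      (hum.aemeasurable.pow_const _) ?_ (aemeasurable_norm_section hXm) (fun z => norm_nonneg _)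
      (fun n => aemeasurable_inner_spaceGrad (hUL n) hac hXm) (fun n z => norm_nonneg _)
      (fun n z => ?_) hK hΘ ?_ ?_
    · filter_upwards [hu0] with z hz using Real.rpow_nonneg hz _
    · rw [← real_inner_self_eq_norm_sq, ← inner_sub_left]
      exact abs_real_inner_le_norm _ _
    · exact hXu.lintegral_lt_top.ne
    · rw [← restrict_withDensity hAm]
      refine (h4 A hAS hA).congr fun n => setLIntegral_congr_fun hAm fun z hz => ?_
      simp only [hU, spaceGrad_freeze (hτA z hz), abs_norm]
  -- A subsequence converges a.e., which is needed for nonlinear functions of Uₙ; the other limits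
  -- persist along it.
  have hmeas : TendstoInMeasure (ν.restrict A) U atTop u := by
    refine tendstoInMeasure_of_tendsto_eLpNorm one_ne_zero
      (fun n => (hUL n).continuous.aestronglyMeasurable) hum ?_
    refine h1'.congr fun n => ?_
    rw [eLpNorm_one_eq_lintegral_enorm]
    refine lintegral_congr fun z => ?_
    rw [Pi.sub_apply, Real.enorm_eq_ofReal_abs]
  obtain ⟨ns, hns, hae⟩ := hmeas.exists_seq_tendsto_ae
  exact ⟨fun k => U (ns k), fun k => hUL _, fun k z => hU0 _ z, hae,
    h1'.comp hns.tendsto_atTop, h2'.comp hns.tendsto_atTop, h4'.comp hns.tendsto_atTop⟩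

end Approximation

/-! ### The energy inequality -/

theorem eventually_integrable_of_tendsto {α : Type*} [MeasurableSpace α] {μ : Measure α}
    {f : ℕ → α → ℝ} {f' : α → ℝ} (hfm : ∀ n, AEStronglyMeasurable (f n) μ) (hf' : Integrable f' μ)
    (hf : Tendsto (fun n => ∫⁻ x, ENNReal.ofReal |f n x - f' x| ∂μ) atTop (𝓝 0)) :
    ∀ᶠ n in atTop, Integrable (f n) μ := by
  filter_upwards [hf.eventually_lt_const ENNReal.zero_lt_top] with n hn
  have : Integrable (fun x => f n x - f' x) μ :=
    ⟨(hfm n).sub hf'.1, by rw [hasFiniteIntegral_iff_norm]; exact hn⟩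
  exact (this.add hf').congr (Eventually.of_forall fun x => by simp)

theorem integrable_of_tendsto {α : Type*} [MeasurableSpace α] {μ : Measure α}
    {f : ℕ → α → ℝ} {f' : α → ℝ} (hfi : ∀ n, Integrable (f n) μ) (hf' : AEStronglyMeasurable f' μ)
    (hf : Tendsto (fun n => ∫⁻ x, ENNReal.ofReal |f n x - f' x| ∂μ) atTop (𝓝 0)) :
    Integrable f' μ := by
  obtain ⟨n, hn⟩ := (hf.eventually_lt_const ENNReal.zero_lt_top).exists
  have : Integrable (fun x => f n x - f' x) μ :=
    ⟨(hfi n).1.sub hf', by rw [hasFiniteIntegral_iff_norm]; exact hn⟩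
  exact ((hfi n).sub this).congr (Eventually.of_forall fun x => by simp)

theorem ofReal_integral_le_lintegral {α : Type*} [MeasurableSpace α] {μ : Measure α}
    (f : α → ℝ) : ENNReal.ofReal (∫ x, f x ∂μ) ≤ ∫⁻ x, ENNReal.ofReal (f x) ∂μ := by
  by_cases hf : Integrable f μ
  · rw [integral_eq_lintegral_pos_part_sub_lintegral_neg_part hf]
    exact (ENNReal.ofReal_le_ofReal (sub_le_self _ ENNReal.toReal_nonneg)).trans
      ENNReal.ofReal_toReal_le
  · simp [integral_undef hf]

section Time

variable {X : Type*} [MetricSpace X] [MeasurableSpace X] [BorelSpace X]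
  [SecondCountableTopology X] {μ : Measure X} [SFinite μ]

theorem integrableOn_mul_timeDeriv [IsLocallyFiniteMeasure (μ.prod (volume : Measure ℝ))]
    {f g : X × ℝ → ℝ} (hf : Continuous f)
    (hg : LocallyLipschitz g) {A : Set (X × ℝ)} (hA : IsCompact A) :
    IntegrableOn (fun z => f z * timeDeriv g z) A (μ.prod volume) := by
  obtain ⟨C, hC, hfC⟩ := hA.exists_forall_le_of_eventually
    (F := fun z => |f z * timeDeriv g z|) (fun z => by
      obtain ⟨C, hC⟩ := hg.eventually_abs_timeDeriv_le z
      refine ⟨(|f z| + 1) * C, ?_⟩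
      have h1 : ∀ᶠ y in 𝓝 z, |f y| < |f z| + 1 :=
        hf.abs.continuousAt.eventually_lt_const (lt_add_one _)
      filter_upwards [hC, h1] with y hy hy'
      rw [abs_mul]
      exact mul_le_mul hy'.le hy (abs_nonneg _) (by positivity))
  refine Measure.integrableOn_of_bounded (M := C) hA.measure_lt_top.ne
    (hf.measurable.mul (measurable_timeDeriv hg.continuous)).aestronglyMeasurable ?_
  exact (ae_restrict_iff' hA.measurableSet).2 (Eventually.of_forall hfC)

/-- Integration by parts in time. -/
theorem setIntegral_timeDeriv_mul_comp [IsLocallyFiniteMeasure (μ.prod (volume : Measure ℝ))]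
    {η U : X × ℝ → ℝ} (hη : LocallyLipschitz η)
    (hηc : HasCompactSupport η) (hU : LocallyLipschitz U) (hU0 : ∀ z, 0 ≤ U z)
    {G H : ℝ → ℝ} {KH : ℝ≥0} (hHL : LipschitzOnWith KH H (Ici 0)) (hG : ContinuousOn G (Ici 0))
    (hH : ∀ y, 0 ≤ y → HasDerivAt H (G y) y) {A : Set (X × ℝ)} (hA : IsCompact A)
    (hηA : tsupport η ⊆ A) :
    ∫ z in A, timeDeriv η z * H (U z) ∂(μ.prod volume) =
      - ∫ z in A, η z * G (U z) * timeDeriv U z ∂(μ.prod volume) := by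
  have hHU : LocallyLipschitz fun z => H (U z) := hHL.comp_locallyLipschitz hU hU0
  have hGU : Continuous fun z => G (U z) := hG.comp_continuous hU.continuous hU0
  have hc : HasCompactSupport fun z => η z * H (U z) := hηc.mul_right
  have h0 := integral_timeDeriv_eq_zero (μ := μ) (hη.mul_real hHU) hc
  have h1 : ∫ z in A, timeDeriv (fun z => η z * H (U z)) z ∂(μ.prod volume) = 0 := by
    rw [setIntegral_eq_integral_of_forall_compl_eq_zero, h0]
    intro z hz
    exact timeDeriv_eq_zero_of_notMem_tsupport fun h => hz (hηA (tsupport_mul_subset_left h))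
  have h2 : ∀ᵐ z ∂(μ.prod volume), timeDeriv (fun z => η z * H (U z)) z =
      H (U z) * timeDeriv η z + η z * G (U z) * timeDeriv U z := by
    filter_upwards [ae_differentiableAt_time (μ := μ) hη, ae_differentiableAt_time (μ := μ) hU]
      with z hz1 hz2
    rw [timeDeriv_mul_comp hz1 hz2 (hH _ (hU0 z))]
    ring
  have h3 : IntegrableOn (fun z => η z * G (U z) * timeDeriv U z) A (μ.prod volume) :=
    integrableOn_mul_timeDeriv (f := fun z => η z * G (U z)) (hη.continuous.mul hGU) hU hA
  rw [integral_congr_ae (ae_restrict_of_ae h2), integral_add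
    (integrableOn_mul_timeDeriv hHU.continuous hη hA) h3] at h1
  simp_rw [mul_comm (timeDeriv η _)]
  linarith

end Time

theorem tendsto_comp_of_continuousOn_Ici {G : ℝ → ℝ} (hG : ContinuousOn G (Ici 0))
    {b : ℕ → ℝ} {l : ℝ}
    (hb : ∀ n, 0 ≤ b n) (h : Tendsto b atTop (𝓝 l)) :
    Tendsto (fun n => G (b n)) atTop (𝓝 (G l)) :=
  (hG l (ge_of_tendsto' h hb)).tendsto.comp
    (tendsto_nhdsWithin_iff.2 ⟨h, Eventually.of_forall hb⟩)

section Energy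

variable {N : ℕ} {M : Type*} [MetricSpace M]
  [ChartedSpace (EuclideanSpace ℝ (Fin N)) M] [IsManifold (𝓡 N) ∞ M]
  [RiemannianBundle (fun x : M => TangentSpace (𝓡 N) x)]

theorem spaceGrad_eq_zero_of_notMem_tsupport {f : M × ℝ → ℝ} {z : M × ℝ} (hz : z ∉ tsupport f) :
    (spaceGrad f z : TangentSpace (𝓡 N) z.1) = 0 := by
  have h1 : f =ᶠ[𝓝 z] 0 := notMem_tsupport_iff_eventuallyEq.1 hz
  have h2 : (fun y => f (y, z.2)) =ᶠ[𝓝 z.1] fun _ => 0 :=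
    (Continuous.tendsto (f := fun y : M => (y, z.2)) (by fun_prop) z.1).eventually h1
  simp only [spaceGrad]
  rw [h2.mfderiv_eq, mfderiv_const]
  exact map_zero _

variable [IsContinuousRiemannianBundle (EuclideanSpace ℝ (Fin N))
      (fun x : M => TangentSpace (𝓡 N) x)]
  [IsRiemannianManifold (𝓡 N) M]
  [MeasurableSpace M] [BorelSpace M] [SecondCountableTopology M]
  [IsLocallyFiniteMeasure (μHE[N] : Measure M)]

/-- The energy inequality obtained by testing with `η G(u)`, where `H' = G`. -/
theorem energy_inequality_of_hasDerivAt {p q m K : ℝ} (hp : 1 < p) (hm : 1 ≤ m) (hK : 0 ≤ K)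
    {a : M → ℝ} (ha : Continuous a) {Φ : ℝ → ℝ} (hΦ : Measurable Φ)
    (hΦK : ∀ s, 0 ≤ s → 0 ≤ Φ s ∧ Φ s ≤ K) {V u v : M × ℝ → ℝ}
    {X : ∀ z : M × ℝ, TangentSpace (𝓡 N) z.1} (h : HasWeakDerivatives p m a u X v)
    (hu0 : ∀ᵐ z ∂((weightedSpaceTimeMeasure N a).restrict (spaceTime M)), 0 ≤ u z)
    (huV : LocallyIntegrableOn (fun z => u z ^ q * V z) (spaceTime M)
      (weightedSpaceTimeMeasure N a))
    (hup : LocallyIntegrableOn (fun z => u z ^ (p + m - 1)) (spaceTime M)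
      (weightedSpaceTimeMeasure N a))
    (hXu : LocallyIntegrableOn (fun z => ‖X z‖ ^ p * u z ^ (m - 1)) (spaceTime M)
      (weightedSpaceTimeMeasure N a))
    (hw : ∀ ψ : M × ℝ → ℝ, LocallyLipschitz ψ → HasCompactSupport ψ → tsupport ψ ⊆ spaceTime M →
      (∀ z, 0 ≤ ψ z) →
      ∫ z in spaceTime M, ψ z * u z ^ q * V z ∂(weightedSpaceTimeMeasure N a) ≤
        (∫ z in spaceTime M,
          inner ℝ (spaceGrad ψ z) (X z) * u z ^ (m - 1) * ‖X z‖ ^ (p - 2) * Φ ‖X z‖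
            ∂(weightedSpaceTimeMeasure N a))
        - ∫ z in spaceTime M, timeDeriv ψ z * u z ∂(weightedSpaceTimeMeasure N a))
    {η : M × ℝ → ℝ} (hη : LocallyLipschitz η) (hηc : HasCompactSupport η)
    (hηS : tsupport η ⊆ spaceTime M) (hη0 : ∀ z, 0 ≤ η z)
    {G H G' : ℝ → ℝ} {KG KH : ℝ≥0} {G₀ G₁ : ℝ} (hGL : LipschitzOnWith KG G (Ici 0))
    (hHL : LipschitzOnWith KH H (Ici 0)) (hG' : ContinuousOn G' (Ici 0))
    (hGd : ∀ y, 0 ≤ y → HasDerivAt G (G' y) y) (hHd : ∀ y, 0 ≤ y → HasDerivAt H (G y) y)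
    (hG0 : ∀ y, 0 ≤ y → 0 ≤ G y) (hG₀ : ∀ y, 0 ≤ y → G y ≤ G₀)
    (hG₁ : ∀ y, 0 ≤ y → |G' y| ≤ G₁) :
    IntegrableOn (fun z => η z * G (u z) * (u z ^ q * V z)) (tsupport η)
      (weightedSpaceTimeMeasure N a) ∧
    IntegrableOn (fun z => G (u z) * (inner ℝ (spaceGrad η z) (X z) *
        (u z ^ (m - 1) * ‖X z‖ ^ (p - 2) * Φ ‖X z‖))) (tsupport η)
      (weightedSpaceTimeMeasure N a) ∧
    IntegrableOn (fun z => η z * G' (u z) * (‖X z‖ ^ p * u z ^ (m - 1) * Φ ‖X z‖)) (tsupport η)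
      (weightedSpaceTimeMeasure N a) ∧
    IntegrableOn (fun z => timeDeriv η z * H (u z)) (tsupport η)
      (weightedSpaceTimeMeasure N a) ∧
    ∫ z in tsupport η, η z * G (u z) * (u z ^ q * V z) ∂(weightedSpaceTimeMeasure N a) ≤
      ∫ z in tsupport η, G (u z) * (inner ℝ (spaceGrad η z) (X z) *
        (u z ^ (m - 1) * ‖X z‖ ^ (p - 2) * Φ ‖X z‖)) ∂(weightedSpaceTimeMeasure N a) +
      ∫ z in tsupport η, η z * G' (u z) * (‖X z‖ ^ p * u z ^ (m - 1) * Φ ‖X z‖)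
        ∂(weightedSpaceTimeMeasure N a) -
      ∫ z in tsupport η, timeDeriv η z * H (u z) ∂(weightedSpaceTimeMeasure N a) := by
  have : IsLocallyFiniteMeasure (weightedSpaceTimeMeasure N a) :=
    isLocallyFiniteMeasure_weightedSpaceTimeMeasure ha
  have : SFinite (weightedMeasure N a) := by unfold weightedMeasure; infer_instance
  have : IsLocallyFiniteMeasure ((weightedMeasure N a).prod (volume : Measure ℝ)) :=
    isLocallyFiniteMeasure_weightedSpaceTimeMeasure ha
  set ν := weightedSpaceTimeMeasure N a with hν
  set A := tsupport η with hAdef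
  have hA : IsCompact A := hηc
  have hAm : MeasurableSet A := hA.measurableSet
  have hmono : ν.restrict A ≤ ν.restrict (spaceTime M) := Measure.restrict_mono hηS le_rfl
  have hac : ν ≪ (μHE[N] : Measure M).prod volume :=
    weightedSpaceTimeMeasure_absolutelyContinuous a
  have hacA : ν.restrict A ≪ (μHE[N] : Measure M).prod volume :=
    Measure.restrict_le_self.absolutelyContinuous.trans hac
  have hu0' : ∀ᵐ z ∂ν.restrict A, 0 ≤ u z := hmono.absolutelyContinuous.ae_le hu0
  have hum : AEStronglyMeasurable u (ν.restrict A) := h.aestronglyMeasurable.mono_measure hmono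
  have hvm : AEStronglyMeasurable v (ν.restrict A) :=
    h.aestronglyMeasurable_timeDeriv.mono_measure hmono
  have hXm := h.aestronglyMeasurable_grad.mono_measure hmono
  have hXn : AEMeasurable (fun z => ‖X z‖) (ν.restrict A) := aemeasurable_norm_section hXm
  have huVA := huV.integrableOn_compact_subset hηS hA
  have hupA := hup.integrableOn_compact_subset hηS hA
  have hXuA := hXu.integrableOn_compact_subset hηS hA
  have hΘ : ∀ z, 0 ≤ Φ ‖X z‖ ∧ Φ ‖X z‖ ≤ K := fun z => hΦK _ (norm_nonneg _)
  obtain ⟨U, hUL, hU0, hUae, hU1, hU2, hU3⟩ :=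
    h.exists_approx_on_compact hp hK hA hηS hu0' hΘ hXuA
  set F : M × ℝ → ℝ := fun z => u z ^ (m - 1) * ‖X z‖ ^ (p - 2) * Φ ‖X z‖ with hF
  set Z : M × ℝ → ℝ := fun z => ‖X z‖ ^ p * u z ^ (m - 1) * Φ ‖X z‖ with hZ
  have hΘm : AEMeasurable (fun z => Φ ‖X z‖) (ν.restrict A) := hΦ.comp_aemeasurable hXn
  have hFm : AEMeasurable F (ν.restrict A) :=
    ((hum.aemeasurable.pow_const _).mul (hXn.pow_const _)).mul hΘm
  have hinner : ∀ {f : M × ℝ → ℝ}, LocallyLipschitz f →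
      AEMeasurable (fun z => inner ℝ (spaceGrad f z) (X z)) (ν.restrict A) := fun hf =>
    aemeasurable_inner_spaceGrad hf hacA hXm
  have hbdd : ∀ {f : M × ℝ → ℝ} (hf : Continuous f), ∃ C, 0 ≤ C ∧ ∀ z ∈ A, |f z| ≤ C := fun hf => by
    obtain ⟨C, hC⟩ := (hA.image hf.abs).bddAbove
    exact ⟨max C 0, le_max_right _ _, fun z hz => (hC ⟨z, hz, rfl⟩).trans (le_max_left _ _)⟩
  have hdt : ∀ {f : M × ℝ → ℝ} (hf : LocallyLipschitz f),
      ∃ C, 0 ≤ C ∧ ∀ z ∈ A, |timeDeriv f z| ≤ C := fun hf =>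
    hA.exists_forall_le_of_eventually fun z => hf.eventually_abs_timeDeriv_le z
  have hGc := hGL.continuousOn
  have hGu : ∀ᵐ z ∂ν.restrict A, Tendsto (fun n => G (U n z)) atTop (𝓝 (G (u z))) := by
    filter_upwards [hUae] with z hz using tendsto_comp_of_continuousOn_Ici hGc (fun n => hU0 n z) hz
  have hG'u : ∀ᵐ z ∂ν.restrict A, Tendsto (fun n => G' (U n z)) atTop (𝓝 (G' (u z))) := by
    filter_upwards [hUae] with z hz using tendsto_comp_of_continuousOn_Ici hG' (fun n => hU0 n z) hz
  have hGUm : ∀ n, Continuous fun z => G (U n z) := fun n =>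
    hGc.comp_continuous (hUL n).continuous (hU0 n)
  have hG'Um : ∀ n, Continuous fun z => G' (U n z) := fun n =>
    hG'.comp_continuous (hUL n).continuous (hU0 n)
  have hGum : AEStronglyMeasurable (fun z => G (u z)) (ν.restrict A) :=
    aestronglyMeasurable_of_tendsto_ae atTop (fun n => (hGUm n).aestronglyMeasurable) hGu
  have hG'um : AEStronglyMeasurable (fun z => G' (u z)) (ν.restrict A) :=
    aestronglyMeasurable_of_tendsto_ae atTop (fun n => (hG'Um n).aestronglyMeasurable) hG'u
  have hG00 : 0 ≤ G₀ := (hG0 0 le_rfl).trans (hG₀ 0 le_rfl)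
  have hG10 : 0 ≤ G₁ := (abs_nonneg _).trans (hG₁ 0 le_rfl)
  have hGabs : ∀ y, 0 ≤ y → |G y| ≤ G₀ := fun y hy => by
    rw [abs_of_nonneg (hG0 y hy)]
    exact hG₀ y hy
  obtain ⟨Cη, hCη0, hCη⟩ := hbdd hη.continuous
  obtain ⟨Cτ, hCτ0, hCτ⟩ := hdt hη
  obtain ⟨Cg, hCg0, hCg⟩ := hA.exists_forall_le_of_eventually
    fun z => hη.eventually_norm_spaceGrad_le (N := N) z
  have haeA : ∀ {P : M × ℝ → Prop}, (∀ z ∈ A, P z) → ∀ᵐ z ∂ν.restrict A, P z := fun hP =>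
    (ae_restrict_iff' hAm).2 (Eventually.of_forall hP)
  have hu1 : IntegrableOn u A ν :=
    integrable_of_tendsto (fun n => (hUL n).continuous.continuousOn.integrableOn_compact hA) hum hU1
  have hUt : ∀ n, IntegrableOn (timeDeriv (U n)) A ν := fun n => by
    have h1 := integrableOn_mul_timeDeriv (μ := weightedMeasure N a) (f := fun _ => 1)
      continuous_const (hUL n) hA
    simp only [one_mul] at h1
    exact h1
  have hv1 : IntegrableOn v A ν := integrable_of_tendsto hUt hvm hU2
  have hZi : IntegrableOn Z A ν :=
    hXuA.mul_bdd hΘm.aestronglyMeasurable (c := K) (Eventually.of_forall fun z => by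
      rw [Real.norm_of_nonneg (hΘ z).1]
      exact (hΘ z).2)
  -- From |X|^(p-1) ≤ 1 + |X|^p and u^(m-1) ≤ 1 + u^(p+m-1), the flux is dominated by the two
  -- locally integrable quantities in the definition of a weak solution.
  have hgi : IntegrableOn (fun z => inner ℝ (spaceGrad η z) (X z) * F z) A ν := by
    have hdom : IntegrableOn (fun z => Cg * (K * ((1 + u z ^ (p + m - 1)) +
        ‖X z‖ ^ p * u z ^ (m - 1)))) A ν :=
      (((integrableOn_const hA.measure_lt_top.ne).add hupA).add hXuA).const_mul _ |>.const_mul _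
    refine Integrable.mono' hdom ((hinner hη).mul hFm).aestronglyMeasurable ?_
    filter_upwards [hu0', haeA hCg] with z hz hzg
    have hum0 : 0 ≤ u z ^ (m - 1) := Real.rpow_nonneg hz _
    have h1 : u z ^ (m - 1) ≤ 1 + u z ^ (p + m - 1) := by
      rcases le_total (u z) 1 with h1 | h1
      · exact (Real.rpow_le_one hz h1 (by linarith)).trans
          (le_add_of_nonneg_right (Real.rpow_nonneg hz _))
      · exact (Real.rpow_le_rpow_of_exponent_le h1 (by linarith)).trans
          (le_add_of_nonneg_left zero_le_one)
    have h2 : ‖X z‖ * ‖X z‖ ^ (p - 2) ≤ 1 + ‖X z‖ ^ p := by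
      rcases eq_or_lt_of_le (norm_nonneg (X z)) with h0 | h0
      · rw [← h0, zero_mul]
        positivity
      · rw [← Real.rpow_one_add' h0.le (by linarith)]
        rcases le_total ‖X z‖ 1 with h1 | h1
        · exact (Real.rpow_le_one h0.le h1 (by linarith)).trans
            (le_add_of_nonneg_right (by positivity))
        · exact (Real.rpow_le_rpow_of_exponent_le h1 (by linarith)).trans
            (le_add_of_nonneg_left zero_le_one)
    have hF0 : 0 ≤ F z := mul_nonneg (mul_nonneg hum0 (by positivity)) (hΘ z).1
    rw [norm_mul, Real.norm_of_nonneg hF0]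
    calc _ ≤ (Cg * ‖X z‖) * F z := by
          gcongr
          exact (norm_inner_le_norm _ _).trans (by gcongr)
      _ = Cg * ((u z ^ (m - 1) * (‖X z‖ * ‖X z‖ ^ (p - 2))) * Φ ‖X z‖) := by
          simp only [hF]; ring
      _ ≤ Cg * ((u z ^ (m - 1) * (1 + ‖X z‖ ^ p)) * K) := by
          gcongr
          · exact (hΘ z).1
          · exact (hΘ z).2
      _ ≤ _ := by
          rw [mul_comm K]
          gcongr
          nlinarith
  have hHLb : ∀ y, 0 ≤ y → |H y| ≤ |H 0| + KH * y := fun y hy => by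
    have := hHL.dist_le_mul y hy 0 (mem_Ici.2 le_rfl)
    rw [Real.dist_eq, Real.dist_eq, sub_zero, abs_of_nonneg hy] at this
    have := abs_sub_abs_le_abs_sub (H y) (H 0)
    linarith
  have hHu : ∀ᵐ z ∂ν.restrict A, Tendsto (fun n => H (U n z)) atTop (𝓝 (H (u z))) := by
    filter_upwards [hUae] with z hz using
      tendsto_comp_of_continuousOn_Ici hHL.continuousOn (fun n => hU0 n z) hz
  have hHUm : ∀ n, Continuous fun z => H (U n z) := fun n =>
    hHL.continuousOn.comp_continuous (hUL n).continuous (hU0 n)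
  have hHum : AEStronglyMeasurable (fun z => H (u z)) (ν.restrict A) :=
    aestronglyMeasurable_of_tendsto_ae atTop (fun n => (hHUm n).aestronglyMeasurable) hHu
  have hHui : IntegrableOn (fun z => H (u z)) A ν := by
    refine Integrable.mono' ((integrableOn_const hA.measure_lt_top.ne).add (hu1.const_mul KH))
      hHum (g := fun z => |H 0| + KH * u z) ?_
    filter_upwards [hu0'] with z hz using hHLb _ hz
  -- the four integrands in the limit
  have hI1 : IntegrableOn (fun z => η z * G (u z) * (u z ^ q * V z)) A ν := by
    refine huVA.bdd_mul (hη.continuous.aestronglyMeasurable.mul hGum) (c := Cη * G₀) ?_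
    filter_upwards [hu0', haeA hCη] with z hz hzη
    rw [norm_mul]
    exact mul_le_mul hzη (hGabs _ hz) (norm_nonneg _) hCη0
  have hI2 : IntegrableOn (fun z => G (u z) * (inner ℝ (spaceGrad η z) (X z) * F z)) A ν := by
    refine hgi.bdd_mul hGum (c := G₀) ?_
    filter_upwards [hu0'] with z hz using hGabs _ hz
  have hI3 : IntegrableOn (fun z => η z * G' (u z) * Z z) A ν := by
    refine hZi.bdd_mul (hη.continuous.aestronglyMeasurable.mul hG'um) (c := Cη * G₁) ?_
    filter_upwards [hu0', haeA hCη] with z hz hzη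
    rw [norm_mul]
    exact mul_le_mul hzη (hG₁ _ hz) (norm_nonneg _) hCη0
  have hI4 : IntegrableOn (fun z => timeDeriv η z * H (u z)) A ν := by
    refine hHui.bdd_mul (measurable_timeDeriv hη.continuous).aestronglyMeasurable (c := Cτ) ?_
    exact haeA hCτ
  refine ⟨hI1, hI2, hI3, hI4, ?_⟩
  -- limits
  have hψL : ∀ n, LocallyLipschitz fun z => η z * G (U n z) := fun n =>
    hη.mul_real (hGL.comp_locallyLipschitz (hUL n) (hU0 n))
  have hψc : ∀ n, HasCompactSupport fun z => η z * G (U n z) := fun n => hηc.mul_right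
  have hψA : ∀ n, tsupport (fun z => η z * G (U n z)) ⊆ A := fun n => tsupport_mul_subset_left
  have hbU : ∀ n, ∀ᵐ z ∂ν.restrict A, |η z * G (U n z)| ≤ Cη * G₀ := fun n => haeA fun z hz => by
    rw [abs_mul]
    exact mul_le_mul (hCη z hz) (hGabs _ (hU0 n z)) (abs_nonneg _) hCη0
  have hηGu : ∀ᵐ z ∂ν.restrict A,
      Tendsto (fun n => η z * G (U n z)) atTop (𝓝 (η z * G (u z))) := by
    filter_upwards [hGu] with z hz using hz.const_mul _
  have hψm : ∀ n, AEStronglyMeasurable (fun z => η z * G (U n z)) (ν.restrict A) := fun n =>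
    (hη.continuous.mul (hGUm n)).aestronglyMeasurable
  have hself : ∀ {f : M × ℝ → ℝ}, Tendsto (fun _ : ℕ =>
      ∫⁻ z in A, ENNReal.ofReal |f z - f z| ∂ν) atTop (𝓝 0) := by simp
  have hL1 := tendsto_integral_mul (mul_nonneg hCη0 hG00) hψm hbU hηGu
    (f := fun _ z => u z ^ q * V z) (fun _ => huVA.1) huVA hself
  have hL2 := tendsto_integral_mul hG00 (fun n => (hGUm n).aestronglyMeasurable)
    (fun n => Eventually.of_forall fun z => hGabs _ (hU0 n z)) hGu
    (f := fun _ z => inner ℝ (spaceGrad η z) (X z) * F z) (fun _ => hgi.1) hgi hself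
  have hfm : ∀ n, AEStronglyMeasurable (fun z => inner ℝ (spaceGrad (U n) z) (X z) * F z)
      (ν.restrict A) := fun n => ((hinner (hUL n)).mul hFm).aestronglyMeasurable
  have hb3 : ∀ n, ∀ᵐ z ∂ν.restrict A, |η z * G' (U n z)| ≤ Cη * G₁ := fun n =>
    haeA fun z hz => by
      rw [abs_mul]
      exact mul_le_mul (hCη z hz) (hG₁ _ (hU0 n z)) (abs_nonneg _) hCη0
  have hm3 : ∀ n, AEStronglyMeasurable (fun z => η z * G' (U n z)) (ν.restrict A) := fun n =>
    (hη.continuous.mul (hG'Um n)).aestronglyMeasurable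
  have hL3 := tendsto_integral_mul (mul_nonneg hCη0 hG10) hm3 hb3
    (by filter_upwards [hG'u] with z hz using hz.const_mul _) hfm hZi hU3
  have hL4 := tendsto_integral_mul (mul_nonneg hCη0 hG00) hψm hbU hηGu
    (f := fun _ => v) (fun _ => hvm) hv1 hself
  have hL5 := tendsto_integral_mul (mul_nonneg hCη0 hG00) hψm hbU hηGu
    (fun n => (hUt n).1) hv1 hU2
  have hL6 : Tendsto (fun n => ∫ z in A, timeDeriv η z * H (U n z) ∂ν) atTop
      (𝓝 (∫ z in A, timeDeriv η z * H (u z) ∂ν)) := by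
    refine tendsto_integral_mul hCτ0 (b := fun _ => timeDeriv η)
      (fun _ => (measurable_timeDeriv hη.continuous).aestronglyMeasurable)
      (fun _ => haeA hCτ) (Eventually.of_forall fun z => tendsto_const_nhds)
      (fun n => (hHUm n).aestronglyMeasurable) hHui ?_
    have h0 := ENNReal.Tendsto.const_mul (a := ENNReal.ofReal KH) hU1 (Or.inr ENNReal.ofReal_ne_top)
    rw [mul_zero] at h0
    refine tendsto_of_tendsto_of_tendsto_of_le_of_le tendsto_const_nhds h0 (fun _ => zero_le)
      fun n => ?_
    rw [← lintegral_const_mul' _ _ ENNReal.ofReal_ne_top]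
    refine lintegral_mono_ae ?_
    filter_upwards [hu0'] with z hz
    rw [← ENNReal.ofReal_mul (show (0 : ℝ) ≤ (KH : ℝ) from KH.2)]
    exact ENNReal.ofReal_le_ofReal (hHL.dist_le_mul _ (hU0 n z) _ hz)
  -- The chain rule for H(u) in weak form: both sides are limits of the corresponding integrals for
  -- Uₙ, where integration by parts is classical.
  have hkey : ∫ z in A, η z * G (u z) * v z ∂ν = - ∫ z in A, timeDeriv η z * H (u z) ∂ν := by
    refine tendsto_nhds_unique hL5 (hL6.neg.congr fun n => ?_)
    rw [hν, weightedSpaceTimeMeasure, setIntegral_timeDeriv_mul_comp hη hηc (hUL n) (hU0 n) hHL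
      hGc hHd hA subset_rfl, neg_neg]
  -- The test function is kept fixed while u is approximated by U_k; integration by parts is used
  -- with H the identity.
  have htime : ∀ n, ∫ z in A, timeDeriv (fun z => η z * G (U n z)) z * u z ∂ν =
      - ∫ z in A, η z * G (U n z) * v z ∂ν := fun n => by
    obtain ⟨C, hC0, hC⟩ := hdt (hψL n)
    have h1 := tendsto_integral_mul hC0 (b := fun _ => timeDeriv fun z => η z * G (U n z))
      (fun _ => (measurable_timeDeriv (hψL n).continuous).aestronglyMeasurable)
      (fun _ => haeA hC) (Eventually.of_forall fun z => tendsto_const_nhds)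
      (fun k => (hUL k).continuous.aestronglyMeasurable) hu1 hU1
    have h2 := tendsto_integral_mul (mul_nonneg hCη0 hG00) (fun _ : ℕ => hψm n) (fun _ => hbU n)
      (Eventually.of_forall fun z => tendsto_const_nhds) (fun k => (hUt k).1) hv1 hU2
    refine tendsto_nhds_unique h1 (h2.neg.congr fun k => ?_)
    have := setIntegral_timeDeriv_mul_comp (μ := weightedMeasure N a) (hψL n) (hψc n) (hUL k)
      (hU0 k) (G := fun _ => 1) (H := id) (KH := 1) LipschitzWith.id.lipschitzOnWith
      continuousOn_const (fun y _ => hasDerivAt_id y) hA (hψA n)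
    simp only [id, mul_one] at this
    exact this.symm
  -- The weak inequality tested with η G(Uₙ), which is Lipschitz, unlike η G(u). It is asserted only
  -- for large n because L¹ convergence gives integrability of ⟨∇Uₙ, X⟩ F only eventually.
  have hweak : ∀ᶠ n in atTop, ∫ z in A, η z * G (U n z) * (u z ^ q * V z) ∂ν ≤
      ∫ z in A, G (U n z) * (inner ℝ (spaceGrad η z) (X z) * F z) ∂ν +
      ∫ z in A, η z * G' (U n z) * (inner ℝ (spaceGrad (U n) z) (X z) * F z) ∂ν +
      ∫ z in A, η z * G (U n z) * v z ∂ν := by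
    filter_upwards [eventually_integrable_of_tendsto hfm hZi hU3] with n hn
    have hres : ∀ f : M × ℝ → ℝ, (∀ z, z ∉ A → f z = 0) →
        ∫ z in spaceTime M, f z ∂ν = ∫ z in A, f z ∂ν := fun f hf =>
      setIntegral_eq_of_subset_of_forall_sdiff_eq_zero measurableSet_spaceTime hηS
        fun z hz => hf z hz.2
    have h0 := hw _ (hψL n) (hψc n) ((hψA n).trans hηS)
      fun z => mul_nonneg (hη0 z) (hG0 _ (hU0 n z))
    rw [hres, hres, hres, htime n] at h0
    · refine (le_of_eq ?_).trans (h0.trans (le_of_eq ?_))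
      · simp only [mul_assoc]
      · rw [sub_neg_eq_add]
        congr 1
        rw [← integral_add]
        · refine integral_congr_ae ?_
          filter_upwards [hacA.ae_le (ae_mdifferentiableAt (N := N) hη),
            hacA.ae_le (ae_mdifferentiableAt (N := N) (hUL n))] with z h1 h2
          rw [inner_spaceGrad_mul_comp h1 h2 (hGd _ (hU0 n z))]
          simp only [hF]
          ring
        · exact hgi.bdd_mul (hGUm n).aestronglyMeasurable (c := G₀)
            (Eventually.of_forall fun z => hGabs _ (hU0 n z))
        · exact hn.bdd_mul (hm3 n) (hb3 n)
    · intro z hz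
      rw [timeDeriv_eq_zero_of_notMem_tsupport fun h => hz (hψA n h), zero_mul]
    · intro z hz
      rw [spaceGrad_eq_zero_of_notMem_tsupport fun h => hz (hψA n h), inner_zero_left]
      simp
    · intro z hz
      rw [image_eq_zero_of_notMem_tsupport hz]
      simp
  have := le_of_tendsto_of_tendsto hL1 ((hL2.add hL3).add hL4) hweak
  rw [hkey] at this
  linarith

theorem lipschitzOnWith_add_rpow {ε e : ℝ} (hε : 0 < ε) (he : e ≤ 1) :
    ∃ K : ℝ≥0, LipschitzOnWith K (fun y => (y + ε) ^ e) (Ici 0) := by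
  refine ⟨Real.toNNReal (|e| * ε ^ (e - 1)), ?_⟩
  refine (convex_Ici 0).lipschitzOnWith_of_nnnorm_deriv_le (fun y hy => ?_) fun y hy => ?_
  · exact ((hasDerivAt_id y).add_const ε).rpow_const (p := e)
      (Or.inl (add_pos_of_nonneg_of_pos hy hε).ne') |>.differentiableAt
  · have hy : 0 ≤ y := hy
    have h1 : HasDerivAt (fun y => (y + ε) ^ e) _ y :=
      ((hasDerivAt_id y).add_const ε).rpow_const (p := e)
        (Or.inl (add_pos_of_nonneg_of_pos hy hε).ne')
    rw [h1.deriv, ← NNReal.coe_le_coe, coe_nnnorm, Real.coe_toNNReal _ (by positivity)]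
    simp only [id, one_mul, norm_mul, Real.norm_eq_abs]
    rw [abs_of_nonneg (Real.rpow_nonneg (add_nonneg hy hε.le) (e - 1))]
    exact mul_le_mul_of_nonneg_left
      (Real.rpow_le_rpow_of_nonpos hε (by linarith) (by linarith)) (abs_nonneg _)

/-- The energy inequality obtained by testing with `η (u + ε) ^ (-e)`. -/
theorem energy_inequality {p q m K : ℝ} (hp : 1 < p) (hm : 1 ≤ m) (hK : 0 ≤ K)
    {a : M → ℝ} (ha : Continuous a) {Φ : ℝ → ℝ} (hΦ : Measurable Φ)
    (hΦK : ∀ s, 0 ≤ s → 0 ≤ Φ s ∧ Φ s ≤ K) {V u v : M × ℝ → ℝ}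
    {X : ∀ z : M × ℝ, TangentSpace (𝓡 N) z.1} (h : HasWeakDerivatives p m a u X v)
    (hu0 : ∀ᵐ z ∂((weightedSpaceTimeMeasure N a).restrict (spaceTime M)), 0 ≤ u z)
    (hV0 : ∀ᵐ z ∂((weightedSpaceTimeMeasure N a).restrict (spaceTime M)), 0 ≤ V z)
    (huV : LocallyIntegrableOn (fun z => u z ^ q * V z) (spaceTime M)
      (weightedSpaceTimeMeasure N a))
    (hup : LocallyIntegrableOn (fun z => u z ^ (p + m - 1)) (spaceTime M)
      (weightedSpaceTimeMeasure N a))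
    (hXu : LocallyIntegrableOn (fun z => ‖X z‖ ^ p * u z ^ (m - 1)) (spaceTime M)
      (weightedSpaceTimeMeasure N a))
    (hw : ∀ ψ : M × ℝ → ℝ, LocallyLipschitz ψ → HasCompactSupport ψ → tsupport ψ ⊆ spaceTime M →
      (∀ z, 0 ≤ ψ z) →
      ∫ z in spaceTime M, ψ z * u z ^ q * V z ∂(weightedSpaceTimeMeasure N a) ≤
        (∫ z in spaceTime M,
          inner ℝ (spaceGrad ψ z) (X z) * u z ^ (m - 1) * ‖X z‖ ^ (p - 2) * Φ ‖X z‖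
            ∂(weightedSpaceTimeMeasure N a))
        - ∫ z in spaceTime M, timeDeriv ψ z * u z ∂(weightedSpaceTimeMeasure N a))
    {η : M × ℝ → ℝ} (hη : LocallyLipschitz η) (hηc : HasCompactSupport η)
    (hηS : tsupport η ⊆ spaceTime M) (hη0 : ∀ z, 0 ≤ η z) {g τ : M × ℝ → ℝ}
    (hg : ∀ᵐ z ∂((weightedSpaceTimeMeasure N a).restrict (spaceTime M)),
      ‖(spaceGrad η z : TangentSpace (𝓡 N) z.1)‖ ≤ g z)
    (hτ : ∀ᵐ z ∂((weightedSpaceTimeMeasure N a).restrict (spaceTime M)), -timeDeriv η z ≤ τ z)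
    {e ε : ℝ} (he0 : 0 ≤ e) (he1 : e < 1) (hε : 0 < ε) :
    ∫⁻ z in tsupport η, ENNReal.ofReal (η z * (u z + ε) ^ (-e) * (u z ^ q * V z))
      ∂(weightedSpaceTimeMeasure N a) ≠ ⊤ ∧
    ENNReal.ofReal e * ∫⁻ z in tsupport η, ENNReal.ofReal
      (η z * (u z + ε) ^ (-e - 1) * (‖X z‖ ^ p * u z ^ (m - 1) * Φ ‖X z‖))
      ∂(weightedSpaceTimeMeasure N a) ≠ ⊤ ∧
    ∫⁻ z in tsupport η, ENNReal.ofReal (η z * (u z + ε) ^ (-e) * (u z ^ q * V z))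
      ∂(weightedSpaceTimeMeasure N a) +
    ENNReal.ofReal e * ∫⁻ z in tsupport η, ENNReal.ofReal
      (η z * (u z + ε) ^ (-e - 1) * (‖X z‖ ^ p * u z ^ (m - 1) * Φ ‖X z‖))
      ∂(weightedSpaceTimeMeasure N a) ≤
    ∫⁻ z in tsupport η, ENNReal.ofReal
      (g z * ((u z + ε) ^ (-e) * (u z ^ (m - 1) * ‖X z‖ ^ (p - 1) * Φ ‖X z‖)) +
        τ z * ((u z + ε) ^ (1 - e) / (1 - e))) ∂(weightedSpaceTimeMeasure N a) := by
  have hmono : (weightedSpaceTimeMeasure N a).restrict (tsupport η) ≤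
      (weightedSpaceTimeMeasure N a).restrict (spaceTime M) := Measure.restrict_mono hηS le_rfl
  have hu0' := hmono.absolutelyContinuous.ae_le hu0
  have hV0' := hmono.absolutelyContinuous.ae_le hV0
  have hg' := hmono.absolutelyContinuous.ae_le hg
  have hτ' := hmono.absolutelyContinuous.ae_le hτ
  have hpos : ∀ {y : ℝ}, 0 ≤ y → 0 < y + ε := fun hy => add_pos_of_nonneg_of_pos hy hε
  have hd : ∀ (r y : ℝ), 0 ≤ y → HasDerivAt (fun y => (y + ε) ^ r) (r * (y + ε) ^ (r - 1)) y :=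
    fun r y hy => by
      simpa using ((hasDerivAt_id y).add_const ε).rpow_const (p := r) (Or.inl (hpos hy).ne')
  have hanti : ∀ {r y : ℝ}, r ≤ 0 → 0 ≤ y → (y + ε) ^ r ≤ ε ^ r := fun hr hy =>
    Real.rpow_le_rpow_of_nonpos hε (by linarith) hr
  have h1e : 0 < 1 - e := by linarith
  obtain ⟨KG, hGL⟩ := lipschitzOnWith_add_rpow hε (show -e ≤ 1 by linarith)
  obtain ⟨KH, hHL⟩ := lipschitzOnWith_add_rpow hε (show 1 - e ≤ 1 by linarith)
  obtain ⟨h1, h2, h3, h4, h5⟩ := energy_inequality_of_hasDerivAt hp hm hK ha hΦ hΦK h hu0 huV hup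
    hXu hw hη hηc hηS hη0 (G := fun y => (y + ε) ^ (-e))
    (G' := fun y => -e * (y + ε) ^ (-e - 1)) (H := fun y => (y + ε) ^ (1 - e) / (1 - e))
    (KH := ‖(1 - e)⁻¹‖₊ * KH)
    (G₀ := ε ^ (-e)) (G₁ := e * ε ^ (-e - 1)) hGL
    (by
      have := (lipschitzWith_smul (1 - e)⁻¹ (β := ℝ)).comp_lipschitzOnWith hHL
      refine (congrArg (LipschitzOnWith _ · _) (funext fun y => ?_)).mp this
      simp [div_eq_inv_mul])
    (fun y hy => ((hd _ y hy).continuousAt.const_mul _).continuousWithinAt)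
    (fun y hy => hd _ y hy)
    (fun y hy => ((hd (1 - e) y hy).div_const (1 - e)).congr_deriv (by
      rw [mul_div_right_comm, div_self h1e.ne', one_mul]
      congr 1
      ring))
    (fun y hy => Real.rpow_nonneg (hpos hy).le _) (fun y hy => hanti (by linarith) hy)
    (fun y hy => by
      rw [abs_mul, abs_neg, abs_of_nonneg he0, abs_of_nonneg (Real.rpow_nonneg (hpos hy).le _)]
      exact mul_le_mul_of_nonneg_left (hanti (by linarith) hy) he0)
  set ν := weightedSpaceTimeMeasure N a with hν
  -- G' = -e (u + ε)^(-e-1) is nonpositive, so the term with G' moves to the left-hand side as a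
  -- nonnegative energy.
  have hJ : ENNReal.ofReal e * ∫⁻ z in tsupport η, ENNReal.ofReal
      (η z * (u z + ε) ^ (-e - 1) * (‖X z‖ ^ p * u z ^ (m - 1) * Φ ‖X z‖)) ∂ν =
      ∫⁻ z in tsupport η, ENNReal.ofReal (-(η z * (-e * (u z + ε) ^ (-e - 1)) *
        (‖X z‖ ^ p * u z ^ (m - 1) * Φ ‖X z‖))) ∂ν := by
    rw [← lintegral_const_mul' _ _ ENNReal.ofReal_ne_top]
    refine lintegral_congr fun z => ?_
    rw [← ENNReal.ofReal_mul he0]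
    congr 1
    ring
  have hZ0 : ∀ z, 0 ≤ u z → 0 ≤ ‖X z‖ ^ p * u z ^ (m - 1) * Φ ‖X z‖ := fun z hz =>
    mul_nonneg (mul_nonneg (by positivity) (Real.rpow_nonneg hz _)) (hΦK _ (norm_nonneg _)).1
  have hn1 : 0 ≤ᵐ[ν.restrict (tsupport η)]
      fun z => η z * (u z + ε) ^ (-e) * (u z ^ q * V z) := by
    filter_upwards [hu0', hV0'] with z hz hz'
    exact mul_nonneg (mul_nonneg (hη0 z) (Real.rpow_nonneg (hpos hz).le _))
      (mul_nonneg (Real.rpow_nonneg hz _) hz')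
  have hn3 : 0 ≤ᵐ[ν.restrict (tsupport η)] fun z => -(η z * (-e * (u z + ε) ^ (-e - 1)) *
        (‖X z‖ ^ p * u z ^ (m - 1) * Φ ‖X z‖)) := by
    filter_upwards [hu0'] with z hz
    have h0 := mul_nonneg (mul_nonneg (hη0 z) (mul_nonneg he0
      (Real.rpow_nonneg (hpos hz).le (-e - 1)))) (hZ0 z hz)
    simp only [Pi.zero_apply]
    linarith
  have h3n : Integrable (fun z => -(η z * (-e * (u z + ε) ^ (-e - 1)) *
      (‖X z‖ ^ p * u z ^ (m - 1) * Φ ‖X z‖))) (ν.restrict (tsupport η)) := h3.neg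
  rw [hJ]
  refine ⟨h1.lintegral_lt_top.ne, h3n.lintegral_lt_top.ne, ?_⟩
  rw [← ofReal_integral_eq_lintegral_ofReal h1 hn1, ← ofReal_integral_eq_lintegral_ofReal h3n hn3,
    ← ENNReal.ofReal_add (integral_nonneg_of_ae hn1) (integral_nonneg_of_ae hn3), integral_neg]
  have h6 : ∫ z in tsupport η, η z * (u z + ε) ^ (-e) * (u z ^ q * V z) ∂ν +
      -∫ z in tsupport η, η z * (-e * (u z + ε) ^ (-e - 1)) *
        (‖X z‖ ^ p * u z ^ (m - 1) * Φ ‖X z‖) ∂ν ≤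
      ∫ z in tsupport η, ((u z + ε) ^ (-e) * (inner ℝ (spaceGrad η z) (X z) *
        (u z ^ (m - 1) * ‖X z‖ ^ (p - 2) * Φ ‖X z‖)) -
        timeDeriv η z * ((u z + ε) ^ (1 - e) / (1 - e))) ∂ν := by
    rw [integral_sub h2 h4]
    linarith
  refine (ENNReal.ofReal_le_ofReal h6).trans ?_
  refine (ofReal_integral_le_lintegral _).trans (lintegral_mono_ae ?_)
  filter_upwards [hu0', hg', hτ'] with z hz hzg hzτ
  refine ENNReal.ofReal_le_ofReal ?_
  have hΘ := (hΦK _ (norm_nonneg (X z))).1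
  have hinn : inner ℝ (spaceGrad η z) (X z) * (u z ^ (m - 1) * ‖X z‖ ^ (p - 2) * Φ ‖X z‖) ≤
      g z * (u z ^ (m - 1) * ‖X z‖ ^ (p - 1) * Φ ‖X z‖) := by
    have hx : ‖X z‖ * ‖X z‖ ^ (p - 2) ≤ ‖X z‖ ^ (p - 1) := by
      rcases eq_or_lt_of_le (norm_nonneg (X z)) with h0 | h0
      · rw [← h0, zero_mul]
        positivity
      · rw [← Real.rpow_one_add' h0.le (by linarith)]
        exact le_of_eq (congrArg _ (by ring))
    have hi : inner ℝ (spaceGrad η z) (X z) ≤ g z * ‖X z‖ :=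
      (real_inner_le_norm _ _).trans (by gcongr)
    have hu : 0 ≤ u z ^ (m - 1) := Real.rpow_nonneg hz _
    have hg0 : 0 ≤ g z := (norm_nonneg _).trans hzg
    calc _ ≤ (g z * ‖X z‖) * (u z ^ (m - 1) * ‖X z‖ ^ (p - 2) * Φ ‖X z‖) := by gcongr
      _ = g z * (u z ^ (m - 1) * (‖X z‖ * ‖X z‖ ^ (p - 2)) * Φ ‖X z‖) := by ring
      _ ≤ _ := by gcongr
  have hû := Real.rpow_nonneg (hpos hz).le (-e)
  have hû' := div_nonneg (Real.rpow_nonneg (hpos hz).le (1 - e)) h1e.le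
  have := mul_le_mul_of_nonneg_left hinn hû
  have := mul_le_mul_of_nonneg_right hzτ hû'
  linarith

end Energy

/-! ### Integrals over logarithmic annuli -/

section Capacity

variable {M : Type*} [MetricSpace M]

/-- The logarithmic size of a point `(x, t)` of space-time, time being scaled by the power
`1 / θ`. -/
def logScale (x₀ : M) (θ : ℝ) (z : M × ℝ) : ℝ :=
  max (Real.log (max 1 (dist x₀ z.1))) (Real.log (max 1 z.2) / θ)

theorem continuous_logScale (x₀ : M) (θ : ℝ) : Continuous (logScale x₀ θ) := by
  have h1 : ∀ y : ℝ, max 1 y ≠ 0 := fun y => (zero_lt_one.trans_le (le_max_left _ _)).ne'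
  unfold logScale
  refine Continuous.max (Continuous.log (by fun_prop) fun _ => h1 _)
    ((Continuous.log (by fun_prop) fun _ => h1 _).div_const _)

theorem logScale_nonneg (x₀ : M) (θ : ℝ) (z : M × ℝ) : 0 ≤ logScale x₀ θ z :=
  (Real.log_nonneg (le_max_left _ _)).trans (le_max_left _ _)

theorem dist_le_of_logScale_le {x₀ : M} {θ k : ℝ} {z : M × ℝ} (h : logScale x₀ θ z ≤ k) :
    dist x₀ z.1 ≤ Real.exp k :=
  (le_max_right _ _).trans ((Real.log_le_iff_le_exp
    (zero_lt_one.trans_le (le_max_left _ _))).1 ((le_max_left _ _).trans h))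

theorem time_le_of_logScale_le {x₀ : M} {θ k : ℝ} (hθ : 0 < θ) {z : M × ℝ}
    (h : logScale x₀ θ z ≤ k) : z.2 ≤ Real.exp (θ * k) := by
  have h1 := (le_max_right _ _).trans h
  rw [div_le_iff₀ hθ, mul_comm] at h1
  exact (le_max_right _ _).trans ((Real.log_le_iff_le_exp
    (zero_lt_one.trans_le (le_max_left _ _))).1 h1)

theorem dist_lt_of_logScale_lt {x₀ : M} {θ k : ℝ} {z : M × ℝ} (h : logScale x₀ θ z < k) :
    dist x₀ z.1 < Real.exp k :=
  (le_max_right _ _).trans_lt ((Real.log_lt_iff_lt_exp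
    (zero_lt_one.trans_le (le_max_left _ _))).1 ((le_max_left _ _).trans_lt h))

/-- The logarithmic annulus in space-time between the scales `n` and `2 n`. -/
def logAnnulus (x₀ : M) (θ : ℝ) (n : ℕ) : Set (M × ℝ) :=
  {z | n ≤ logScale x₀ θ z ∧ logScale x₀ θ z ≤ 2 * n}

variable [MeasurableSpace M] [BorelSpace M] [SecondCountableTopology M]

theorem measurableSet_logAnnulus (x₀ : M) (θ : ℝ) (n : ℕ) :
    MeasurableSet (logAnnulus x₀ θ n) :=
  (measurableSet_le measurable_const (continuous_logScale x₀ θ).measurable).inter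
    (measurableSet_le (continuous_logScale x₀ θ).measurable measurable_const)

/-- The sublevel set lies in the product of the ball of radius e^k and the interval (0, e^(θk)],
over which the integral factorizes; log R = k and log T = θk produce the power of k. -/
theorem exists_lintegral_sublevel_le {μ : Measure M} [SFinite μ] {x₀ : M} {A : M → ℝ≥0∞}
    {B : ℝ → ℝ≥0∞} (hA : AEMeasurable A μ) (hB : AEMeasurable B (volume.restrict (Ioi 0)))
    {C s₁ s₂ d₁ d₂ θ γ β : ℝ} (hC : 0 ≤ C) (hθ : 0 < θ)
    (hA' : ∀ᶠ R : ℝ in atTop, ∫⁻ x in Metric.ball x₀ R, A x ∂μ ≤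
      ENNReal.ofReal (C * R ^ s₁ * Real.log R ^ d₁))
    (hB' : ∀ᶠ T : ℝ in atTop, ∫⁻ t in Ioc 0 T, B t ≤
      ENNReal.ofReal (C * T ^ s₂ * Real.log T ^ d₂))
    (hγ : s₁ + θ * s₂ ≤ γ) (hβ : d₁ + d₂ ≤ β) :
    ∃ C', 0 ≤ C' ∧ ∀ᶠ k : ℝ in atTop,
      ∫⁻ z in {z | z ∈ spaceTime M ∧ logScale x₀ θ z < k}, A z.1 * B z.2 ∂(μ.prod volume) ≤
        ENNReal.ofReal (C' * Real.exp (γ * k) * k ^ β) := by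
  refine ⟨C ^ 2 * θ ^ d₂, by positivity, ?_⟩
  have h1 := Real.tendsto_exp_atTop.eventually hA'
  have h2 := (Real.tendsto_exp_atTop.comp (tendsto_id.const_mul_atTop hθ)).eventually hB'
  filter_upwards [h1, h2, eventually_ge_atTop 1] with k hk1 hk2 hk
  have hk0 : 0 < k := zero_lt_one.trans_le hk
  simp only [Function.comp, id] at hk2
  have hsub : {z | z ∈ spaceTime M ∧ logScale x₀ θ z < k} ⊆
      Metric.ball x₀ (Real.exp k) ×ˢ Ioc 0 (Real.exp (θ * k)) := fun z hz =>
    ⟨by rw [Metric.mem_ball, dist_comm]; exact dist_lt_of_logScale_lt hz.2,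
      hz.1.2, time_le_of_logScale_le hθ hz.2.le⟩
  refine (lintegral_mono_set hsub).trans ?_
  rw [← Measure.prod_restrict, lintegral_prod_mul hA.restrict
    (hB.mono_measure (Measure.restrict_mono Ioc_subset_Ioi_self le_rfl))]
  refine (mul_le_mul' hk1 hk2).trans ?_
  have hlog : 0 ≤ C * Real.exp k ^ s₁ * Real.log (Real.exp k) ^ d₁ := by
    rw [Real.log_exp]
    positivity
  rw [← ENNReal.ofReal_mul hlog]
  refine ENNReal.ofReal_le_ofReal ?_
  rw [Real.log_exp, Real.log_exp, ← Real.exp_mul, ← Real.exp_mul, Real.mul_rpow hθ.le hk0.le]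
  calc _ = C ^ 2 * θ ^ d₂ * Real.exp ((s₁ + θ * s₂) * k) * k ^ (d₁ + d₂) := by
        rw [Real.rpow_add hk0, add_mul, Real.exp_add, mul_comm k s₁,
          show θ * k * s₂ = θ * s₂ * k by ring]
        ring
    _ ≤ _ := by gcongr

/-- On the shell k ≤ ℓ < k + 1 the weight e^(-γℓ) cancels the growth e^(γ(k+1)) up to a factor e^γ,
so a shell contributes O(n^β). There are n + 1 shells, whence the exponent 1 + β. -/
theorem exists_lintegral_logAnnulus_le {μ : Measure M} [SFinite μ] {x₀ : M} {A : M → ℝ≥0∞}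
    {B : ℝ → ℝ≥0∞} (hA : AEMeasurable A μ) (hB : AEMeasurable B (volume.restrict (Ioi 0)))
    {C s₁ s₂ d₁ d₂ θ γ β : ℝ} (hC : 0 ≤ C) (hθ : 0 < θ)
    (hA' : ∀ᶠ R : ℝ in atTop, ∫⁻ x in Metric.ball x₀ R, A x ∂μ ≤
      ENNReal.ofReal (C * R ^ s₁ * Real.log R ^ d₁))
    (hB' : ∀ᶠ T : ℝ in atTop, ∫⁻ t in Ioc 0 T, B t ≤
      ENNReal.ofReal (C * T ^ s₂ * Real.log T ^ d₂))
    (hγ : s₁ + θ * s₂ ≤ γ) (hγ0 : 0 ≤ γ) (hβ : d₁ + d₂ ≤ β) (hβ0 : 0 ≤ β) :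
    ∃ C', 0 ≤ C' ∧ ∀ᶠ n : ℕ in atTop,
      ∫⁻ z in spaceTime M ∩ logAnnulus x₀ θ n,
        ENNReal.ofReal (Real.exp (-γ * logScale x₀ θ z)) * (A z.1 * B z.2) ∂(μ.prod volume) ≤
        ENNReal.ofReal (C' * (n : ℝ) ^ (1 + β)) := by
  obtain ⟨C₁, hC₁, h⟩ := exists_lintegral_sublevel_le hA hB hC hθ hA' hB' hγ hβ
  -- The 2 comes from n + 1 ≤ 2n, the 3 from k + 1 ≤ 3n for k ≤ 2n.
  refine ⟨2 * (C₁ * Real.exp γ * 3 ^ β), by positivity, ?_⟩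
  obtain ⟨k₀, hk₀⟩ := eventually_atTop.1 h
  filter_upwards [eventually_ge_atTop ⌈k₀⌉₊, eventually_ge_atTop 1] with n hn hn1
  have hn1' : (1 : ℝ) ≤ n := by exact_mod_cast hn1
  have hnk : k₀ ≤ n := (Nat.le_ceil k₀).trans (by exact_mod_cast hn)
  set E : ℕ → Set (M × ℝ) := fun k => {z | z ∈ spaceTime M ∧ k ≤ logScale x₀ θ z ∧
    logScale x₀ θ z < k + 1} with hE
  have hEm : ∀ k, MeasurableSet (E k) := fun k => measurableSet_spaceTime.inter
    ((measurableSet_le measurable_const (continuous_logScale x₀ θ).measurable).inter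
    (measurableSet_lt (continuous_logScale x₀ θ).measurable measurable_const))
  have hcov : spaceTime M ∩ logAnnulus x₀ θ n ⊆ ⋃ k ∈ Finset.Icc n (2 * n), E k := by
    rintro z ⟨hzS, hz1, hz2⟩
    have h0 := logScale_nonneg x₀ θ z
    refine mem_iUnion₂.2 ⟨⌊logScale x₀ θ z⌋₊, Finset.mem_Icc.2 ⟨Nat.le_floor hz1, ?_⟩, hzS,
      Nat.floor_le h0, Nat.lt_floor_add_one _⟩
    exact Nat.floor_le_of_le (by push_cast; exact hz2)
  have hshell : ∀ k ∈ Finset.Icc n (2 * n), ∫⁻ z in E k,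
      ENNReal.ofReal (Real.exp (-γ * logScale x₀ θ z)) * (A z.1 * B z.2) ∂(μ.prod volume) ≤
      ENNReal.ofReal (C₁ * Real.exp γ * (3 * n) ^ β) := by
    intro k hk
    obtain ⟨hk1, hk2⟩ := Finset.mem_Icc.1 hk
    have hk1' : (n : ℝ) ≤ k := by exact_mod_cast hk1
    have hk2' : (k : ℝ) ≤ 2 * n := by exact_mod_cast hk2
    calc _ ≤ ∫⁻ z in E k, ENNReal.ofReal (Real.exp (-γ * k)) * (A z.1 * B z.2)
            ∂(μ.prod volume) := by
          refine setLIntegral_mono' (hEm k) fun z hz => ?_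
          gcongr ENNReal.ofReal (Real.exp ?_) * _
          nlinarith [hz.2.1]
      _ = ENNReal.ofReal (Real.exp (-γ * k)) * ∫⁻ z in E k, A z.1 * B z.2 ∂(μ.prod volume) :=
          lintegral_const_mul' _ _ ENNReal.ofReal_ne_top
      _ ≤ ENNReal.ofReal (Real.exp (-γ * k)) *
            ENNReal.ofReal (C₁ * Real.exp (γ * (k + 1)) * (k + 1) ^ β) := by
          gcongr
          refine (lintegral_mono_set ?_).trans (hk₀ (k + 1) (by linarith))
          exact fun z hz => ⟨hz.1, hz.2.2⟩
      _ ≤ _ := by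
          rw [← ENNReal.ofReal_mul (Real.exp_nonneg _)]
          refine ENNReal.ofReal_le_ofReal ?_
          have : Real.exp (-γ * k) * Real.exp (γ * (k + 1)) = Real.exp γ := by
            rw [← Real.exp_add]
            congr 1
            ring
          calc _ = C₁ * (Real.exp (-γ * k) * Real.exp (γ * (k + 1))) * (k + 1) ^ β := by ring
            _ ≤ _ := by
              rw [this]
              gcongr
              linarith
  calc _ ≤ ∫⁻ z in ⋃ k ∈ Finset.Icc n (2 * n), E k,
        ENNReal.ofReal (Real.exp (-γ * logScale x₀ θ z)) * (A z.1 * B z.2) ∂(μ.prod volume) :=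
        lintegral_mono_set hcov
    _ ≤ ∑ k ∈ Finset.Icc n (2 * n), ∫⁻ z in E k,
        ENNReal.ofReal (Real.exp (-γ * logScale x₀ θ z)) * (A z.1 * B z.2) ∂(μ.prod volume) := by
        rw [← lintegral_finsetSum_measure]
        refine lintegral_mono' ?_ le_rfl
        rw [← Measure.sum_coe_finset]
        exact Measure.restrict_biUnion_le (T := (Finset.Icc n (2 * n) : Set ℕ))
          (Finset.countable_toSet _)
    _ ≤ ∑ k ∈ Finset.Icc n (2 * n), ENNReal.ofReal (C₁ * Real.exp γ * (3 * n) ^ β) :=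
        Finset.sum_le_sum hshell
    _ = ENNReal.ofReal ((n + 1) * (C₁ * Real.exp γ * (3 * n) ^ β)) := by
        rw [Finset.sum_const, Nat.card_Icc, nsmul_eq_mul, show 2 * n + 1 - n = n + 1 by omega,
          ← ENNReal.ofReal_natCast, ← ENNReal.ofReal_mul (by positivity), Nat.cast_succ]
    _ ≤ _ := by
        refine ENNReal.ofReal_le_ofReal ?_
        rw [Real.mul_rpow (by norm_num) (by positivity), Real.rpow_add (by positivity),
          Real.rpow_one]
        calc _ = (n + 1) * ((C₁ * Real.exp γ * 3 ^ β) * (n : ℝ) ^ β) := by ring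
          _ ≤ (2 * n) * ((C₁ * Real.exp γ * 3 ^ β) * (n : ℝ) ^ β) := by
            gcongr
            linarith
          _ = _ := by ring

end Capacity

/-! ### Logarithmic cutoff functions -/

theorem abs_log_sub_log_le {ρ a b : ℝ} (hρ : 0 < ρ) (ha : ρ ≤ a) (hb : ρ ≤ b) :
    |Real.log a - Real.log b| ≤ |a - b| / ρ := by
  have key : ∀ {a b : ℝ}, ρ ≤ a → ρ ≤ b → Real.log a - Real.log b ≤ |a - b| / ρ := by
    intro a b ha hb
    have ha0 := hρ.trans_le ha
    have hb0 := hρ.trans_le hb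
    rw [← Real.log_div ha0.ne' hb0.ne']
    refine (Real.log_le_sub_one_of_pos (div_pos ha0 hb0)).trans ?_
    rw [div_sub_one hb0.ne']
    calc _ ≤ |a - b| / b := by gcongr; exact le_abs_self _
      _ ≤ _ := by gcongr
  refine abs_le.2 ⟨?_, key ha hb⟩
  have := key hb ha
  rw [abs_sub_comm] at this
  linarith

/-- Here c is the other entry in the maximum defining `logScale`. Where c dominates strictly, the
function is locally constant; otherwise max 1 y₀ is the exponential of l times the maximum, and the
slope of the logarithm is its reciprocal. The factor 2 allows for max 1 y > (max 1 y₀)/2 near y₀. -/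
theorem eventually_abs_max_log_sub_le (c : ℝ) {l : ℝ} (hl : 0 < l) (y₀ : ℝ) :
    ∀ᶠ y in 𝓝 y₀, |max c (Real.log (max 1 y) / l) - max c (Real.log (max 1 y₀) / l)| ≤
      2 * Real.exp (-l * max c (Real.log (max 1 y₀) / l)) / l * |y - y₀| := by
  have h1 : ∀ y : ℝ, 0 < max 1 y := fun y => zero_lt_one.trans_le (le_max_left _ _)
  have hcont : Continuous fun y : ℝ => Real.log (max 1 y) / l :=
    (Continuous.log (by fun_prop) fun y => (h1 y).ne').div_const _
  rcases lt_or_ge (Real.log (max 1 y₀) / l) c with h | h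
  · filter_upwards [hcont.continuousAt.eventually_lt_const h] with y hy
    rw [max_eq_left hy.le, max_eq_left h.le, sub_self, abs_zero]
    positivity
  · have h2 : ∀ᶠ y in 𝓝 y₀, max 1 y₀ / 2 < max 1 y :=
      (Continuous.continuousAt (by fun_prop)).eventually_const_lt (half_lt_self (h1 y₀))
    filter_upwards [h2] with y hy
    have h3 : Real.exp (-l * max c (Real.log (max 1 y₀) / l)) = (max 1 y₀)⁻¹ := by
      rw [max_eq_right h, neg_mul, mul_div_cancel₀ _ hl.ne', Real.exp_neg, Real.exp_log (h1 _)]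
    rw [h3]
    have h4 := abs_log_sub_log_le (half_pos (h1 y₀)) hy.le (half_lt_self (h1 y₀)).le
    have h5 : |max 1 y - max 1 y₀| ≤ |y - y₀| := by
      simpa using abs_max_sub_max_le_max (1 : ℝ) y 1 y₀
    have h6 : |max c (Real.log (max 1 y) / l) - max c (Real.log (max 1 y₀) / l)| ≤
        |Real.log (max 1 y) / l - Real.log (max 1 y₀) / l| := by
      simpa using abs_max_sub_max_le_max c (Real.log (max 1 y) / l) c (Real.log (max 1 y₀) / l)
    refine h6.trans ?_
    rw [← sub_div, abs_div, abs_of_pos hl]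
    calc _ ≤ |y - y₀| / (max 1 y₀ / 2) / l := by
          gcongr
          exact h4.trans (by gcongr)
      _ = _ := by ring

section Cutoff

variable {M : Type*} [MetricSpace M]

/-- The cutoff function of the variable `logScale`, equal to `1` below `n` and to `0` above
`2 n`. -/
def scaleCutoff (x₀ : M) (θ : ℝ) (n : ℕ) (z : M × ℝ) : ℝ :=
  max 0 (min 1 (2 - logScale x₀ θ z / n))

/-- The cutoff function in time, equal to `0` for times less than `1 / n` and to `1` for times
greater than `2 / n`. -/
def timeCutoff (n : ℕ) (z : M × ℝ) : ℝ := max 0 (min 1 (n * z.2 - 1))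

/-- The test function `timeCutoff * scaleCutoff ^ s`. -/
def cutoff (x₀ : M) (θ : ℝ) (n s : ℕ) (z : M × ℝ) : ℝ :=
  timeCutoff n z * scaleCutoff x₀ θ n z ^ s

theorem scaleCutoff_nonneg (x₀ : M) (θ : ℝ) (n : ℕ) (z : M × ℝ) : 0 ≤ scaleCutoff x₀ θ n z :=
  le_max_left _ _

theorem scaleCutoff_le_one (x₀ : M) (θ : ℝ) (n : ℕ) (z : M × ℝ) : scaleCutoff x₀ θ n z ≤ 1 :=
  max_le zero_le_one (min_le_left _ _)

theorem timeCutoff_nonneg (n : ℕ) (z : M × ℝ) : 0 ≤ timeCutoff n z := le_max_left _ _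

theorem timeCutoff_le_one (n : ℕ) (z : M × ℝ) : timeCutoff n z ≤ 1 :=
  max_le zero_le_one (min_le_left _ _)

theorem cutoff_nonneg (x₀ : M) (θ : ℝ) (n s : ℕ) (z : M × ℝ) : 0 ≤ cutoff x₀ θ n s z :=
  mul_nonneg (timeCutoff_nonneg n z) (pow_nonneg (scaleCutoff_nonneg x₀ θ n z) s)

theorem cutoff_le_one (x₀ : M) (θ : ℝ) (n s : ℕ) (z : M × ℝ) : cutoff x₀ θ n s z ≤ 1 :=
  mul_le_one₀ (timeCutoff_le_one n z) (pow_nonneg (scaleCutoff_nonneg x₀ θ n z) s)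
    (pow_le_one₀ (scaleCutoff_nonneg x₀ θ n z) (scaleCutoff_le_one x₀ θ n z))

theorem abs_clamp_sub_le (a b : ℝ) : |max 0 (min 1 a) - max 0 (min 1 b)| ≤ |a - b| := by
  have h1 := abs_max_sub_max_le_max 0 (min 1 a) 0 (min 1 b)
  have h2 := abs_min_sub_min_le_max 1 a 1 b
  simp only [sub_self, abs_zero, abs_nonneg, sup_of_le_right] at h1 h2
  exact h1.trans h2

theorem abs_scaleCutoff_sub_le (x₀ : M) (θ : ℝ) (n : ℕ) (y z : M × ℝ) :
    |scaleCutoff x₀ θ n y - scaleCutoff x₀ θ n z| ≤ |logScale x₀ θ y - logScale x₀ θ z| / n := by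
  refine (abs_clamp_sub_le _ _).trans (le_of_eq ?_)
  rw [sub_sub_sub_cancel_left, ← sub_div, abs_div, abs_sub_comm, Nat.abs_cast]

theorem lipschitzWith_log_max_one : LipschitzWith 1 fun y : ℝ => Real.log (max 1 y) := by
  refine LipschitzWith.of_dist_le_mul fun a b => ?_
  rw [NNReal.coe_one, one_mul, Real.dist_eq, Real.dist_eq]
  have h := abs_log_sub_log_le one_pos (le_max_left 1 a) (le_max_left 1 b)
  rw [div_one] at h
  exact h.trans (by simpa using abs_max_sub_max_le_max 1 a 1 b)

theorem locallyLipschitz_logScale (x₀ : M) (θ : ℝ) : LocallyLipschitz (logScale x₀ θ) := by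
  have h1 : LipschitzWith (1 * (1 * 1)) fun z : M × ℝ => Real.log (max 1 (dist x₀ z.1)) :=
    lipschitzWith_log_max_one.comp ((LipschitzWith.dist_right x₀).comp LipschitzWith.prod_fst)
  have h2 : LipschitzWith _ fun z : M × ℝ => θ⁻¹ • Real.log (max 1 z.2) :=
    (lipschitzWith_smul θ⁻¹).comp (lipschitzWith_log_max_one.comp LipschitzWith.prod_snd)
  have h3 := (h1.max h2).locallyLipschitz
  simp only [smul_eq_mul, ← div_eq_inv_mul] at h3
  exact h3

theorem locallyLipschitz_scaleCutoff (x₀ : M) (θ : ℝ) (n : ℕ) :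
    LocallyLipschitz (scaleCutoff x₀ θ n) := by
  have h : LipschitzWith (Real.toNNReal (1 / n)) fun y : ℝ => max 0 (min 1 (2 - y / n)) := by
    refine LipschitzWith.of_dist_le_mul fun a b => (abs_clamp_sub_le _ _).trans (le_of_eq ?_)
    rw [sub_sub_sub_cancel_left, ← sub_div, abs_div, Nat.abs_cast, Real.coe_toNNReal _
      (by positivity), Real.dist_eq, abs_sub_comm]
    ring
  exact h.locallyLipschitz.comp (locallyLipschitz_logScale x₀ θ)

theorem locallyLipschitz_timeCutoff (n : ℕ) : LocallyLipschitz (timeCutoff (M := M) n) := by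
  have h : LipschitzWith (n : ℝ≥0) fun y : ℝ => max 0 (min 1 (n * y - 1)) := by
    refine LipschitzWith.of_dist_le_mul fun a b => (abs_clamp_sub_le _ _).trans (le_of_eq ?_)
    rw [sub_sub_sub_cancel_right, ← mul_sub, abs_mul, Nat.abs_cast, Real.dist_eq,
      NNReal.coe_natCast]
  exact (h.comp (LipschitzWith.prod_snd (α := M))).locallyLipschitz

theorem locallyLipschitz_cutoff (x₀ : M) (θ : ℝ) (n s : ℕ) :
    LocallyLipschitz (cutoff x₀ θ n s) :=
  (locallyLipschitz_timeCutoff n).mul_real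
    (((contDiff_id.pow s : ContDiff ℝ 1 fun y : ℝ => y ^ s).locallyLipschitz).comp
      (locallyLipschitz_scaleCutoff x₀ θ n))

theorem tsupport_cutoff_subset (x₀ : M) {θ : ℝ} (hθ : 0 < θ) {n s : ℕ} (hn : n ≠ 0) (hs : s ≠ 0) :
    tsupport (cutoff x₀ θ n s) ⊆
      Metric.closedBall x₀ (Real.exp (2 * n)) ×ˢ Icc (1 / (n : ℝ)) (Real.exp (θ * (2 * n))) := by
  have hn0 : (0 : ℝ) < n := by positivity
  refine closure_minimal (fun z hz => ?_) (Metric.isClosed_closedBall.prod isClosed_Icc)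
  have h1 : timeCutoff n z ≠ 0 := left_ne_zero_of_mul hz
  have h2 : scaleCutoff x₀ θ n z ≠ 0 := fun h => hz (by simp [cutoff, h, hs])
  have h3 : logScale x₀ θ z ≤ 2 * n := by
    by_contra h
    push Not at h
    refine h2 (max_eq_left ((min_le_right _ _).trans ?_))
    rw [sub_nonpos, le_div_iff₀ hn0]
    exact h.le
  have h4 : 1 / (n : ℝ) ≤ z.2 := by
    by_contra h
    push Not at h
    refine h1 (max_eq_left ((min_le_right _ _).trans ?_))
    rw [lt_div_iff₀ hn0] at h
    linarith
  exact ⟨by rw [Metric.mem_closedBall, dist_comm]; exact dist_le_of_logScale_le h3, h4,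
    time_le_of_logScale_le hθ h3⟩

theorem tsupport_cutoff_subset_spaceTime (x₀ : M) {θ : ℝ} (hθ : 0 < θ) {n s : ℕ} (hn : n ≠ 0)
    (hs : s ≠ 0) : tsupport (cutoff x₀ θ n s) ⊆ spaceTime M := fun z hz =>
  ⟨mem_univ _, lt_of_lt_of_le (by positivity) (tsupport_cutoff_subset x₀ hθ hn hs hz).2.1⟩

theorem hasCompactSupport_cutoff [ProperSpace M] (x₀ : M) {θ : ℝ} (hθ : 0 < θ) {n s : ℕ}
    (hn : n ≠ 0) (hs : s ≠ 0) : HasCompactSupport (cutoff x₀ θ n s) :=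
  ((isCompact_closedBall _ _).prod isCompact_Icc).of_isClosed_subset (isClosed_tsupport _)
    (tsupport_cutoff_subset x₀ hθ hn hs)

/-- The annulus is closed, so the derivative bounds may be taken to be 0 everywhere off it. -/
theorem scaleCutoff_eventually_const {x₀ : M} {θ : ℝ} {n : ℕ} (hn : n ≠ 0) {z : M × ℝ}
    (hz : z ∉ logAnnulus x₀ θ n) :
    ∀ᶠ y in 𝓝 z, scaleCutoff x₀ θ n y = scaleCutoff x₀ θ n z := by
  have hn0 : (0 : ℝ) < n := by positivity
  have h1 : ∀ y, logScale x₀ θ y < n → scaleCutoff x₀ θ n y = 1 := fun y hy => by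
    have : logScale x₀ θ y / n ≤ 1 := (div_le_one hn0).2 hy.le
    rw [scaleCutoff, min_eq_left (by linarith), max_eq_right zero_le_one]
  have h2 : ∀ y, 2 * n < logScale x₀ θ y → scaleCutoff x₀ θ n y = 0 := fun y hy => by
    have : 2 ≤ logScale x₀ θ y / n := (le_div_iff₀ hn0).2 hy.le
    exact max_eq_left ((min_le_right _ _).trans (by linarith))
  have hc := (continuous_logScale x₀ θ).continuousAt (x := z)
  by_cases h : logScale x₀ θ z < n
  · filter_upwards [hc.eventually_lt_const h] with y hy
    rw [h1 y hy, h1 z h]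
  · have h' : 2 * n < logScale x₀ θ z := by
      by_contra h3
      exact hz ⟨not_lt.1 h, not_lt.1 h3⟩
    filter_upwards [hc.eventually_const_lt h'] with y hy
    rw [h2 y hy, h2 z h']

/-- The bound for the gradient of `scaleCutoff`. -/
def gradBound (x₀ : M) (θ : ℝ) (n : ℕ) : M × ℝ → ℝ :=
  (logAnnulus x₀ θ n).indicator fun z => 2 * Real.exp (-logScale x₀ θ z) / n

/-- The bound for the time derivative of `scaleCutoff`. -/
def timeBound (x₀ : M) (θ : ℝ) (n : ℕ) : M × ℝ → ℝ :=
  (logAnnulus x₀ θ n).indicator fun z => 2 * Real.exp (-θ * logScale x₀ θ z) / (θ * n)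

theorem gradBound_nonneg (x₀ : M) (θ : ℝ) (n : ℕ) (z : M × ℝ) : 0 ≤ gradBound x₀ θ n z :=
  indicator_nonneg (fun _ _ => by positivity) _

theorem timeBound_nonneg (x₀ : M) {θ : ℝ} (hθ : 0 < θ) (n : ℕ) (z : M × ℝ) :
    0 ≤ timeBound x₀ θ n z :=
  indicator_nonneg (fun _ _ => by positivity) _

theorem abs_timeDeriv_scaleCutoff_le (x₀ : M) {θ : ℝ} (hθ : 0 < θ) {n : ℕ} (hn : n ≠ 0)
    (z : M × ℝ) : |timeDeriv (scaleCutoff x₀ θ n) z| ≤ timeBound x₀ θ n z := by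
  refine abs_timeDeriv_le (timeBound_nonneg x₀ hθ n z) ?_
  by_cases hz : z ∈ logAnnulus x₀ θ n
  · rw [timeBound, indicator_of_mem hz]
    filter_upwards [eventually_abs_max_log_sub_le (Real.log (max 1 (dist x₀ z.1))) hθ z.2] with s hs
    refine (abs_scaleCutoff_sub_le x₀ θ n _ _).trans ?_
    calc _ ≤ 2 * Real.exp (-θ * logScale x₀ θ z) / θ * |s - z.2| / n := by gcongr; exact hs
      _ = _ := by ring
  · filter_upwards [(Continuous.tendsto (f := fun s : ℝ => (z.1, s)) (by fun_prop) z.2).eventually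
      (scaleCutoff_eventually_const hn hz)] with s hs
    rw [hs, sub_self, abs_zero]
    exact mul_nonneg (timeBound_nonneg x₀ hθ n z) (abs_nonneg _)

theorem timeDeriv_timeCutoff_nonneg (n : ℕ) (z : M × ℝ) : 0 ≤ timeDeriv (timeCutoff n) z := by
  have h : Monotone fun s : ℝ => max 0 (min 1 ((n : ℝ) * s - 1)) := fun a b hab => by
    dsimp only
    gcongr
  exact h.deriv_nonneg

/-- Only an upper bound for -∂_t is needed. The time cutoff is nondecreasing, so its contribution is
nonpositive and is dropped; this is why no control of u as t → 0 enters. -/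
theorem neg_timeDeriv_cutoff_le [MeasurableSpace M] [BorelSpace M] [SecondCountableTopology M]
    (μ : Measure M) [SFinite μ] (x₀ : M) {θ : ℝ} (hθ : 0 < θ) {n : ℕ} (hn : n ≠ 0) (s : ℕ) :
    ∀ᵐ z ∂(μ.prod volume), -timeDeriv (cutoff x₀ θ n s) z ≤
      s * (timeCutoff n z * scaleCutoff x₀ θ n z ^ (s - 1) * timeBound x₀ θ n z) := by
  filter_upwards [ae_differentiableAt_time (μ := μ) (locallyLipschitz_timeCutoff (M := M) n),
    ae_differentiableAt_time (μ := μ) (locallyLipschitz_scaleCutoff x₀ θ n)] with z h1 h2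
  unfold cutoff
  rw [timeDeriv_mul_comp h1 h2 (hasDerivAt_pow s _)]
  have h3 := mul_nonneg (timeDeriv_timeCutoff_nonneg n z)
    (pow_nonneg (scaleCutoff_nonneg x₀ θ n z) s)
  have h4 := (neg_le_abs _).trans (abs_timeDeriv_scaleCutoff_le x₀ hθ hn z)
  have h5 : 0 ≤ s * (timeCutoff n z * scaleCutoff x₀ θ n z ^ (s - 1)) :=
    mul_nonneg s.cast_nonneg (mul_nonneg (timeCutoff_nonneg n z)
      (pow_nonneg (scaleCutoff_nonneg x₀ θ n z) _))
  have h6 := mul_le_mul_of_nonneg_left h4 h5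
  linarith

end Cutoff

section Gradient

variable {N : ℕ} {M : Type*} [MetricSpace M]
  [ChartedSpace (EuclideanSpace ℝ (Fin N)) M] [IsManifold (𝓡 N) ∞ M]
  [RiemannianBundle (fun x : M => TangentSpace (𝓡 N) x)]
  [IsContinuousRiemannianBundle (EuclideanSpace ℝ (Fin N))
      (fun x : M => TangentSpace (𝓡 N) x)]
  [IsRiemannianManifold (𝓡 N) M]

theorem norm_spaceGrad_scaleCutoff_le (x₀ : M) (θ : ℝ) {n : ℕ} (hn : n ≠ 0) (z : M × ℝ) :
    ‖(spaceGrad (scaleCutoff x₀ θ n) z : TangentSpace (𝓡 N) z.1)‖ ≤ gradBound x₀ θ n z := by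
  refine norm_spaceGrad_le _ _ (gradBound_nonneg x₀ θ n z) ?_
  by_cases hz : z ∈ logAnnulus x₀ θ n
  · rw [gradBound, indicator_of_mem hz]
    have h := (Continuous.tendsto (f := fun y : M => dist x₀ y) (by fun_prop) z.1).eventually
      (eventually_abs_max_log_sub_le (Real.log (max 1 z.2) / θ) one_pos (dist x₀ z.1))
    filter_upwards [h] with y hy
    refine (abs_scaleCutoff_sub_le x₀ θ n _ _).trans ?_
    simp only [div_one, max_comm (Real.log (max 1 z.2) / θ), neg_mul, one_mul] at hy
    have hd : |dist x₀ y - dist x₀ z.1| ≤ dist z.1 y := by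
      rw [dist_comm x₀ y, dist_comm x₀ z.1, dist_comm z.1 y]
      exact abs_dist_sub_le _ _ _
    calc _ ≤ 2 * Real.exp (-logScale x₀ θ z) * dist z.1 y / n := by
          gcongr
          exact hy.trans (mul_le_mul_of_nonneg_left hd (by positivity))
      _ = _ := by ring
  · filter_upwards [(Continuous.tendsto (f := fun y : M => (y, z.2)) (by fun_prop) z.1).eventually
      (scaleCutoff_eventually_const hn hz)] with y hy
    rw [hy, sub_self, abs_zero]
    exact mul_nonneg (gradBound_nonneg x₀ θ n z) dist_nonneg

variable [MeasurableSpace M] [BorelSpace M] [SecondCountableTopology M]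
  [SFinite (μHE[N] : Measure M)]

theorem norm_spaceGrad_cutoff_le (x₀ : M) (θ : ℝ) {n : ℕ} (hn : n ≠ 0) (s : ℕ) :
    ∀ᵐ z ∂((μHE[N] : Measure M).prod volume),
      ‖(spaceGrad (cutoff x₀ θ n s) z : TangentSpace (𝓡 N) z.1)‖ ≤
        s * (timeCutoff n z * scaleCutoff x₀ θ n z ^ (s - 1) * gradBound x₀ θ n z) := by
  filter_upwards [ae_mdifferentiableAt (N := N) (locallyLipschitz_timeCutoff (M := M) n),
    ae_mdifferentiableAt (N := N) (locallyLipschitz_scaleCutoff x₀ θ n)] with z h1 h2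
  have h0 : (spaceGrad (timeCutoff n) z : TangentSpace (𝓡 N) z.1) = 0 := by
    rw [← norm_le_zero_iff]
    refine norm_spaceGrad_le _ _ le_rfl (Eventually.of_forall fun y => ?_)
    simp [timeCutoff]
  set G : TangentSpace (𝓡 N) z.1 := spaceGrad (cutoff x₀ θ n s) z with hG
  set c : ℝ := s * (timeCutoff n z * scaleCutoff x₀ θ n z ^ (s - 1)) with hc
  have hc0 : 0 ≤ c := mul_nonneg s.cast_nonneg (mul_nonneg (timeCutoff_nonneg n z)
    (pow_nonneg (scaleCutoff_nonneg x₀ θ n z) _))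
  -- Pairing the gradient with itself turns the product rule for pairings into a bound on the norm;
  -- the time cutoff has no spatial gradient.
  have h3 : inner ℝ G G = c * inner ℝ (spaceGrad (scaleCutoff x₀ θ n) z) G := by
    have := inner_spaceGrad_mul_comp h1 h2 (hasDerivAt_pow s _) G
    rw [h0, inner_zero_left, mul_zero, zero_add] at this
    refine (this.trans ?_)
    rw [hc]
    ring
  have h4 : ‖G‖ * ‖G‖ ≤ c * gradBound x₀ θ n z * ‖G‖ := by
    rw [← real_inner_self_eq_norm_mul_norm G, h3, mul_assoc c]
    refine mul_le_mul_of_nonneg_left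
      ((real_inner_le_norm (spaceGrad (scaleCutoff x₀ θ n) z) G).trans ?_) hc0
    exact mul_le_mul_of_nonneg_right (norm_spaceGrad_scaleCutoff_le x₀ θ hn z) (norm_nonneg _)
  rcases eq_or_lt_of_le (norm_nonneg G) with h5 | h5
  · rw [← h5, ← mul_assoc]
    exact mul_nonneg hc0 (gradBound_nonneg x₀ θ n z)
  · rw [← mul_assoc]
    exact le_of_mul_le_mul_right h4 h5

end Gradient

/-! ### Pointwise bounds by Young's inequality -/

/-- A form of Young's inequality. -/
theorem mul_rpow_le_add {H x r y z ρ : ℝ} (hH : 0 ≤ H) (hx : 0 ≤ x) (hr : 0 < r) (hy : 0 < y)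
    (hyz : y < z) (hρ : ρ * (z - y) = y) :
    H * x ^ y ≤ r * x ^ z + H ^ (1 + ρ) * r ^ (-ρ) := by
  have hρ0 : 0 < ρ := by
    by_contra h
    nlinarith [sub_pos.2 hyz]
  -- Either the first term on the right dominates, or x^(z-y) < H/r, and raising this to the power ρ
  -- = y/(z-y) bounds x^y.
  rcases le_or_gt (H * x ^ y) (r * x ^ z) with h | h
  · exact h.trans (le_add_of_nonneg_right (by positivity))
  · rcases eq_or_lt_of_le hx with h0 | h0
    · rw [← h0, Real.zero_rpow hy.ne', Real.zero_rpow (hy.trans hyz).ne'] at h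
      simp at h
    have hxy := Real.rpow_pos_of_pos h0 y
    have h1 : r * x ^ (z - y) < H := by
      rw [Real.rpow_sub h0, mul_div_assoc', div_lt_iff₀ hxy]
      exact h
    have hH' : 0 < H := lt_of_le_of_lt (by positivity) h1
    have h2 : x ^ y ≤ (H / r) ^ ρ := by
      rw [← hρ, mul_comm, Real.rpow_mul hx]
      refine Real.rpow_le_rpow (by positivity) ?_ hρ0.le
      rw [le_div_iff₀ hr, mul_comm]
      exact h1.le
    calc H * x ^ y ≤ H * (H / r) ^ ρ := by gcongr
      _ = H ^ (1 + ρ) * r ^ (-ρ) := by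
        rw [Real.div_rpow hH hr.le, Real.rpow_add hH', Real.rpow_one, Real.rpow_neg hr.le]
        ring
      _ ≤ _ := le_add_of_nonneg_left (by positivity)

/-- Young's inequality in Y with exponents p - 1 and p. The energy carries the exponent α,
independently of the exponent e of the test function: later α = 1/n, while e is either 1/n or 0. -/
theorem gradient_term_le {p m K u ε Y Θ φ g α e κ : ℝ} {s : ℕ} (hp : 1 < p) (hm : 1 ≤ m)
    (hu : 0 ≤ u) (hε : 0 < ε) (hY : 0 ≤ Y) (hΘ : 0 ≤ Θ) (hΘK : Θ ≤ K) (hφ : 0 < φ) (hs : 1 ≤ s)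
    (hg : 0 ≤ g) (hα : 0 < α) (hκ : 0 < κ) :
    (s * (φ ^ (s - 1) * g)) * ((u + ε) ^ (-e) * (u ^ (m - 1) * Y ^ (p - 1) * Θ)) ≤
      κ * (α * (φ ^ s * (u + ε) ^ (-α - 1) * (Y ^ p * u ^ (m - 1) * Θ))) +
      κ ^ (-(p - 1)) * (s : ℝ) ^ p * K * (φ ^ (s - p) * (α ^ (-(p - 1)) * g ^ p) *
        (u + ε) ^ ((α + 1) * (p - 1) - p * e + (m - 1))) := by
  set w := u + ε with hw
  have hw0 : 0 < w := add_pos_of_nonneg_of_pos hu hε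
  have hum : 0 ≤ u ^ (m - 1) := Real.rpow_nonneg hu _
  have hum' : u ^ (m - 1) ≤ w ^ (m - 1) :=
    Real.rpow_le_rpow hu (by linarith) (by linarith)
  have hs0 : (0 : ℝ) < s := by exact_mod_cast hs
  have hφ1 : φ ^ (s - 1) = φ ^ ((s : ℝ) - 1) := by
    rw [← Real.rpow_natCast, Nat.cast_sub hs, Nat.cast_one]
  have hφs : φ ^ s = φ ^ (s : ℝ) := (Real.rpow_natCast _ _).symm
  have hφp := Real.rpow_pos_of_pos hφ ((s : ℝ) - 1)
  have hφsp := Real.rpow_pos_of_pos hφ (s : ℝ)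
  have hwe := Real.rpow_pos_of_pos hw0 (-e)
  have hwα := Real.rpow_pos_of_pos hw0 (-α - 1)
  set A := s * (φ ^ (s - 1) * g) * w ^ (-e) with hA
  set r := κ * (α * (φ ^ s * w ^ (-α - 1))) with hr
  have hA0 : 0 ≤ A := by positivity
  have hr0 : 0 < r := by positivity
  have key := mul_rpow_le_add (ρ := p - 1) (y := p - 1) (z := p) hA0 hY hr0 (by linarith)
    (by linarith) (by ring)
  rw [show 1 + (p - 1) = p by ring] at key
  have e1 : A ^ p = (s : ℝ) ^ p * (φ ^ (((s : ℝ) - 1) * p) * g ^ p) * w ^ (-e * p) := by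
    rw [hA, hφ1, Real.mul_rpow (by positivity) hwe.le, Real.mul_rpow hs0.le (by positivity),
      Real.mul_rpow hφp.le hg, Real.rpow_mul hφ.le, Real.rpow_mul hw0.le]
  have e2 : r ^ (-(p - 1)) = κ ^ (-(p - 1)) * (α ^ (-(p - 1)) *
      (φ ^ ((s : ℝ) * -(p - 1)) * w ^ ((-α - 1) * -(p - 1)))) := by
    rw [hr, hφs, Real.mul_rpow hκ.le (by positivity), Real.mul_rpow hα.le (by positivity),
      Real.mul_rpow hφsp.le hwα.le, Real.rpow_mul hφ.le, Real.rpow_mul hw0.le]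
  have e3 : φ ^ (((s : ℝ) - 1) * p) * φ ^ ((s : ℝ) * -(p - 1)) = φ ^ (s - p) := by
    rw [← Real.rpow_add hφ]
    congr 1
    ring
  have e4 : w ^ (-e * p) * w ^ ((-α - 1) * -(p - 1)) * w ^ (m - 1) =
      w ^ ((α + 1) * (p - 1) - p * e + (m - 1)) := by
    rw [← Real.rpow_add hw0, ← Real.rpow_add hw0]
    congr 1
    ring
  have hAr : 0 ≤ A ^ p * r ^ (-(p - 1)) := by positivity
  calc _ = (A * Y ^ (p - 1)) * (u ^ (m - 1) * Θ) := by rw [hA]; ring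
    _ ≤ (r * Y ^ p + A ^ p * r ^ (-(p - 1))) * (u ^ (m - 1) * Θ) := by gcongr
    _ = r * Y ^ p * (u ^ (m - 1) * Θ) + A ^ p * r ^ (-(p - 1)) * (u ^ (m - 1) * Θ) := add_mul _ _ _
    _ ≤ r * Y ^ p * (u ^ (m - 1) * Θ) + A ^ p * r ^ (-(p - 1)) * (w ^ (m - 1) * K) := by gcongr
    _ = _ := by
      rw [e1, e2, ← e3, ← e4, hr]
      ring

/-- Replaces the exponent ρ, which varies with n, by the critical one; it is applied with |ρ - β| =
O(1/n) and |log B| = O(n). -/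
theorem rpow_le_exp_mul_rpow {B ρ β L : ℝ} (hB : 0 < B) (h : |ρ - β| * |Real.log B| ≤ L) :
    B ^ ρ ≤ Real.exp L * B ^ β := by
  rw [Real.rpow_def_of_pos hB, Real.rpow_def_of_pos hB, ← Real.exp_add]
  refine Real.exp_le_exp.2 ?_
  have := (le_abs_self _).trans ((abs_mul (ρ - β) (Real.log B)).trans_le h)
  linarith

/-- Bounds a power of κ whose exponent depends on n by an expression independent of n that still
tends to 0 at infinity when ρ₁ > 0. -/
theorem rpow_neg_le_add {κ ρ ρ₁ ρ₂ : ℝ} (hκ : 0 < κ) (h1 : ρ₁ ≤ ρ) (h2 : ρ ≤ ρ₂) :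
    κ ^ (-ρ) ≤ κ ^ (-ρ₁) + κ ^ (-ρ₂) := by
  rcases le_total 1 κ with h | h
  · exact (Real.rpow_le_rpow_of_exponent_le h (by linarith)).trans
      (le_add_of_nonneg_right (by positivity))
  · exact (Real.rpow_le_rpow_of_exponent_ge hκ h (by linarith)).trans
      (le_add_of_nonneg_left (by positivity))

/-- Where u ≤ ε the left-hand side is at most G (2ε)^y. Where u ≥ ε, (u + ε)^q ≤ 2^q u^q, and
Young's inequality with exponents y < q - e compares with the source. The integer s is so large that
φ^s absorbs the negative powers of φ this creates. -/
theorem power_term_le {q u ε φ G W V e k y z ρ β c L κ : ℝ} {s : ℕ} (hu : 0 ≤ u) (hε : 0 < ε)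
    (hφ : 0 < φ) (hφ1 : φ ≤ 1) (hG : 0 < G) (hW : 0 < W) (hWV : W ≤ V) (hq : 0 ≤ q)
    (hy : 0 < y) (hyz : y < z)
    (hz : z = q - e) (hρ : ρ * (z - y) = y) (hρ1 : β / 2 ≤ ρ) (hρ2 : ρ ≤ β + c)
    (hL : |ρ - β| * |Real.log (G / W)| ≤ L) (hk : 0 ≤ k) (hs : k * (1 + (β + c)) ≤ s)
    (hκ : 0 < κ) :
    φ ^ (s - k) * G * (u + ε) ^ y ≤
      κ * (2 ^ q * (φ ^ s * (u + ε) ^ (-e) * (u ^ q * V))) +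
      (κ ^ (-(β / 2)) + κ ^ (-(β + c))) * (Real.exp L * (G ^ (1 + β) * W ^ (-β))) +
      G * (2 * ε) ^ y := by
  have hw0 : 0 < u + ε := add_pos_of_nonneg_of_pos hu hε
  have hV : 0 ≤ V := hW.le.trans hWV
  have hρ0 : 0 < ρ := by
    by_contra h
    nlinarith [sub_pos.2 hyz]
  have hke : 0 ≤ (s : ℝ) - k := by nlinarith
  have hφk1 : φ ^ (s - k) ≤ 1 := Real.rpow_le_one hφ.le hφ1 hke
  have huq : 0 ≤ u ^ q := Real.rpow_nonneg hu _
  have t1 : 0 ≤ κ * (2 ^ q * (φ ^ s * (u + ε) ^ (-e) * (u ^ q * V))) := by positivity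
  have t2 : 0 ≤ (κ ^ (-(β / 2)) + κ ^ (-(β + c))) * (Real.exp L * (G ^ (1 + β) * W ^ (-β))) := by
    positivity
  have t3 : 0 ≤ G * (2 * ε) ^ y := by positivity
  rcases le_total u ε with h | h
  · have h1 : (u + ε) ^ y ≤ (2 * ε) ^ y := Real.rpow_le_rpow hw0.le (by linarith) hy.le
    have : φ ^ (s - k) * G * (u + ε) ^ y ≤ 1 * G * (2 * ε) ^ y := by gcongr
    linarith
  · have h1 := mul_rpow_le_add (H := G * φ ^ (-k)) (r := κ * W) (by positivity) hw0.le
      (by positivity) hy hyz hρ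
    have h2 : (u + ε) ^ z ≤ 2 ^ q * ((u + ε) ^ (-e) * u ^ q) := by
      rw [hz, sub_eq_add_neg, Real.rpow_add hw0, mul_comm, mul_left_comm]
      gcongr
      rw [← Real.mul_rpow two_pos.le hu]
      exact Real.rpow_le_rpow hw0.le (by linarith) hq
    have h3 : φ ^ s * ((G * φ ^ (-k)) ^ (1 + ρ) * (κ * W) ^ (-ρ)) ≤
        κ ^ (-ρ) * (G ^ (1 + ρ) * W ^ (-ρ)) := by
      rw [Real.mul_rpow hG.le (by positivity), Real.mul_rpow hκ.le hW.le, ← Real.rpow_mul hφ.le]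
      have h4 : φ ^ s * φ ^ (-k * (1 + ρ)) ≤ 1 := by
        rw [← Real.rpow_natCast, ← Real.rpow_add hφ]
        exact Real.rpow_le_one hφ.le hφ1 (by nlinarith)
      calc _ = (φ ^ s * φ ^ (-k * (1 + ρ))) * (κ ^ (-ρ) * (G ^ (1 + ρ) * W ^ (-ρ))) := by ring
        _ ≤ 1 * (κ ^ (-ρ) * (G ^ (1 + ρ) * W ^ (-ρ))) := by gcongr
        _ = _ := one_mul _
    have h5 : G ^ (1 + ρ) * W ^ (-ρ) ≤ Real.exp L * (G ^ (1 + β) * W ^ (-β)) := by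
      have h6 : ∀ b : ℝ, G ^ (1 + b) * W ^ (-b) = G * (G / W) ^ b := fun b => by
        rw [Real.rpow_add hG, Real.rpow_one, Real.div_rpow hG.le hW.le, Real.rpow_neg hW.le]
        ring
      rw [h6, h6, mul_left_comm]
      gcongr
      exact rpow_le_exp_mul_rpow (div_pos hG hW) hL
    have h7 := rpow_neg_le_add hκ hρ1 hρ2
    calc φ ^ (s - k) * G * (u + ε) ^ y = φ ^ s * (G * φ ^ (-k) * (u + ε) ^ y) := by
          rw [sub_eq_add_neg, Real.rpow_add hφ, Real.rpow_natCast]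
          ring
      _ ≤ φ ^ s * (κ * W * (u + ε) ^ z + (G * φ ^ (-k)) ^ (1 + ρ) * (κ * W) ^ (-ρ)) := by gcongr
      _ = κ * (φ ^ s * (W * (u + ε) ^ z)) +
          φ ^ s * ((G * φ ^ (-k)) ^ (1 + ρ) * (κ * W) ^ (-ρ)) := by ring
      _ ≤ κ * (φ ^ s * (V * (2 ^ q * ((u + ε) ^ (-e) * u ^ q)))) +
          κ ^ (-ρ) * (G ^ (1 + ρ) * W ^ (-ρ)) := by gcongr
      _ ≤ κ * (φ ^ s * (V * (2 ^ q * ((u + ε) ^ (-e) * u ^ q)))) +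
          (κ ^ (-(β / 2)) + κ ^ (-(β + c))) * (Real.exp L * (G ^ (1 + β) * W ^ (-β))) := by gcongr
      _ = κ * (2 ^ q * (φ ^ s * (u + ε) ^ (-e) * (u ^ q * V))) +
          (κ ^ (-(β / 2)) + κ ^ (-(β + c))) * (Real.exp L * (G ^ (1 + β) * W ^ (-β))) := by ring
      _ ≤ _ := le_add_of_nonneg_right t3

theorem abs_div_sub_div_le {b d y w t : ℝ} (hb : 0 < b) (hd : 0 < d) (hy : |y - b| ≤ t)
    (hw : |w - d| ≤ t) (ht : t ≤ d / 2) :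
    |y / w - b / d| ≤ 2 * (b + d) / d ^ 2 * t := by
  have hw' : d / 2 ≤ w := by linarith [(abs_le.1 hw).1]
  have hw0 : 0 < w := by linarith
  have ht0 : 0 ≤ t := (abs_nonneg _).trans hy
  rw [div_sub_div _ _ hw0.ne' hd.ne', abs_div, abs_of_pos (mul_pos hw0 hd),
    div_le_iff₀ (mul_pos hw0 hd)]
  have h1 : |y * d - w * b| ≤ (b + d) * t := by
    have e1 : y * d - w * b = d * (y - b) - b * (w - d) := by ring
    rw [e1]
    refine (abs_sub _ _).trans ?_
    rw [abs_mul, abs_mul, abs_of_pos hb, abs_of_pos hd]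
    nlinarith
  refine h1.trans ?_
  have e2 : 2 * (b + d) / d ^ 2 * t * (w * d) = (b + d) * t * (w / (d / 2)) := by
    field_simp
  rw [e2]
  exact le_mul_of_one_le_right (by positivity) ((one_le_div (by positivity)).2 hw')

/-- The sum of powers of `κ` which multiplies the capacity term. -/
def powerSum (β₁ β₂ c κ : ℝ) : ℝ :=
  (κ ^ (-(β₂ / 2)) + κ ^ (-(β₂ + c))) + (κ ^ (-(β₁ / 2)) + κ ^ (-(β₁ + c)))

/-- The exponents in Young's inequality are close to the critical ones. -/
theorem exists_exponents {p q m b Δ : ℝ} (hp : 1 < p) (hq1 : 1 < q) (hb : b = p + m - 2)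
    (hΔ : Δ = q - b) (hb0 : 0 < b) (hΔ0 : 0 < Δ) :
    ∃ c, 0 ≤ c ∧ ∃ s : ℕ, 2 ≤ s ∧ p * (1 + (b / Δ + c)) ≤ s ∧ 1 * (1 + (1 / (q - 1) + c)) ≤ s ∧
      ∃ α₀ > 0, α₀ ≤ 1 / 2 ∧ ∀ α, 0 < α → α ≤ α₀ → ∀ e, 0 ≤ e → e ≤ α → ∀ y,
        y = (α + 1) * (p - 1) - p * e + (m - 1) → b / 2 ≤ y ∧ y < q - e ∧
        |y / (q - e - y) - b / Δ| ≤ c * α ∧ b / Δ / 2 ≤ y / (q - e - y) ∧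
        y / (q - e - y) ≤ b / Δ + c ∧
        |(1 - e) / (q - 1) - 1 / (q - 1)| ≤ c * α ∧ 1 / (q - 1) / 2 ≤ (1 - e) / (q - 1) ∧
        (1 - e) / (q - 1) ≤ 1 / (q - 1) + c := by
  have hq0 : 0 < q - 1 := by linarith
  have hβ₂0 : 0 < b / Δ := div_pos hb0 hΔ0
  have hβ₁0 : 0 < 1 / (q - 1) := div_pos one_pos hq0
  -- The constants of `abs_div_sub_div_le` for the quotients b/Δ and 1/(q-1), whose numerators and
  -- denominators all move by at most αp.
  obtain ⟨c₂, hc₂⟩ : ∃ c, c = 2 * (b + Δ) / Δ ^ 2 * p := ⟨_, rfl⟩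
  obtain ⟨c₁, hc₁⟩ : ∃ c, c = 2 * (1 + (q - 1)) / (q - 1) ^ 2 * p := ⟨_, rfl⟩
  have hc₂0 : 0 < c₂ := by rw [hc₂]; positivity
  have hc₁0 : 0 < c₁ := by rw [hc₁]; positivity
  obtain ⟨c, hc⟩ : ∃ c, c = c₁ + c₂ := ⟨_, rfl⟩
  have hc0 : 0 < c := by linarith
  have hp0 : 0 < p := by linarith
  obtain ⟨s, hs⟩ := exists_nat_ge
    (max 2 (max (p * (1 + (b / Δ + c))) (1 * (1 + (1 / (q - 1) + c)))))
  simp only [max_le_iff] at hs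
  refine ⟨c, hc0.le, s, by exact_mod_cast hs.1, hs.2.1, hs.2.2,
    -- These bounds on α give, in order: 1/(1-e) ≤ 2; a denominator at least Δ/2; a numerator at
    -- least b/2; the condition on q - 1 in `abs_div_sub_div_le`; and quotients at least half their
    -- limits.
    min (1 / 2) (min (min (Δ / 2 / p) (b / 2 / p))
    (min ((q - 1) / 2 / p) (min (b / Δ / 2 / c) (1 / (q - 1) / 2 / c)))), by positivity,
    min_le_left _ _, ?_⟩
  intro α hα hα₀ e he heα y hy
  simp only [le_min_iff, le_div_iff₀ hp0, le_div_iff₀ hc0] at hα₀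
  obtain ⟨ha1, ⟨ha2, ha3⟩, ha4, ha5, ha6⟩ := hα₀
  have hpe : p * e ≤ p * α := mul_le_mul_of_nonneg_left heα hp0.le
  have hpe0 : 0 ≤ p * e := by positivity
  have hαp : α ≤ α * p := le_mul_of_one_le_right hα.le hp.le
  have hyb : y - b = α * p - α - p * e := by rw [hy, hb]; ring
  have hzy : q - e - y - Δ = e * p - e - α * p + α := by rw [hy, hΔ, hb]; ring
  have hyb' : |y - b| ≤ α * p := by
    rw [hyb]
    exact abs_le.2 ⟨by linarith, by linarith⟩
  have hzy' : |q - e - y - Δ| ≤ α * p := by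
    rw [hzy]
    exact abs_le.2 ⟨by linarith, by linarith⟩
  have hρ₂ : |y / (q - e - y) - b / Δ| ≤ c * α := by
    refine (abs_div_sub_div_le hb0 hΔ0 hyb' hzy' ha2).trans ?_
    have h1 : c₂ * α ≤ c * α := by gcongr; linarith
    refine le_trans (le_of_eq ?_) h1
    rw [hc₂]
    ring
  have hρ₁ : |(1 - e) / (q - 1) - 1 / (q - 1)| ≤ c * α := by
    refine (abs_div_sub_div_le one_pos hq0 (t := α * p) ?_ ?_ ha4).trans ?_
    · rw [show 1 - e - 1 = -e by ring, abs_neg, abs_of_nonneg he]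
      linarith
    · rw [sub_self, abs_zero]
      positivity
    have h1 : c₁ * α ≤ c * α := by gcongr; linarith
    refine le_trans (le_of_eq ?_) h1
    rw [hc₁]
    ring
  have hcα : c * α ≤ c := mul_le_of_le_one_right hc0.le (by linarith)
  have h1 := abs_le.1 hyb'
  have h2 := abs_le.1 hzy'
  have h3 := abs_le.1 hρ₂
  have h4 := abs_le.1 hρ₁
  exact ⟨by linarith, by linarith, hρ₂, by linarith, by linarith, hρ₁, by linarith, by linarith⟩

theorem time_term_le {s : ℕ} {φ τ w e B : ℝ} (hφ : 0 ≤ φ) (hτ : 0 ≤ τ) (hw : 0 ≤ w)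
    (he : e ≤ 1 / 2) (h : φ ^ (s - 1) * τ * w ^ (1 - e) ≤ B) :
    s * (φ ^ (s - 1) * τ) * (w ^ (1 - e) / (1 - e)) ≤ 2 * s * B := by
  have h2 : w ^ (1 - e) / (1 - e) ≤ 2 * w ^ (1 - e) := by
    rw [div_le_iff₀ (by linarith)]
    nlinarith [Real.rpow_nonneg hw (1 - e)]
  calc _ ≤ s * (φ ^ (s - 1) * τ) * (2 * w ^ (1 - e)) := by gcongr
    _ = 2 * s * (φ ^ (s - 1) * τ * w ^ (1 - e)) := by ring
    _ ≤ _ := by gcongr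

/-- The factor ξ (the time cutoff) is kept on J and I, which must be compared with the left-hand
side, and bounded by 1 on the remainders. -/
theorem sum_terms_le {ξ t₁ t₂ J B₁ B₂ I P S₁ S₂ E₁ E₂ : ℝ} (hξ : 0 ≤ ξ) (hξ1 : ξ ≤ 1) (hI : 0 ≤ I)
    (hP : 0 ≤ P) (hS₁ : 0 ≤ S₁) (hS₂ : 0 ≤ S₂) (hE₁ : 0 ≤ E₁) (hE₂ : 0 ≤ E₂) (hB₁ : 0 ≤ B₁)
    (hB₂ : 0 ≤ B₂) (h₂ : t₂ ≤ J + B₂ * (I + P * S₂ + E₂)) (h₁ : t₁ ≤ B₁ * (I + P * S₁ + E₁)) :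
    ξ * (t₂ + t₁) ≤ ξ * J + (B₂ + B₁) * (ξ * (2 * I) + P * (S₂ + S₁) + (E₂ + E₁)) := by
  have hR0 : 0 ≤ P * (S₂ + S₁) + (E₂ + E₁) := by positivity
  have hPS₁ := mul_nonneg hP hS₁
  have hPS₂ := mul_nonneg hP hS₂
  have hadd := mul_add P S₂ S₁
  have h3 : t₂ + t₁ ≤ J + (B₂ + B₁) * (2 * I + (P * (S₂ + S₁) + (E₂ + E₁))) := by
    have h4 : B₂ * (I + P * S₂ + E₂) ≤ B₂ * (2 * I + (P * (S₂ + S₁) + (E₂ + E₁))) := by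
      refine mul_le_mul_of_nonneg_left ?_ hB₂
      linarith
    have h5 : B₁ * (I + P * S₁ + E₁) ≤ B₁ * (2 * I + (P * (S₂ + S₁) + (E₂ + E₁))) := by
      refine mul_le_mul_of_nonneg_left ?_ hB₁
      linarith
    linarith
  calc ξ * (t₂ + t₁) ≤ ξ * (J + (B₂ + B₁) * (2 * I + (P * (S₂ + S₁) + (E₂ + E₁)))) := by gcongr
    _ = ξ * J + (B₂ + B₁) * (ξ * (2 * I) + ξ * (P * (S₂ + S₁) + (E₂ + E₁))) := by ring
    _ ≤ ξ * J + (B₂ + B₁) * (ξ * (2 * I) + 1 * (P * (S₂ + S₁) + (E₂ + E₁))) := by gcongr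
    _ = _ := by ring

/-- `gradient_term_le` reduces the gradient flux to a power of u; `power_term_le` then treats it
with weight G and exponent y, and the time flux with weight τ and exponent 1 - e. -/
theorem flux_term_le {p q m K b β₁ β₂ c α e y z₁ z₂ : ℝ} {s : ℕ} (hp : 1 < p) (hm : 1 ≤ m)
    (hq0 : 0 ≤ q) (hq1 : 0 < q - 1) (hK : 0 < K)
    (hb0 : 0 < b) (hc : 0 ≤ c) (hs2 : 2 ≤ s)
    (hs₂ : p * (1 + (β₂ + c)) ≤ s) (hs₁ : 1 * (1 + (β₁ + c)) ≤ s) (hα : 0 < α)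
    (he' : e ≤ 1 / 2) (hy : y = (α + 1) * (p - 1) - p * e + (m - 1)) (hyb : b / 2 ≤ y)
    (hyq : y < q - e) (hz₂ : z₂ = y / (q - e - y)) (hρ₂ : |z₂ - β₂| ≤ c * α) (hl₂ : β₂ / 2 ≤ z₂)
    (hr₂ : z₂ ≤ β₂ + c) (hz₁ : z₁ = (1 - e) / (q - 1)) (hρ₁ : |z₁ - β₁| ≤ c * α)
    (hl₁ : β₁ / 2 ≤ z₁) (hr₁ : z₁ ≤ β₁ + c)
    {u ε Y Θ ξ φ g G τ W V L κ₁ κ : ℝ} (hu : 0 ≤ u) (hε : 0 < ε) (hε1 : ε ≤ 1 / 2) (hY : 0 ≤ Y)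
    (hΘ : 0 ≤ Θ) (hΘK : Θ ≤ K) (hξ : 0 ≤ ξ) (hξ1 : ξ ≤ 1) (hφ : 0 ≤ φ) (hφ1 : φ ≤ 1) (hg : 0 < g)
    (hτ : 0 < τ) (hG : G = α ^ (-(p - 1)) * g ^ p) (hW : 0 < W) (hWV : W ≤ V)
    (hL₂ : α * |Real.log (G / W)| ≤ L) (hL₁ : α * |Real.log (τ / W)| ≤ L) (hκ₁ : 0 < κ₁)
    (hκ : 0 < κ) :
    s * (ξ * φ ^ (s - 1) * g) * ((u + ε) ^ (-e) * (u ^ (m - 1) * Y ^ (p - 1) * Θ)) +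
        s * (ξ * φ ^ (s - 1) * τ) * ((u + ε) ^ (1 - e) / (1 - e)) ≤
      κ₁ * (α * (ξ * φ ^ s * (u + ε) ^ (-α - 1) * (Y ^ p * u ^ (m - 1) * Θ))) +
        (κ₁ ^ (-(p - 1)) * (s : ℝ) ^ p * K + 2 * s) *
        (κ * (2 * 2 ^ q * (ξ * φ ^ s * (u + ε) ^ (-e) * (u ^ q * V))) +
          powerSum β₁ β₂ c κ * (Real.exp (c * L) *
            (G ^ (1 + β₂) * W ^ (-β₂) + τ ^ (1 + β₁) * W ^ (-β₁))) +
          (G * (2 * ε) ^ (b / 2) + τ * (2 * ε) ^ (1 / 2 : ℝ))) := by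
  have hV0 : 0 < V := hW.trans_le hWV
  have hG0 : 0 < G := by rw [hG]; positivity
  have huq : 0 ≤ u ^ q := Real.rpow_nonneg hu _
  have hum : 0 ≤ u ^ (m - 1) := Real.rpow_nonneg hu _
  have hw0 : 0 < u + ε := add_pos_of_nonneg_of_pos hu hε
  have hP0 : 0 ≤ powerSum β₁ β₂ c κ := by unfold powerSum; positivity
  have hy0 : 0 < y := by linarith
  -- Real powers of φ with exponents of either sign occur below, so φ = 0 is treated apart; there
  -- the left-hand side vanishes because s ≥ 2.
  rcases eq_or_lt_of_le hφ with h0 | hφ0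
  · rw [← h0, zero_pow (by omega : s - 1 ≠ 0), zero_pow (by omega : s ≠ 0)]
    simp only [mul_zero, zero_mul, add_zero, zero_add]
    positivity
  have hL : ∀ {δ x : ℝ}, |δ| ≤ c * α → α * |x| ≤ L → |δ| * |x| ≤ c * L := fun {δ x} h1 h2 =>
    calc |δ| * |x| ≤ c * α * |x| := by gcongr
      _ = c * (α * |x|) := by ring
      _ ≤ _ := by gcongr
  have P₂ := power_term_le (q := q) (u := u) (e := e) (s := s) (k := p) hu hε hφ0 hφ1 hG0 hW hWV
    hq0 hy0 hyq rfl (by rw [hz₂]; exact div_mul_cancel₀ _ (by linarith)) hl₂ hr₂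
    (hL hρ₂ hL₂) (by linarith) hs₂ hκ
  have P₁ := power_term_le (q := q) (u := u) (e := e) (s := s) (k := 1) (y := 1 - e) hu hε hφ0
    hφ1 hτ hW hWV hq0 (by linarith) (by linarith) rfl
    (by rw [hz₁, show q - e - (1 - e) = q - 1 by ring]; exact div_mul_cancel₀ _ hq1.ne')
    hl₁ hr₁ (hL hρ₁ hL₁) zero_le_one hs₁ hκ
  have Pg := gradient_term_le (e := e) (g := g) hp hm hu hε hY hΘ hΘK hφ0 (by omega : 1 ≤ s)
    hg.le hα hκ₁
  rw [← hG, ← hy] at Pg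
  have hE₂ : (2 * ε) ^ y ≤ (2 * ε) ^ (b / 2) :=
    Real.rpow_le_rpow_of_exponent_ge (by positivity) (by linarith) hyb
  have hE₁ : (2 * ε) ^ (1 - e) ≤ (2 * ε) ^ (1 / 2 : ℝ) :=
    Real.rpow_le_rpow_of_exponent_ge (by positivity) (by linarith) (by linarith)
  have hps₂ : κ ^ (-(β₂ / 2)) + κ ^ (-(β₂ + c)) ≤ powerSum β₁ β₂ c κ :=
    le_add_of_nonneg_right (by positivity)
  have hps₁ : κ ^ (-(β₁ / 2)) + κ ^ (-(β₁ + c)) ≤ powerSum β₁ β₂ c κ :=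
    le_add_of_nonneg_left (by positivity)
  have hφ1' : φ ^ (s - (1 : ℝ)) = φ ^ (s - 1) := by
    rw [← Real.rpow_natCast, Nat.cast_sub (by omega), Nat.cast_one]
  rw [hφ1'] at P₁
  have P₂' := P₂.trans (add_le_add (add_le_add_right (mul_le_mul_of_nonneg_right hps₂
    (by positivity)) _) (mul_le_mul_of_nonneg_left hE₂ hG0.le))
  have P₁' := P₁.trans (add_le_add (add_le_add_right (mul_le_mul_of_nonneg_right hps₁
    (by positivity)) _) (mul_le_mul_of_nonneg_left hE₁ hτ.le))
  have T₁ := time_term_le hφ hτ.le hw0.le he' P₁'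
  have T₂ := Pg.trans (add_le_add_right (mul_le_mul_of_nonneg_left P₂'
    (by positivity : 0 ≤ κ₁ ^ (-(p - 1)) * (s : ℝ) ^ p * K)) _)
  have T := sum_terms_le hξ hξ1 (by positivity) hP0 (by positivity) (by positivity)
    (by positivity) (by positivity) (by positivity) (by positivity) T₂ T₁
  refine (le_of_eq ?_).trans (T.trans (le_of_eq ?_))
  · ring
  · ring

/-! ### Size of the weights on the annuli -/

theorem abs_log_le_of_rpow_bounds {C x y α : ℝ} (hC : 0 < C) (hx : 1 ≤ x)
    (h1 : C⁻¹ * x ^ (-α) ≤ y) (h2 : y ≤ C * x ^ α) :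
    0 < y ∧ |Real.log y| ≤ |Real.log C| + α * Real.log x := by
  have hx0 : 0 < x := by linarith
  have hy : 0 < y := lt_of_lt_of_le (by positivity) h1
  have h3 := Real.log_le_log (by positivity) h1
  have h4 := Real.log_le_log hy h2
  rw [Real.log_mul (by positivity) (by positivity), Real.log_rpow hx0] at h3 h4
  rw [Real.log_inv] at h3
  have := le_abs_self (Real.log C)
  exact ⟨hy, abs_le.2 ⟨by linarith, by linarith⟩⟩

theorem log_one_add_le {x y : ℝ} (hx : 0 ≤ x) (hy : 0 ≤ y) (h : x ≤ Real.exp y) :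
    Real.log (1 + x) ≤ 1 + y := by
  rw [Real.log_le_iff_le_exp (by linarith), Real.exp_add]
  have h1 := Real.add_one_le_exp (1 : ℝ)
  have h2 := Real.one_le_exp hy
  nlinarith

section

variable {M : Type*} [MetricSpace M]

/-- The choice α = 1/n makes the powers of n combine to n^(p-1) n^(-p) = 1/n, the same decay as in
the time term. -/
theorem gradBound_rpow {x₀ : M} {θ p : ℝ} {n : ℕ} (hn : n ≠ 0) {z : M × ℝ}
    (hz : z ∈ logAnnulus x₀ θ n) :
    (1 / (n : ℝ)) ^ (-(p - 1)) * gradBound x₀ θ n z ^ p =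
      2 ^ p * Real.exp (-p * logScale x₀ θ z) / n := by
  have hn0 : (0 : ℝ) < n := by positivity
  rw [gradBound, indicator_of_mem hz, one_div, Real.inv_rpow hn0.le, Real.rpow_neg hn0.le, inv_inv,
    Real.div_rpow (by positivity) hn0.le, Real.mul_rpow two_pos.le (Real.exp_nonneg _),
    ← Real.exp_mul, Real.rpow_sub hn0, Real.rpow_one, neg_mul, neg_mul,
    mul_comm (logScale x₀ θ z)]
  field_simp

theorem timeBound_eq {x₀ : M} {θ : ℝ} {n : ℕ} {z : M × ℝ}
    (hz : z ∈ logAnnulus x₀ θ n) :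
    timeBound x₀ θ n z = 2 / θ * Real.exp (-θ * logScale x₀ θ z) / n := by
  rw [timeBound, indicator_of_mem hz]
  ring

/-- On the annulus r ≤ e^(2n) and t ≤ e^(2θn), so the polynomial bounds make log h and log f of size
O(n), like every other term of the logarithm. -/
theorem exists_abs_log_le {x₀ : M} {θ C α₁ α₂ C₀ l : ℝ} {h : M → ℝ} {f : ℝ → ℝ} (hθ : 0 < θ)
    (hC : 0 < C) (hα₁ : 0 ≤ α₁) (hα₂ : 0 ≤ α₂) (hC₀ : 0 < C₀) (hl : 0 ≤ l) :
    ∃ L, ∀ n : ℕ, n ≠ 0 → ∀ z ∈ spaceTime M ∩ logAnnulus x₀ θ n,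
      C⁻¹ * (1 + dist x₀ z.1) ^ (-α₁) ≤ h z.1 → h z.1 ≤ C * (1 + dist x₀ z.1) ^ α₁ →
      C⁻¹ * (1 + z.2) ^ (-α₂) ≤ f z.2 → f z.2 ≤ C * (1 + z.2) ^ α₂ →
      1 / (n : ℝ) * |Real.log (C₀ * Real.exp (-l * logScale x₀ θ z) / n / (f z.2 * h z.1))| ≤
        L := by
  -- The terms come from ℓ ≤ 2n, log n ≤ n, log (1 + r) ≤ 1 + 2n ≤ 3n and log (1 + t) ≤ 1 + 2θn; log
  -- C occurs once for h and once for f.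
  refine ⟨|Real.log C₀| + 2 * l + 1 + 2 * |Real.log C| + 3 * α₁ + α₂ * (1 + 2 * θ), ?_⟩
  rintro n hn z ⟨hzS, hz1, hz2⟩ h1 h2 f1 f2
  have hn1 : (1 : ℝ) ≤ n := by exact_mod_cast Nat.one_le_iff_ne_zero.2 hn
  have hn0 : (0 : ℝ) < n := by linarith
  have ht : 0 < z.2 := hzS.2
  have hr : 0 ≤ dist x₀ z.1 := dist_nonneg
  have hP0 := logScale_nonneg x₀ θ z
  obtain ⟨hh0, hh⟩ := abs_log_le_of_rpow_bounds hC (by linarith) h1 h2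
  obtain ⟨hf0, hf⟩ := abs_log_le_of_rpow_bounds hC (by linarith) f1 f2
  have hr' := log_one_add_le hr (by positivity) (dist_le_of_logScale_le hz2)
  have ht' := log_one_add_le ht.le (by positivity) (time_le_of_logScale_le hθ hz2)
  have hlogn : |Real.log n| ≤ n := by
    rw [abs_of_nonneg (Real.log_nonneg hn1)]
    linarith [Real.log_le_sub_one_of_pos hn0]
  rw [one_div, inv_mul_le_iff₀ hn0, Real.log_div (by positivity) (by positivity),
    Real.log_div (by positivity) hn0.ne', Real.log_mul hC₀.ne' (Real.exp_ne_zero _), Real.log_exp,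
    Real.log_mul hf0.ne' hh0.ne']
  have e1 : |Real.log C₀| ≤ n * |Real.log C₀| := le_mul_of_one_le_left (abs_nonneg _) hn1
  have e2 : |Real.log C| ≤ n * |Real.log C| := le_mul_of_one_le_left (abs_nonneg _) hn1
  have e3 : l * logScale x₀ θ z ≤ l * (2 * n) := mul_le_mul_of_nonneg_left hz2 hl
  have e3' : 0 ≤ l * logScale x₀ θ z := by positivity
  have e4 : α₁ * Real.log (1 + dist x₀ z.1) ≤ α₁ * (3 * n) :=
    mul_le_mul_of_nonneg_left (by linarith) hα₁
  have e5 : α₂ * Real.log (1 + z.2) ≤ α₂ * ((1 + 2 * θ) * n) :=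
    mul_le_mul_of_nonneg_left (by linarith) hα₂
  have a1 := abs_le.1 (le_refl |Real.log C₀|)
  have a2 := abs_le.1 hh
  have a3 := abs_le.1 hf
  have a4 := abs_le.1 hlogn
  exact abs_le.2 ⟨by linarith, by linarith⟩

variable [MeasurableSpace M] [BorelSpace M] [SecondCountableTopology M]

/-- The capacity estimate for the terms arising from the derivatives of the cutoff functions. -/
theorem exists_lintegral_weight_le {μ : Measure M} [SFinite μ] {x₀ : M} {h : M → ℝ} {f : ℝ → ℝ}
    (hh : AEMeasurable h μ) (hf : AEMeasurable f (volume.restrict (Ioi 0)))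
    (hpos : ∀ᵐ z ∂((μ.prod volume).restrict (spaceTime M)), 0 < h z.1 ∧ 0 < f z.2)
    {C C₀ s₁ s₂ d₁ d₂ θ l γ β : ℝ} (hC : 0 ≤ C) (hC₀ : 0 ≤ C₀) (hθ : 0 < θ)
    (hA : ∀ᶠ R : ℝ in atTop, ∫⁻ x in Metric.ball x₀ R, ENNReal.ofReal (h x ^ (-β)) ∂μ ≤
      ENNReal.ofReal (C * R ^ s₁ * Real.log R ^ d₁))
    (hB : ∀ᶠ T : ℝ in atTop, ∫⁻ t in Ioc 0 T, ENNReal.ofReal (f t ^ (-β)) ≤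
      ENNReal.ofReal (C * T ^ s₂ * Real.log T ^ d₂))
    (hγ : s₁ + θ * s₂ ≤ γ) (hγ0 : 0 ≤ γ) (hl : l * (1 + β) = γ) (hβ : d₁ + d₂ ≤ β) (hβ0 : 0 ≤ β) :
    ∃ C', 0 ≤ C' ∧ ∀ᶠ n : ℕ in atTop, ∫⁻ z in spaceTime M ∩ logAnnulus x₀ θ n, ENNReal.ofReal
        ((C₀ * Real.exp (-l * logScale x₀ θ z) / n) ^ (1 + β) * (f z.2 * h z.1) ^ (-β))
        ∂(μ.prod volume) ≤ ENNReal.ofReal C' := by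
  obtain ⟨C₁, hC₁, h1⟩ := exists_lintegral_logAnnulus_le (hh.pow_const (-β)).ennreal_ofReal
    (hf.pow_const (-β)).ennreal_ofReal hC hθ hA hB hγ hγ0 hβ hβ0
  refine ⟨C₀ ^ (1 + β) * C₁, by positivity, ?_⟩
  filter_upwards [h1, eventually_ge_atTop 1] with n hn hn1
  have hn0 : (0 : ℝ) < n := by exact_mod_cast hn1
  have hpos' : ∀ᵐ z ∂((μ.prod volume).restrict (spaceTime M ∩ logAnnulus x₀ θ n)),
      0 < h z.1 ∧ 0 < f z.2 :=
    (Measure.restrict_mono inter_subset_left le_rfl).absolutelyContinuous.ae_le hpos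
  calc _ = ∫⁻ z in spaceTime M ∩ logAnnulus x₀ θ n, ENNReal.ofReal (C₀ ^ (1 + β) / n ^ (1 + β)) *
        (ENNReal.ofReal (Real.exp (-γ * logScale x₀ θ z)) *
        (ENNReal.ofReal (h z.1 ^ (-β)) * ENNReal.ofReal (f z.2 ^ (-β)))) ∂(μ.prod volume) := by
        refine lintegral_congr_ae ?_
        filter_upwards [hpos'] with z hz
        rw [← ENNReal.ofReal_mul (Real.rpow_nonneg hz.1.le _),
          ← ENNReal.ofReal_mul (Real.exp_nonneg _), ← ENNReal.ofReal_mul (by positivity)]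
        congr 1
        rw [Real.div_rpow (by positivity) hn0.le, Real.mul_rpow hC₀ (Real.exp_nonneg _),
          ← Real.exp_mul, Real.mul_rpow hz.2.le hz.1.le, ← hl,
          show -l * logScale x₀ θ z * (1 + β) = -(l * (1 + β)) * logScale x₀ θ z by ring]
        ring
    _ = ENNReal.ofReal (C₀ ^ (1 + β) / n ^ (1 + β)) * ∫⁻ z in spaceTime M ∩ logAnnulus x₀ θ n,
        ENNReal.ofReal (Real.exp (-γ * logScale x₀ θ z)) *
        (ENNReal.ofReal (h z.1 ^ (-β)) * ENNReal.ofReal (f z.2 ^ (-β))) ∂(μ.prod volume) :=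
        lintegral_const_mul' _ _ ENNReal.ofReal_ne_top
    -- The critical cancellation: the slope 1/n of the cutoff, to the power 1 + β, exactly
    -- compensates the integral over the annulus.
    _ ≤ ENNReal.ofReal (C₀ ^ (1 + β) / n ^ (1 + β)) * ENNReal.ofReal (C₁ * (n : ℝ) ^ (1 + β)) := by
        gcongr
    _ = _ := by
        rw [← ENNReal.ofReal_mul (by positivity)]
        congr 1
        field_simp

end

/-! ### Integrated flux estimates and absorption -/

theorem lintegral_ofReal_le_of_le_on {Ω : Type*} [MeasurableSpace Ω] {μ : Measure Ω} {D : Set Ω}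
    (hD : MeasurableSet D) {T J I S : Ω → ℝ} {κ₁ B κ P R : ℝ} (hJm : AEMeasurable J μ)
    (hIm : AEMeasurable I μ) (hκ₁ : 0 ≤ κ₁) (hB : 0 ≤ B) (hκ : 0 ≤ κ) (hP : 0 ≤ P)
    (hT : ∀ᵐ z ∂μ, z ∈ D → T z ≤ κ₁ * J z + B * (κ * I z + P * S z + R))
    (hT' : ∀ᵐ z ∂μ, z ∉ D → T z ≤ 0) :
    ∫⁻ z, ENNReal.ofReal (T z) ∂μ ≤ ENNReal.ofReal κ₁ * ∫⁻ z, ENNReal.ofReal (J z) ∂μ +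
      ENNReal.ofReal B * (ENNReal.ofReal κ * ∫⁻ z in D, ENNReal.ofReal (I z) ∂μ +
        ENNReal.ofReal P * ∫⁻ z in D, ENNReal.ofReal (S z) ∂μ + ENNReal.ofReal R * μ D) := by
  have h0 : ∫⁻ z in Dᶜ, ENNReal.ofReal (T z) ∂μ = 0 := by
    rw [lintegral_eq_zero_iff' (by
      refine (aemeasurable_const (b := (0 : ℝ≥0∞))).congr ?_
      filter_upwards [(ae_restrict_iff' hD.compl).2 hT'] with z hz
      exact (ENNReal.ofReal_of_nonpos hz).symm)]
    filter_upwards [(ae_restrict_iff' hD.compl).2 hT'] with z hz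
    exact ENNReal.ofReal_of_nonpos hz
  rw [← lintegral_add_compl _ hD, h0, add_zero]
  have hJm' : AEMeasurable (fun z => ENNReal.ofReal κ₁ * ENNReal.ofReal (J z)) (μ.restrict D) :=
    (hJm.ennreal_ofReal.const_mul _).restrict
  have hIm' : AEMeasurable (fun z => ENNReal.ofReal κ * ENNReal.ofReal (I z)) (μ.restrict D) :=
    (hIm.ennreal_ofReal.const_mul _).restrict
  calc _ ≤ ∫⁻ z in D, (ENNReal.ofReal κ₁ * ENNReal.ofReal (J z) + ENNReal.ofReal B *
        (ENNReal.ofReal κ * ENNReal.ofReal (I z) + (ENNReal.ofReal P * ENNReal.ofReal (S z) +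
          ENNReal.ofReal R))) ∂μ := by
        refine lintegral_mono_ae ?_
        filter_upwards [(ae_restrict_iff' hD).2 hT] with z hz
        refine (ENNReal.ofReal_le_ofReal hz).trans ?_
        rw [← ENNReal.ofReal_mul hκ₁, ← ENNReal.ofReal_mul hκ, ← ENNReal.ofReal_mul hP]
        refine ENNReal.ofReal_add_le.trans (add_le_add_right ?_ _)
        rw [ENNReal.ofReal_mul hB]
        refine mul_le_mul' le_rfl (ENNReal.ofReal_add_le.trans ?_)
        rw [← add_assoc]
        exact add_le_add_left ENNReal.ofReal_add_le _
    _ = ENNReal.ofReal κ₁ * ∫⁻ z in D, ENNReal.ofReal (J z) ∂μ +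
      ENNReal.ofReal B * (ENNReal.ofReal κ * ∫⁻ z in D, ENNReal.ofReal (I z) ∂μ +
        ENNReal.ofReal P * ∫⁻ z in D, ENNReal.ofReal (S z) ∂μ + ENNReal.ofReal R * μ D) := by
        rw [lintegral_add_left' hJm', lintegral_const_mul' _ _ ENNReal.ofReal_ne_top,
          lintegral_const_mul' _ _ ENNReal.ofReal_ne_top, lintegral_add_left' hIm',
          lintegral_const_mul' _ _ ENNReal.ofReal_ne_top, lintegral_add_right _ measurable_const,
          lintegral_const_mul' _ _ ENNReal.ofReal_ne_top, setLIntegral_const, add_assoc]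
    _ ≤ _ := by
        gcongr
        exact Measure.restrict_le_self

/-- Finiteness of i and j permits the subtraction; it comes from the compact support of the test
function and from ε > 0. -/
theorem le_of_absorb {i j k r : ℝ≥0∞} (hi : i ≠ ⊤) (hj : j ≠ ⊤) (hk : k ≤ 1 / 2)
    (h : i + j ≤ ENNReal.ofReal (1 / 2) * j + (k * i + r)) : j ≤ 2 * r := by
  rcases eq_or_ne r ⊤ with hr | hr
  · rw [hr, ENNReal.mul_top two_ne_zero]
    exact le_top
  have h1 : i + j ≤ ENNReal.ofReal (1 / 2) * j + (ENNReal.ofReal (1 / 2) * i + r) := by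
    refine h.trans ?_
    gcongr
    rw [ENNReal.ofReal_div_of_pos two_pos]
    simpa using hk
  lift i to ℝ≥0 using hi
  lift j to ℝ≥0 using hj
  lift r to ℝ≥0 using hr
  rw [ENNReal.ofReal] at h1
  norm_cast at h1 ⊢
  rw [← NNReal.coe_le_coe] at h1 ⊢
  push_cast at h1 ⊢
  rw [Real.coe_toNNReal _ (by norm_num)] at h1
  have := i.2
  linarith [NNReal.coe_nonneg i]

section

variable {M : Type*} [MetricSpace M] [MeasurableSpace M] [BorelSpace M]
  [SecondCountableTopology M]

/-- The flux terms in the energy inequality for the test function `cutoff`. -/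
def cutoffFlux (p m e ε : ℝ) (x₀ : M) (θ : ℝ) (n s : ℕ) (u Y Θ : M × ℝ → ℝ) (z : M × ℝ) : ℝ :=
  s * (timeCutoff n z * scaleCutoff x₀ θ n z ^ (s - 1) * gradBound x₀ θ n z) *
      ((u z + ε) ^ (-e) * (u z ^ (m - 1) * Y z ^ (p - 1) * Θ z)) +
    s * (timeCutoff n z * scaleCutoff x₀ θ n z ^ (s - 1) * timeBound x₀ θ n z) *
      ((u z + ε) ^ (1 - e) / (1 - e))

/-- The term of the energy inequality containing `V`. -/
def cutoffSource (q e ε : ℝ) (x₀ : M) (θ : ℝ) (n s : ℕ) (u V : M × ℝ → ℝ) (z : M × ℝ) : ℝ :=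
  cutoff x₀ θ n s z * (u z + ε) ^ (-e) * (u z ^ q * V z)

/-- The term of the energy inequality containing the gradient. -/
def cutoffEnergy (p m e ε : ℝ) (x₀ : M) (θ : ℝ) (n s : ℕ) (u Y Θ : M × ℝ → ℝ) (z : M × ℝ) : ℝ :=
  cutoff x₀ θ n s z * (u z + ε) ^ (-e - 1) * (Y z ^ p * u z ^ (m - 1) * Θ z)

/-- The weight in the capacity term. -/
def capacityWeight (p β₁ β₂ : ℝ) (x₀ : M) (θ : ℝ) (n : ℕ) (W : M × ℝ → ℝ) (z : M × ℝ) : ℝ :=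
  ((1 / (n : ℝ)) ^ (-(p - 1)) * gradBound x₀ θ n z ^ p) ^ (1 + β₂) * W z ^ (-β₂) +
    timeBound x₀ θ n z ^ (1 + β₁) * W z ^ (-β₁)

/-- `flux_term_le` integrated over the annulus, off which the flux vanishes. The energy has exponent
1/n for every e, so that the bound found with e = 1/n can be reused with e = 0. The source stays
restricted to the annulus, which is what makes it negligible in the limit. -/
theorem lintegral_cutoffFlux_le {ν : Measure (M × ℝ)} {p q m K b β₁ β₂ c θ L : ℝ} {s n : ℕ}
    {x₀ : M} {u V Y Θ W : M × ℝ → ℝ} (hp : 1 < p) (hm : 1 ≤ m) (hq1 : 1 < q) (hK : 0 < K)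
    (hb0 : 0 < b) (hc : 0 ≤ c) (hs2 : 2 ≤ s) (hs₂ : p * (1 + (β₂ + c)) ≤ s)
    (hs₁ : 1 * (1 + (β₁ + c)) ≤ s) (hθ : 0 < θ) (hn : n ≠ 0) {e : ℝ} (he' : e ≤ 1 / 2)
    (hexp : ∀ y, y = (1 / (n : ℝ) + 1) * (p - 1) - p * e + (m - 1) → b / 2 ≤ y ∧ y < q - e ∧
        |y / (q - e - y) - β₂| ≤ c * (1 / (n : ℝ)) ∧ β₂ / 2 ≤ y / (q - e - y) ∧
        y / (q - e - y) ≤ β₂ + c ∧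
        |(1 - e) / (q - 1) - β₁| ≤ c * (1 / (n : ℝ)) ∧ β₁ / 2 ≤ (1 - e) / (q - 1) ∧
        (1 - e) / (q - 1) ≤ β₁ + c)
    (hu : ∀ᵐ z ∂ν.restrict (spaceTime M), 0 ≤ u z) (hY : ∀ z, 0 ≤ Y z)
    (hΘ : ∀ z, 0 ≤ Θ z ∧ Θ z ≤ K) (hum : AEMeasurable u (ν.restrict (spaceTime M)))
    (huVm : AEMeasurable (fun z => u z ^ q * V z) (ν.restrict (spaceTime M)))
    (hYm : AEMeasurable Y (ν.restrict (spaceTime M)))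
    (hΘm : AEMeasurable Θ (ν.restrict (spaceTime M)))
    (hW : ∀ᵐ z ∂ν.restrict (spaceTime M), 0 < W z ∧ W z ≤ V z)
    (hL : ∀ᵐ z ∂ν.restrict (spaceTime M), z ∈ logAnnulus x₀ θ n →
      1 / (n : ℝ) * |Real.log ((1 / (n : ℝ)) ^ (-(p - 1)) * gradBound x₀ θ n z ^ p / W z)| ≤ L ∧
      1 / (n : ℝ) * |Real.log (timeBound x₀ θ n z / W z)| ≤ L)
    {ε κ₁ κ : ℝ} (hε : 0 < ε) (hε1 : ε ≤ 1 / 2) (hκ₁ : 0 < κ₁) (hκ : 0 < κ) :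
    ∫⁻ z in tsupport (cutoff x₀ θ n s), ENNReal.ofReal (cutoffFlux p m e ε x₀ θ n s u Y Θ z) ∂ν ≤
      ENNReal.ofReal κ₁ * (ENNReal.ofReal (1 / n) * ∫⁻ z in tsupport (cutoff x₀ θ n s),
        ENNReal.ofReal (cutoffEnergy p m (1 / n) ε x₀ θ n s u Y Θ z) ∂ν) +
      ENNReal.ofReal (κ₁ ^ (-(p - 1)) * (s : ℝ) ^ p * K + 2 * s) *
        (ENNReal.ofReal (κ * (2 * 2 ^ q)) *
          ∫⁻ z in tsupport (cutoff x₀ θ n s) ∩ logAnnulus x₀ θ n,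
            ENNReal.ofReal (cutoffSource q e ε x₀ θ n s u V z) ∂ν +
          ENNReal.ofReal (powerSum β₁ β₂ c κ * Real.exp (c * L)) *
            ∫⁻ z in spaceTime M ∩ logAnnulus x₀ θ n,
              ENNReal.ofReal (capacityWeight p β₁ β₂ x₀ θ n W z) ∂ν +
          ENNReal.ofReal (2 ^ p * (2 * ε) ^ (b / 2) + 2 / θ * (2 * ε) ^ (1 / 2 : ℝ)) *
            ν (tsupport (cutoff x₀ θ n s))) := by
  have hn0 : (0 : ℝ) < n := by positivity
  have hn1 : (1 : ℝ) ≤ n := by exact_mod_cast Nat.one_le_iff_ne_zero.2 hn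
  have hAS := tsupport_cutoff_subset_spaceTime x₀ hθ hn (show s ≠ 0 by omega)
  have hmono : ν.restrict (tsupport (cutoff x₀ θ n s)) ≤ ν.restrict (spaceTime M) :=
    Measure.restrict_mono hAS le_rfl
  have hDm := measurableSet_logAnnulus x₀ θ n
  have hηm : AEMeasurable (cutoff x₀ θ n s) (ν.restrict (tsupport (cutoff x₀ θ n s))) :=
    (locallyLipschitz_cutoff x₀ θ n s).continuous.aemeasurable
  have hum' := hum.mono_measure hmono
  obtain ⟨h1, h2, h3, h4, h5, h6, h7, h8⟩ := hexp _ rfl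
  have hP0 : 0 ≤ powerSum β₁ β₂ c κ := by unfold powerSum; positivity
  have key := lintegral_ofReal_le_of_le_on (μ := ν.restrict (tsupport (cutoff x₀ θ n s)))
    (D := logAnnulus x₀ θ n) hDm (T := cutoffFlux p m e ε x₀ θ n s u Y Θ)
    (J := fun z => 1 / (n : ℝ) * cutoffEnergy p m (1 / n) ε x₀ θ n s u Y Θ z)
    (I := cutoffSource q e ε x₀ θ n s u V) (S := capacityWeight p β₁ β₂ x₀ θ n W)
    (κ₁ := κ₁) (B := κ₁ ^ (-(p - 1)) * (s : ℝ) ^ p * K + 2 * s) (κ := κ * (2 * 2 ^ q))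
    (P := powerSum β₁ β₂ c κ * Real.exp (c * L))
    (R := 2 ^ p * (2 * ε) ^ (b / 2) + 2 / θ * (2 * ε) ^ (1 / 2 : ℝ)) ?_ ?_ hκ₁.le
    (by positivity) (by positivity) (by positivity) ?_ ?_
  · refine key.trans ?_
    rw [Measure.restrict_restrict hDm]
    have e1 : ∫⁻ z in tsupport (cutoff x₀ θ n s), ENNReal.ofReal (1 / (n : ℝ) *
        cutoffEnergy p m (1 / n) ε x₀ θ n s u Y Θ z) ∂ν =
        ENNReal.ofReal (1 / n) * ∫⁻ z in tsupport (cutoff x₀ θ n s),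
        ENNReal.ofReal (cutoffEnergy p m (1 / n) ε x₀ θ n s u Y Θ z) ∂ν := by
      rw [← lintegral_const_mul' _ _ ENNReal.ofReal_ne_top]
      exact lintegral_congr fun z => ENNReal.ofReal_mul (by positivity)
    rw [e1, inter_comm (logAnnulus x₀ θ n)]
    refine add_le_add le_rfl (mul_le_mul' le_rfl (add_le_add (add_le_add le_rfl
      (mul_le_mul' le_rfl (lintegral_mono_set (inter_subset_inter_left _ hAS))))
      (mul_le_mul' le_rfl ?_)))
    rw [Measure.restrict_apply hDm]
    exact measure_mono inter_subset_right
  · exact ((hηm.mul ((hum'.add_const ε).pow_const _)).mul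
      ((((hYm.mono_measure hmono).pow_const _).mul (hum'.pow_const _)).mul
        (hΘm.mono_measure hmono))).const_mul _
  · exact (hηm.mul ((hum'.add_const ε).pow_const _)).mul (huVm.mono_measure hmono)
  · filter_upwards [hmono.absolutelyContinuous.ae_le hu, hmono.absolutelyContinuous.ae_le hW,
      hmono.absolutelyContinuous.ae_le hL] with z hz hzW hzL hzD
    have hg : 0 < gradBound x₀ θ n z := by
      rw [gradBound, indicator_of_mem hzD]
      positivity
    have hτ : 0 < timeBound x₀ θ n z := by
      rw [timeBound, indicator_of_mem hzD]
      positivity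
    have hlog := logScale_nonneg x₀ θ z
    have hG' : (1 / (n : ℝ)) ^ (-(p - 1)) * gradBound x₀ θ n z ^ p ≤ 2 ^ p := by
      rw [gradBound_rpow hn hzD]
      refine div_le_of_le_mul₀ hn0.le (by positivity) ?_
      refine mul_le_mul_of_nonneg_left ?_ (by positivity)
      refine (Real.exp_le_one_iff.2 ?_).trans hn1
      nlinarith
    have hτ' : timeBound x₀ θ n z ≤ 2 / θ := by
      rw [timeBound_eq hzD]
      refine div_le_of_le_mul₀ hn0.le (by positivity) ?_
      refine mul_le_mul_of_nonneg_left ?_ (by positivity)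
      refine (Real.exp_le_one_iff.2 ?_).trans hn1
      nlinarith
    have h := flux_term_le hp hm (by linarith) (by linarith : 0 < q - 1) hK hb0 hc hs2 hs₂ hs₁
      (by positivity : 0 < 1 / (n : ℝ)) he' rfl h1 h2 rfl h3 h4 h5 rfl h6 h7 h8 hz hε hε1 (hY z)
      (hΘ z).1 (hΘ z).2 (timeCutoff_nonneg n z) (timeCutoff_le_one n z)
      (scaleCutoff_nonneg x₀ θ n z) (scaleCutoff_le_one x₀ θ n z) hg hτ rfl hzW.1 hzW.2
      (hzL hzD).1 (hzL hzD).2 hκ₁ hκ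
    refine h.trans ?_
    have hB : 0 ≤ κ₁ ^ (-(p - 1)) * (s : ℝ) ^ p * K + 2 * s := by positivity
    refine add_le_add (le_of_eq rfl) (mul_le_mul_of_nonneg_left (add_le_add (le_of_eq ?_)
      (add_le_add ?_ ?_)) hB)
    · simp only [cutoffSource, cutoff, capacityWeight]
      ring
    · exact mul_le_mul_of_nonneg_right hG' (by positivity)
    · exact mul_le_mul_of_nonneg_right hτ' (by positivity)
  · refine Eventually.of_forall fun z hzD => le_of_eq ?_
    simp only [cutoffFlux, gradBound, timeBound, indicator_of_notMem hzD, mul_zero, zero_mul,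
      add_zero]

end

/-! ### The nonlinear capacity argument -/

theorem tendsto_powerSum {β₁ β₂ c : ℝ} (h₁ : 0 < β₁) (h₂ : 0 < β₂) (hc : 0 ≤ c) :
    Tendsto (powerSum β₁ β₂ c) atTop (𝓝 0) := by
  have h := ((tendsto_rpow_neg_atTop (half_pos h₂)).add
    (tendsto_rpow_neg_atTop (add_pos_of_pos_of_nonneg h₂ hc))).add
    ((tendsto_rpow_neg_atTop (half_pos h₁)).add
    (tendsto_rpow_neg_atTop (add_pos_of_pos_of_nonneg h₁ hc)))
  simp only [add_zero] at h
  exact h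

section

variable {M : Type*} [MetricSpace M]

theorem eventually_cutoff_eq_one (x₀ : M) (θ : ℝ) (s : ℕ) {z : M × ℝ} (hz : z ∈ spaceTime M) :
    ∀ᶠ n : ℕ in atTop, cutoff x₀ θ n s z = 1 := by
  have ht : 0 < z.2 := hz.2
  filter_upwards [eventually_ge_atTop ⌈logScale x₀ θ z⌉₊, eventually_ge_atTop ⌈2 / z.2⌉₊,
    eventually_ge_atTop 1] with n h1 h2 h3
  have h1' : logScale x₀ θ z ≤ n := Nat.ceil_le.1 h1
  have h2' : 2 / z.2 ≤ n := Nat.ceil_le.1 h2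
  have hn0 : (0 : ℝ) < n := by exact_mod_cast h3
  rw [div_le_iff₀ ht] at h2'
  have h4 : logScale x₀ θ z / n ≤ 1 := (div_le_one hn0).2 h1'
  rw [cutoff, timeCutoff, scaleCutoff, min_eq_left (by linarith), min_eq_left (by linarith),
    max_eq_right zero_le_one, one_pow, one_mul]

theorem eventually_notMem_logAnnulus (x₀ : M) (θ : ℝ) (z : M × ℝ) :
    ∀ᶠ n : ℕ in atTop, z ∉ logAnnulus x₀ θ n := by
  filter_upwards [eventually_gt_atTop ⌈logScale x₀ θ z⌉₊] with n hn h
  exact absurd h.1 (not_le.2 (Nat.lt_of_ceil_lt hn))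

variable [MeasurableSpace M] [BorelSpace M] [SecondCountableTopology M]

/-- The critical case: uniform boundedness alone gives only integrability of F. Integrability in
turn kills the integrals over the receding annuli, after which the parameters κ and κ₁ are free to
remove the remaining constants. -/
theorem lintegral_eq_zero_of_cutoff_bound {ν : Measure (M × ℝ)} {x₀ : M} {θ : ℝ} {s : ℕ}
    {F : M × ℝ → ℝ} (hF : ∀ᵐ z ∂ν.restrict (spaceTime M), 0 ≤ F z)
    (hFm : AEMeasurable F (ν.restrict (spaceTime M))) (hθ : 0 < θ) (hs : s ≠ 0)
    {B P : ℝ → ℝ} {C₁ C₂ : ℝ≥0∞} {c : ℝ} (hC₁ : C₁ ≠ ⊤) (hC₂ : C₂ ≠ ⊤) (hc : 0 < c)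
    (hB : ∀ x, 0 < x → 0 < B x) (hP : Tendsto P atTop (𝓝 0))
    (hfin : ∀ᶠ n : ℕ in atTop, ∫⁻ z in tsupport (cutoff x₀ θ n s),
      ENNReal.ofReal (cutoff x₀ θ n s z * F z) ∂ν ≠ ⊤)
    (h : ∀ κ₁ > 0, ∀ κ > 0, ∀ᶠ n : ℕ in atTop, ∫⁻ z in tsupport (cutoff x₀ θ n s),
        ENNReal.ofReal (cutoff x₀ θ n s z * F z) ∂ν ≤
      ENNReal.ofReal κ₁ * C₁ + ENNReal.ofReal (B κ₁) * (ENNReal.ofReal (κ * c) *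
        ∫⁻ z in tsupport (cutoff x₀ θ n s) ∩ logAnnulus x₀ θ n,
          ENNReal.ofReal (cutoff x₀ θ n s z * F z) ∂ν + ENNReal.ofReal (P κ) * C₂)) :
    ∫⁻ z in spaceTime M, ENNReal.ofReal (F z) ∂ν = 0 := by
  set y : ℕ → ℝ≥0∞ := fun n => ∫⁻ z in tsupport (cutoff x₀ θ n s),
    ENNReal.ofReal (cutoff x₀ θ n s z * F z) ∂ν with hy
  set yD : ℕ → ℝ≥0∞ := fun n => ∫⁻ z in tsupport (cutoff x₀ θ n s) ∩ logAnnulus x₀ θ n,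
    ENNReal.ofReal (cutoff x₀ θ n s z * F z) ∂ν with hyD
  have hyDy : ∀ n, yD n ≤ y n := fun n => lintegral_mono_set inter_subset_left
  have hηm : ∀ n, Measurable (cutoff x₀ θ n s) := fun n =>
    (locallyLipschitz_cutoff x₀ θ n s).continuous.measurable
  -- lower semicontinuity
  have hfatou : ∀ c' : ℝ≥0∞, (∃ r : ℕ → ℝ≥0∞, Tendsto r atTop (𝓝 c') ∧ ∀ᶠ n in atTop, y n ≤ r n) →
      ∫⁻ z in spaceTime M, ENNReal.ofReal (F z) ∂ν ≤ c' := by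
    rintro c' ⟨r, hr, hyr⟩
    have h1 : ∀ n, ∫⁻ z in spaceTime M, ENNReal.ofReal (cutoff x₀ θ n s z * F z) ∂ν ≤ y n := by
      intro n
      have hm : MeasurableSet (tsupport (cutoff x₀ θ n s)) := (isClosed_tsupport _).measurableSet
      have h2 : ∀ z, ENNReal.ofReal (cutoff x₀ θ n s z * F z) =
          (tsupport (cutoff x₀ θ n s)).indicator
            (fun z => ENNReal.ofReal (cutoff x₀ θ n s z * F z)) z := fun z => by
        by_cases hz : z ∈ tsupport (cutoff x₀ θ n s)
        · rw [indicator_of_mem hz]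
        · rw [indicator_of_notMem hz, image_eq_zero_of_notMem_tsupport hz, zero_mul,
            ENNReal.ofReal_zero]
      rw [lintegral_congr h2, lintegral_indicator hm]
      exact lintegral_mono' (Measure.restrict_mono_measure Measure.restrict_le_self _) le_rfl
    calc _ = ∫⁻ z in spaceTime M, liminf (fun n : ℕ =>
          ENNReal.ofReal (cutoff x₀ θ n s z * F z)) atTop ∂ν := by
          refine setLIntegral_congr_fun measurableSet_spaceTime fun z hz => ?_
          refine (Tendsto.liminf_eq (tendsto_const_nhds.congr' ?_)).symm
          filter_upwards [eventually_cutoff_eq_one x₀ θ s hz] with n hn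
          rw [hn, one_mul]
      _ ≤ liminf (fun n => ∫⁻ z in spaceTime M,
          ENNReal.ofReal (cutoff x₀ θ n s z * F z) ∂ν) atTop :=
          lintegral_liminf_le' fun n => ((hηm n).aemeasurable.mul hFm).ennreal_ofReal
      _ ≤ liminf r atTop := liminf_le_liminf (by
          filter_upwards [hyr] with n hn using (h1 n).trans hn)
      _ = c' := hr.liminf_eq
  -- finiteness
  have hfinite : ∫⁻ z in spaceTime M, ENNReal.ofReal (F z) ∂ν ≠ ⊤ := by
    -- With κ₁ = 1, this κ gives the annulus integral the coefficient 1/2, so that it is absorbed by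
    -- the left-hand side.
    have hκ : 0 < 1 / (2 * B 1 * c) := by
      have := hB 1 one_pos
      positivity
    have hR : ENNReal.ofReal 1 * C₁ + ENNReal.ofReal (B 1) *
        (ENNReal.ofReal (P (1 / (2 * B 1 * c))) * C₂) ≠ ⊤ := by finiteness
    refine ne_top_of_le_ne_top (ENNReal.mul_ne_top ENNReal.ofNat_ne_top hR)
      (hfatou (2 * _) ⟨fun _ => _, tendsto_const_nhds, ?_⟩)
    filter_upwards [h 1 one_pos _ hκ, hfin] with n hn hnfin
    refine le_of_absorb (i := 0) (k := 0) ENNReal.zero_ne_top hnfin (by simp) ?_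
    rw [zero_add, zero_mul, zero_add]
    refine hn.trans ?_
    rw [mul_add, ← add_assoc, add_comm (ENNReal.ofReal 1 * C₁), add_assoc]
    refine add_le_add ?_ le_rfl
    rw [← mul_assoc, ← ENNReal.ofReal_mul (hB 1 one_pos).le]
    refine mul_le_mul' (ENNReal.ofReal_le_ofReal (le_of_eq ?_)) (hyDy n)
    have := (hB 1 one_pos).ne'
    field_simp
  -- the integrals over the annuli tend to zero
  have hDlim : Tendsto yD atTop (𝓝 0) := by
    have h1 : Tendsto (fun n => ∫⁻ z in spaceTime M, (logAnnulus x₀ θ n).indicator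
        (fun z => ENNReal.ofReal (F z)) z ∂ν) atTop (𝓝 (∫⁻ z in spaceTime M, 0 ∂ν)) := by
      refine tendsto_lintegral_of_dominated_convergence' (fun z => ENNReal.ofReal (F z))
        (fun n => hFm.ennreal_ofReal.indicator (measurableSet_logAnnulus x₀ θ n))
        (fun n => Eventually.of_forall fun z => indicator_le_self _ _ _) hfinite
        (Eventually.of_forall fun z => ?_)
      refine tendsto_const_nhds.congr' ?_
      filter_upwards [eventually_notMem_logAnnulus x₀ θ z] with n hn
      rw [indicator_of_notMem hn]
    rw [lintegral_zero] at h1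
    refine tendsto_of_tendsto_of_tendsto_of_le_of_le' tendsto_const_nhds h1
      (Eventually.of_forall fun _ => zero_le) ?_
    filter_upwards [eventually_ge_atTop 1] with n hn
    rw [lintegral_indicator (measurableSet_logAnnulus x₀ θ n),
      Measure.restrict_restrict (measurableSet_logAnnulus x₀ θ n), inter_comm]
    have hAS := tsupport_cutoff_subset_spaceTime x₀ hθ (show n ≠ 0 by omega) hs
    refine (lintegral_mono_set (inter_subset_inter_left _ hAS)).trans (lintegral_mono_ae ?_)
    filter_upwards [(Measure.restrict_mono inter_subset_left
      le_rfl).absolutelyContinuous.ae_le hF] with z hz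
    exact ENNReal.ofReal_le_ofReal (mul_le_of_le_one_left hz (cutoff_le_one x₀ θ n s z))
  have hmain : ∀ κ₁ > 0, ∀ κ > 0, ∫⁻ z in spaceTime M, ENNReal.ofReal (F z) ∂ν ≤
      ENNReal.ofReal κ₁ * C₁ + ENNReal.ofReal (B κ₁) * (ENNReal.ofReal (P κ) * C₂) := by
    intro κ₁ hκ₁ κ hκ
    refine hfatou _ ⟨_, ?_, h κ₁ hκ₁ κ hκ⟩
    have h1 := ENNReal.Tendsto.const_mul (a := ENNReal.ofReal (κ * c)) hDlim
      (Or.inr ENNReal.ofReal_ne_top)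
    rw [mul_zero] at h1
    have h2 := ENNReal.Tendsto.const_mul (a := ENNReal.ofReal (B κ₁))
      (h1.add_const (ENNReal.ofReal (P κ) * C₂)) (Or.inr ENNReal.ofReal_ne_top)
    rw [zero_add] at h2
    exact h2.const_add _
  -- With n gone, κ → ∞ costs nothing, since κ multiplied only the annulus integral. It must precede
  -- κ₁ → 0, because B may blow up at 0.
  have hmain' : ∀ κ₁ > 0, ∫⁻ z in spaceTime M, ENNReal.ofReal (F z) ∂ν ≤
      ENNReal.ofReal κ₁ * C₁ := by
    intro κ₁ hκ₁
    have h1 : Tendsto (fun κ => ENNReal.ofReal (P κ)) atTop (𝓝 0) := by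
      simpa using ENNReal.tendsto_ofReal hP
    have h2 := ENNReal.Tendsto.mul_const (b := C₂) h1 (Or.inr hC₂)
    rw [zero_mul] at h2
    have h3 := ENNReal.Tendsto.const_mul (a := ENNReal.ofReal (B κ₁)) h2
      (Or.inr ENNReal.ofReal_ne_top)
    have h4 := h3.const_add (ENNReal.ofReal κ₁ * C₁)
    rw [mul_zero, add_zero] at h4
    refine ge_of_tendsto h4 ?_
    filter_upwards [eventually_gt_atTop 0] with κ hκ using hmain κ₁ hκ₁ κ hκ
  have h1 : Tendsto (fun κ : ℝ => ENNReal.ofReal κ) (𝓝[>] 0) (𝓝 0) := by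
    have := (ENNReal.continuous_ofReal.tendsto 0).mono_left (nhdsWithin_le_nhds (s := Ioi 0))
    simpa using this
  have h2 := ENNReal.Tendsto.mul_const (b := C₁) h1 (Or.inr hC₁)
  rw [zero_mul] at h2
  refine le_antisymm (ge_of_tendsto h2 ?_) zero_le
  filter_upwards [self_mem_nhdsWithin] with κ₁ hκ₁ using hmain' κ₁ hκ₁

theorem tendsto_cutoff_error {p b θ : ℝ} (hb : 0 < b) {v : ℝ≥0∞} (hv : v ≠ ⊤) :
    Tendsto (fun ε : ℝ => ENNReal.ofReal (2 ^ p * (2 * ε) ^ (b / 2) +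
      2 / θ * (2 * ε) ^ (1 / 2 : ℝ)) * v) (𝓝[>] 0) (𝓝 0) := by
  have h1 : Continuous fun ε : ℝ => 2 ^ p * (2 * ε) ^ (b / 2) + 2 / θ * (2 * ε) ^ (1 / 2 : ℝ) :=
    (((continuous_const.mul continuous_id).rpow_const fun _ => Or.inr (by positivity)).const_mul
      _).add (((continuous_const.mul continuous_id).rpow_const fun _ =>
        Or.inr (by norm_num)).const_mul _)
  have h2 := (ENNReal.tendsto_ofReal (h1.tendsto 0)).mono_left (nhdsWithin_le_nhds (s := Ioi 0))
  have h3 := ENNReal.Tendsto.mul_const (b := v) h2 (Or.inr hv)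
  rw [mul_zero, Real.zero_rpow (by positivity), Real.zero_rpow (by norm_num), mul_zero, mul_zero,
    add_zero, ENNReal.ofReal_zero, zero_mul] at h3
  exact h3

end

section

variable {M : Type*} [MetricSpace M] [MeasurableSpace M] [BorelSpace M]
  [SecondCountableTopology M]

/-- The energy inequality for the test functions `cutoff`. -/
def HasCutoffEnergyInequality (p q m : ℝ) (x₀ : M) (θ : ℝ) (ν : Measure (M × ℝ))
    (u V Y Θ : M × ℝ → ℝ) : Prop :=
  ∀ n : ℕ, n ≠ 0 → ∀ s : ℕ, s ≠ 0 → ∀ e ε : ℝ, 0 ≤ e → e < 1 → 0 < ε →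
    ∫⁻ z in tsupport (cutoff x₀ θ n s), ENNReal.ofReal (cutoffSource q e ε x₀ θ n s u V z) ∂ν ≠ ⊤ ∧
    ENNReal.ofReal e * ∫⁻ z in tsupport (cutoff x₀ θ n s),
      ENNReal.ofReal (cutoffEnergy p m e ε x₀ θ n s u Y Θ z) ∂ν ≠ ⊤ ∧
    ∫⁻ z in tsupport (cutoff x₀ θ n s), ENNReal.ofReal (cutoffSource q e ε x₀ θ n s u V z) ∂ν +
      ENNReal.ofReal e * ∫⁻ z in tsupport (cutoff x₀ θ n s),
        ENNReal.ofReal (cutoffEnergy p m e ε x₀ θ n s u Y Θ z) ∂ν ≤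
      ∫⁻ z in tsupport (cutoff x₀ θ n s),
        ENNReal.ofReal (cutoffFlux p m e ε x₀ θ n s u Y Θ z) ∂ν

theorem cutoffSource_zero (q ε : ℝ) (x₀ : M) (θ : ℝ) (n s : ℕ) (u V : M × ℝ → ℝ) (z : M × ℝ) :
    cutoffSource q 0 ε x₀ θ n s u V z = cutoff x₀ θ n s z * (u z ^ q * V z) := by
  rw [cutoffSource, neg_zero, Real.rpow_zero, mul_one]

/-- The energy inequality is used twice: with e = 1/n it bounds (1/n) · energy by the capacity,
after absorbing half of the energy and of the source, and with e = 0 it bounds the source by κ₁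
times that quantity. For fixed n the regularization error vanishes as ε → 0. -/
theorem cutoff_bound {ν : Measure (M × ℝ)} {p q m K b β₁ β₂ c θ L : ℝ} {s n : ℕ}
    {x₀ : M} {u V Y Θ W : M × ℝ → ℝ} (hp : 1 < p) (hm : 1 ≤ m) (hq1 : 1 < q) (hK : 0 < K)
    (hb0 : 0 < b) (hc : 0 ≤ c) (hs2 : 2 ≤ s) (hs₂ : p * (1 + (β₂ + c)) ≤ s)
    (hs₁ : 1 * (1 + (β₁ + c)) ≤ s) (hθ : 0 < θ) (hn : n ≠ 0) (hn2 : 1 / (n : ℝ) ≤ 1 / 2)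
    (hexp : ∀ e, 0 ≤ e → e ≤ 1 / (n : ℝ) →
      ∀ y, y = (1 / (n : ℝ) + 1) * (p - 1) - p * e + (m - 1) → b / 2 ≤ y ∧ y < q - e ∧
        |y / (q - e - y) - β₂| ≤ c * (1 / (n : ℝ)) ∧ β₂ / 2 ≤ y / (q - e - y) ∧
        y / (q - e - y) ≤ β₂ + c ∧
        |(1 - e) / (q - 1) - β₁| ≤ c * (1 / (n : ℝ)) ∧ β₁ / 2 ≤ (1 - e) / (q - 1) ∧
        (1 - e) / (q - 1) ≤ β₁ + c)
    (hu : ∀ᵐ z ∂ν.restrict (spaceTime M), 0 ≤ u z) (hY : ∀ z, 0 ≤ Y z)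
    (hΘ : ∀ z, 0 ≤ Θ z ∧ Θ z ≤ K) (hum : AEMeasurable u (ν.restrict (spaceTime M)))
    (huVm : AEMeasurable (fun z => u z ^ q * V z) (ν.restrict (spaceTime M)))
    (hYm : AEMeasurable Y (ν.restrict (spaceTime M)))
    (hΘm : AEMeasurable Θ (ν.restrict (spaceTime M)))
    (hW : ∀ᵐ z ∂ν.restrict (spaceTime M), 0 < W z ∧ W z ≤ V z)
    (hL : ∀ᵐ z ∂ν.restrict (spaceTime M), z ∈ logAnnulus x₀ θ n →
      1 / (n : ℝ) * |Real.log ((1 / (n : ℝ)) ^ (-(p - 1)) * gradBound x₀ θ n z ^ p / W z)| ≤ L ∧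
      1 / (n : ℝ) * |Real.log (timeBound x₀ θ n z / W z)| ≤ L)
    (hE : HasCutoffEnergyInequality p q m x₀ θ ν u V Y Θ)
    (hfin : ν (tsupport (cutoff x₀ θ n s)) ≠ ⊤) {B : ℝ → ℝ}
    (hB : ∀ x, B x = x ^ (-(p - 1)) * (s : ℝ) ^ p * K + 2 * s) {κ' : ℝ} (hκ' : 0 < κ')
    (hBκ' : B (1 / 2) * (κ' * (2 * 2 ^ q)) ≤ 1 / 2) {C : ℝ≥0∞}
    (hC : ∫⁻ z in spaceTime M ∩ logAnnulus x₀ θ n,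
        ENNReal.ofReal (capacityWeight p β₁ β₂ x₀ θ n W z) ∂ν ≤ C)
    {κ₁ κ : ℝ} (hκ₁ : 0 < κ₁) (hκ : 0 < κ) :
    ∫⁻ z in tsupport (cutoff x₀ θ n s),
        ENNReal.ofReal (cutoff x₀ θ n s z * (u z ^ q * V z)) ∂ν ≤
      ENNReal.ofReal κ₁ * (2 * (ENNReal.ofReal (B (1 / 2)) *
        (ENNReal.ofReal (powerSum β₁ β₂ c κ' * Real.exp (c * L)) * C))) +
      ENNReal.ofReal (B κ₁) * (ENNReal.ofReal (κ * (2 * 2 ^ q)) *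
        ∫⁻ z in tsupport (cutoff x₀ θ n s) ∩ logAnnulus x₀ θ n,
          ENNReal.ofReal (cutoff x₀ θ n s z * (u z ^ q * V z)) ∂ν +
        ENNReal.ofReal (powerSum β₁ β₂ c κ * Real.exp (c * L)) * C) := by
  have hn0 : (0 : ℝ) < 1 / n := by positivity
  have hs0 : s ≠ 0 := by omega
  have hB0 : 0 ≤ B (1 / 2) := by
    rw [hB]
    positivity
  set X' := ENNReal.ofReal (powerSum β₁ β₂ c κ' * Real.exp (c * L)) * C with hX'
  set X := ENNReal.ofReal (powerSum β₁ β₂ c κ * Real.exp (c * L)) * C with hX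
  set yD := ∫⁻ z in tsupport (cutoff x₀ θ n s) ∩ logAnnulus x₀ θ n,
    ENNReal.ofReal (cutoff x₀ θ n s z * (u z ^ q * V z)) ∂ν with hyD
  have hstep : ∀ ε : ℝ, 0 < ε → ε ≤ 1 / 2 → ∀ t, t = ENNReal.ofReal (2 ^ p * (2 * ε) ^ (b / 2) +
      2 / θ * (2 * ε) ^ (1 / 2 : ℝ)) * ν (tsupport (cutoff x₀ θ n s)) →
      ∫⁻ z in tsupport (cutoff x₀ θ n s),
        ENNReal.ofReal (cutoff x₀ θ n s z * (u z ^ q * V z)) ∂ν ≤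
      ENNReal.ofReal κ₁ * (2 * (ENNReal.ofReal (B (1 / 2)) * (X' + t))) +
      ENNReal.ofReal (B κ₁) * (ENNReal.ofReal (κ * (2 * 2 ^ q)) * yD + X + t) := by
    intro ε hε hε1 t ht
    obtain ⟨hi, hj, hij⟩ := hE n hn s hs0 (1 / n) ε hn0.le (by linarith) hε
    obtain ⟨-, -, h0⟩ := hE n hn s hs0 0 ε le_rfl one_pos hε
    have f1 := lintegral_cutoffFlux_le hp hm hq1 hK hb0 hc hs2 hs₂ hs₁ hθ hn hn2
      (hexp _ hn0.le le_rfl) hu hY hΘ hum huVm hYm hΘm hW hL hε hε1 one_half_pos hκ'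
    have f0 := lintegral_cutoffFlux_le hp hm hq1 hK hb0 hc hs2 hs₂ hs₁ hθ hn (by norm_num)
      (hexp 0 le_rfl hn0.le) hu hY hΘ hum huVm hYm hΘm hW hL hε hε1 hκ₁ hκ
    rw [← hB, ← ht] at f1 f0
    simp only [cutoffSource_zero] at h0 f0
    rw [ENNReal.ofReal_zero, zero_mul, add_zero] at h0
    set j := ENNReal.ofReal (1 / n) * ∫⁻ z in tsupport (cutoff x₀ θ n s),
      ENNReal.ofReal (cutoffEnergy p m (1 / n) ε x₀ θ n s u Y Θ z) ∂ν with hjdef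
    have hjX : j ≤ 2 * (ENNReal.ofReal (B (1 / 2)) * (X' + t)) := by
      refine le_of_absorb (k := ENNReal.ofReal (B (1 / 2)) * ENNReal.ofReal (κ' * (2 * 2 ^ q)))
        hi hj ?_ (hij.trans (f1.trans ?_))
      · rw [← ENNReal.ofReal_mul hB0]
        refine (ENNReal.ofReal_le_ofReal hBκ').trans (le_of_eq ?_)
        rw [ENNReal.ofReal_div_of_pos two_pos]
        simp
      · refine add_le_add le_rfl ?_
        rw [mul_assoc (ENNReal.ofReal (B (1 / 2))), ← mul_add, ← add_assoc]
        exact mul_le_mul' le_rfl (add_le_add (add_le_add (mul_le_mul' le_rfl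
          (lintegral_mono_set inter_subset_left)) (mul_le_mul' le_rfl hC)) le_rfl)
    refine h0.trans (f0.trans ?_)
    exact add_le_add (mul_le_mul' le_rfl hjX) (mul_le_mul' le_rfl (add_le_add (add_le_add le_rfl
      (mul_le_mul' le_rfl hC)) le_rfl))
  have hlim := tendsto_cutoff_error (p := p) (θ := θ) hb0 hfin
  have h1 := ENNReal.Tendsto.const_mul (a := ENNReal.ofReal (B (1 / 2))) (hlim.const_add X')
    (Or.inr ENNReal.ofReal_ne_top)
  have h2 := ENNReal.Tendsto.const_mul (a := ENNReal.ofReal κ₁)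
    (ENNReal.Tendsto.const_mul (a := 2) h1 (Or.inr ENNReal.ofNat_ne_top))
    (Or.inr ENNReal.ofReal_ne_top)
  have h3 := ENNReal.Tendsto.const_mul (a := ENNReal.ofReal (B κ₁))
    (hlim.const_add (ENNReal.ofReal (κ * (2 * 2 ^ q)) * yD + X)) (Or.inr ENNReal.ofReal_ne_top)
  have h4 := h2.add h3
  rw [add_zero, add_zero] at h4
  refine ge_of_tendsto h4 ?_
  filter_upwards [Ioc_mem_nhdsGT (show (0 : ℝ) < 1 / 2 by norm_num)] with ε hε
  exact hstep ε hε.1 hε.2 _ rfl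

/-- The nonlinear capacity argument. -/
theorem lintegral_source_eq_zero {ν : Measure (M × ℝ)} {p q m K b Δ θ L C : ℝ}
    {x₀ : M} {u V Y Θ W : M × ℝ → ℝ} (hp : 1 < p) (hm : 1 ≤ m) (hq1 : 1 < q) (hK : 0 < K)
    (hb : b = p + m - 2) (hΔ : Δ = q - b) (hb0 : 0 < b) (hΔ0 : 0 < Δ) (hθ : 0 < θ)
    (hu : ∀ᵐ z ∂ν.restrict (spaceTime M), 0 ≤ u z) (hY : ∀ z, 0 ≤ Y z)
    (hΘ : ∀ z, 0 ≤ Θ z ∧ Θ z ≤ K) (hum : AEMeasurable u (ν.restrict (spaceTime M)))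
    (huVm : AEMeasurable (fun z => u z ^ q * V z) (ν.restrict (spaceTime M)))
    (hYm : AEMeasurable Y (ν.restrict (spaceTime M)))
    (hΘm : AEMeasurable Θ (ν.restrict (spaceTime M)))
    (hW : ∀ᵐ z ∂ν.restrict (spaceTime M), 0 < W z ∧ W z ≤ V z)
    (hL : ∀ n : ℕ, n ≠ 0 → ∀ᵐ z ∂ν.restrict (spaceTime M), z ∈ logAnnulus x₀ θ n →
      1 / (n : ℝ) * |Real.log ((1 / (n : ℝ)) ^ (-(p - 1)) * gradBound x₀ θ n z ^ p / W z)| ≤ L ∧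
      1 / (n : ℝ) * |Real.log (timeBound x₀ θ n z / W z)| ≤ L)
    (hE : HasCutoffEnergyInequality p q m x₀ θ ν u V Y Θ)
    (hfin : ∀ n s : ℕ, n ≠ 0 → s ≠ 0 → ν (tsupport (cutoff x₀ θ n s)) ≠ ⊤)
    (hC : ∀ᶠ n : ℕ in atTop, ∫⁻ z in spaceTime M ∩ logAnnulus x₀ θ n,
      ENNReal.ofReal (capacityWeight p (1 / (q - 1)) (b / Δ) x₀ θ n W z) ∂ν ≤ ENNReal.ofReal C) :
    ∫⁻ z in spaceTime M, ENNReal.ofReal (u z ^ q * V z) ∂ν = 0 := by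
  obtain ⟨c, hc, s, hs2, hs₂, hs₁, α₀, hα₀, hα₀2, hexp⟩ :=
    exists_exponents (m := m) hp hq1 hb hΔ hb0 hΔ0
  have hq0 : 0 < q - 1 := by linarith
  have hs0 : s ≠ 0 := by omega
  have hs0' : (0 : ℝ) < s := by positivity
  obtain ⟨B, hB⟩ : ∃ B : ℝ → ℝ, ∀ x, B x = x ^ (-(p - 1)) * (s : ℝ) ^ p * K + 2 * s :=
    ⟨_, fun _ => rfl⟩
  have hBpos : ∀ x, 0 < x → 0 < B x := fun x hx => by
    rw [hB]
    positivity
  have hB2 := hBpos (1 / 2) one_half_pos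
  have hc0 : (0 : ℝ) < 2 * 2 ^ q := by positivity
  -- Chosen so that for e = 1/n, with κ₁ = 1/2, the source on the right has coefficient exactly 1/2.
  have hκ' : 0 < 1 / (2 * B (1 / 2) * (2 * 2 ^ q)) := by positivity
  have hP : Tendsto (fun κ => powerSum (1 / (q - 1)) (b / Δ) c κ * Real.exp (c * L)) atTop
      (𝓝 0) := by
    have := (tendsto_powerSum (one_div_pos.2 hq0) (div_pos hb0 hΔ0) hc).mul_const
      (Real.exp (c * L))
    rwa [zero_mul] at this
  refine lintegral_eq_zero_of_cutoff_bound (x₀ := x₀) (θ := θ) (s := s) (B := B)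
    (C₂ := ENNReal.ofReal C)
    (C₁ := 2 * (ENNReal.ofReal (B (1 / 2)) * (ENNReal.ofReal (powerSum (1 / (q - 1)) (b / Δ) c
      (1 / (2 * B (1 / 2) * (2 * 2 ^ q))) * Real.exp (c * L)) * ENNReal.ofReal C)))
    ?_ huVm hθ hs0 (by finiteness) ENNReal.ofReal_ne_top hc0 hBpos hP ?_ ?_
  · filter_upwards [hu, hW] with z hz hzW
    exact mul_nonneg (Real.rpow_nonneg hz _) (hzW.1.le.trans hzW.2)
  · filter_upwards [eventually_ge_atTop 1] with n hn
    have := (hE n (by omega) s hs0 0 1 le_rfl one_pos one_pos).1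
    simpa only [cutoffSource_zero] using this
  · intro κ₁ hκ₁ κ hκ
    have hlim : ∀ᶠ n : ℕ in atTop, 1 / (n : ℝ) ≤ α₀ :=
      tendsto_one_div_atTop_nhds_zero_nat.eventually_le_const hα₀
    filter_upwards [hlim, hC, eventually_ge_atTop 1] with n hnα hnC hn1
    have hn : n ≠ 0 := by omega
    refine cutoff_bound hp hm hq1 hK hb0 hc hs2 hs₂ hs₁ hθ hn (hnα.trans hα₀2)
      (hexp _ (by positivity) hnα) hu hY hΘ hum huVm hYm hΘm hW (hL n hn) hE (hfin n s hn hs0) hB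
      hκ' (le_of_eq ?_) hnC hκ₁ hκ
    field_simp

end

/-! ### Choice of the time scale and proof of the theorem -/

/-- The product condition says that the interval from σ₁/A to B/σ₄ is nonempty; the implications for
A = 0 and B = 0 cover its degenerate ends. -/
theorem exists_time_scale {σ₁ σ₄ A B : ℝ} (hσ₁ : 0 ≤ σ₁) (hσ₄ : 0 ≤ σ₄) (hA : 0 ≤ A) (hB : 0 ≤ B)
    (hA0 : A = 0 → σ₁ = 0) (hB0 : B = 0 → σ₄ = 0) (h : σ₁ * σ₄ ≤ A * B) :
    ∃ θ > 0, σ₁ ≤ θ * A ∧ θ * σ₄ ≤ B := by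
  rcases eq_or_lt_of_le hσ₄ with h4 | h4
  · rcases eq_or_lt_of_le hA with h0 | h0
    · exact ⟨1, one_pos, by rw [hA0 h0.symm, ← h0, mul_zero], by rw [← h4, mul_zero]; exact hB⟩
    -- The summand 1 keeps θ positive when σ₁ = 0.
    · refine ⟨σ₁ / A + 1, by positivity, ?_, by rw [← h4, mul_zero]; exact hB⟩
      rw [add_mul, div_mul_cancel₀ _ h0.ne']
      linarith
  · have hB' : 0 < B := lt_of_le_of_ne hB fun hb => h4.ne' (hB0 hb.symm)
    refine ⟨B / σ₄, by positivity, ?_, (div_mul_cancel₀ _ h4.ne').le⟩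
    rw [div_mul_eq_mul_div, le_div_iff₀ h4]
    linarith

section

variable {M : Type*} [MetricSpace M] [MeasurableSpace M] [BorelSpace M]
  [SecondCountableTopology M]

theorem prod_restrict_spaceTime (μ : Measure M) [SFinite μ] :
    (μ.prod (volume : Measure ℝ)).restrict (spaceTime M) =
      μ.prod (volume.restrict (Ioi 0)) := by
  rw [spaceTime, ← Measure.prod_restrict, Measure.restrict_univ]

theorem ae_restrict_spaceTime {μ : Measure M} [SFinite μ] {P : M → Prop} {Q : ℝ → Prop}
    (hP : ∀ᵐ x ∂μ, P x) (hQ : ∀ᵐ t ∂(volume.restrict (Ioi (0 : ℝ))), Q t) :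
    ∀ᵐ z ∂((μ.prod volume).restrict (spaceTime M)), P z.1 ∧ Q z.2 := by
  rw [prod_restrict_spaceTime]
  exact (Measure.quasiMeasurePreserving_fst.ae hP).and (Measure.quasiMeasurePreserving_snd.ae hQ)

theorem exists_lintegral_capacityWeight_le {μ : Measure M} [SFinite μ] {x₀ : M} {h : M → ℝ}
    {f : ℝ → ℝ} (hh : AEMeasurable h μ) (hf : AEMeasurable f (volume.restrict (Ioi 0)))
    (hpos : ∀ᵐ z ∂((μ.prod volume).restrict (spaceTime M)), 0 < h z.1 ∧ 0 < f z.2)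
    {p C σ₁ σ₂ σ₃ σ₄ δ₁ δ₂ δ₃ δ₄ θ β₁ β₂ : ℝ} (hp : 0 ≤ p) (hC : 0 ≤ C) (hθ : 0 < θ)
    (hA₁ : ∀ᶠ R : ℝ in atTop, ∫⁻ x in Metric.ball x₀ R, ENNReal.ofReal (h x ^ (-β₁)) ∂μ ≤
      ENNReal.ofReal (C * R ^ σ₁ * Real.log R ^ δ₁))
    (hB₁ : ∀ᶠ T : ℝ in atTop, ∫⁻ t in Ioc 0 T, ENNReal.ofReal (f t ^ (-β₁)) ≤
      ENNReal.ofReal (C * T ^ σ₂ * Real.log T ^ δ₂))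
    (hA₂ : ∀ᶠ R : ℝ in atTop, ∫⁻ x in Metric.ball x₀ R, ENNReal.ofReal (h x ^ (-β₂)) ∂μ ≤
      ENNReal.ofReal (C * R ^ σ₃ * Real.log R ^ δ₃))
    (hB₂ : ∀ᶠ T : ℝ in atTop, ∫⁻ t in Ioc 0 T, ENNReal.ofReal (f t ^ (-β₂)) ≤
      ENNReal.ofReal (C * T ^ σ₄ * Real.log T ^ δ₄))
    (h₁ : σ₁ + θ * σ₂ ≤ θ * (1 + β₁)) (h₂ : σ₃ + θ * σ₄ ≤ p * (1 + β₂))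
    (hδ₁ : δ₁ + δ₂ ≤ β₁) (hδ₂ : δ₃ + δ₄ ≤ β₂) (hβ₁ : 0 ≤ β₁) (hβ₂ : 0 ≤ β₂) :
    ∃ C', ∀ᶠ n : ℕ in atTop, ∫⁻ z in spaceTime M ∩ logAnnulus x₀ θ n,
      ENNReal.ofReal (capacityWeight p β₁ β₂ x₀ θ n (fun z => f z.2 * h z.1) z)
        ∂(μ.prod volume) ≤ ENNReal.ofReal C' := by
  obtain ⟨C₂, hC₂, H₂⟩ := exists_lintegral_weight_le (C₀ := 2 ^ p) (l := p) hh hf hpos hC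
    (by positivity) hθ hA₂ hB₂ h₂ (by positivity) rfl hδ₂ hβ₂
  obtain ⟨C₁, hC₁, H₁⟩ := exists_lintegral_weight_le (C₀ := 2 / θ) (l := θ) hh hf hpos hC
    (by positivity) hθ hA₁ hB₁ h₁ (by positivity) rfl hδ₁ hβ₁
  refine ⟨C₂ + C₁, ?_⟩
  filter_upwards [H₁, H₂, eventually_ge_atTop 1] with n hn₁ hn₂ hn
  have hmono : (μ.prod (volume : Measure ℝ)).restrict (spaceTime M ∩ logAnnulus x₀ θ n) ≤
      (μ.prod volume).restrict (spaceTime M) := Measure.restrict_mono inter_subset_left le_rfl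
  have hWm : AEMeasurable (fun z : M × ℝ => f z.2 * h z.1)
      ((μ.prod volume).restrict (spaceTime M ∩ logAnnulus x₀ θ n)) := by
    refine AEMeasurable.mono_measure ?_ hmono
    rw [prod_restrict_spaceTime]
    exact (hf.comp_quasiMeasurePreserving Measure.quasiMeasurePreserving_snd).mul
      (hh.comp_quasiMeasurePreserving Measure.quasiMeasurePreserving_fst)
  have hPm := (continuous_logScale x₀ θ).measurable
  have hm : AEMeasurable (fun z : M × ℝ => ENNReal.ofReal
      ((2 ^ p * Real.exp (-p * logScale x₀ θ z) / n) ^ (1 + β₂) * (f z.2 * h z.1) ^ (-β₂)))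
      ((μ.prod volume).restrict (spaceTime M ∩ logAnnulus x₀ θ n)) :=
    (AEMeasurable.mul (by fun_prop) (hWm.pow_const _)).ennreal_ofReal
  rw [ENNReal.ofReal_add hC₂ hC₁]
  refine le_trans ?_ (add_le_add hn₂ hn₁)
  rw [← lintegral_add_left' hm]
  refine setLIntegral_mono' (measurableSet_spaceTime.inter (measurableSet_logAnnulus x₀ θ n))
    fun z hz => ?_
  rw [capacityWeight, gradBound_rpow (by omega) hz.2, timeBound_eq hz.2]
  exact ENNReal.ofReal_add_le

end

section

variable {N : ℕ} {M : Type*} [MetricSpace M]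
  [ChartedSpace (EuclideanSpace ℝ (Fin N)) M] [IsManifold (𝓡 N) ∞ M]
  [RiemannianBundle (fun x : M => TangentSpace (𝓡 N) x)]
  [IsContinuousRiemannianBundle (EuclideanSpace ℝ (Fin N))
      (fun x : M => TangentSpace (𝓡 N) x)]
  [IsRiemannianManifold (𝓡 N) M] [ProperSpace M]
  [MeasurableSpace M] [BorelSpace M] [SecondCountableTopology M]
  [IsLocallyFiniteMeasure (μHE[N] : Measure M)]

theorem hasCutoffEnergyInequality {p q m K : ℝ} (hp : 1 < p) (hm : 1 ≤ m) (hK : 0 ≤ K)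
    {a : M → ℝ} (ha : Continuous a) {Φ : ℝ → ℝ} (hΦ : Measurable Φ)
    (hΦK : ∀ s, 0 ≤ s → 0 ≤ Φ s ∧ Φ s ≤ K) {V u v : M × ℝ → ℝ}
    {X : ∀ z : M × ℝ, TangentSpace (𝓡 N) z.1} (h : HasWeakDerivatives p m a u X v)
    (hu0 : ∀ᵐ z ∂((weightedSpaceTimeMeasure N a).restrict (spaceTime M)), 0 ≤ u z)
    (hV0 : ∀ᵐ z ∂((weightedSpaceTimeMeasure N a).restrict (spaceTime M)), 0 ≤ V z)
    (huV : LocallyIntegrableOn (fun z => u z ^ q * V z) (spaceTime M)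
      (weightedSpaceTimeMeasure N a))
    (hup : LocallyIntegrableOn (fun z => u z ^ (p + m - 1)) (spaceTime M)
      (weightedSpaceTimeMeasure N a))
    (hXu : LocallyIntegrableOn (fun z => ‖X z‖ ^ p * u z ^ (m - 1)) (spaceTime M)
      (weightedSpaceTimeMeasure N a))
    (hw : ∀ ψ : M × ℝ → ℝ, LocallyLipschitz ψ → HasCompactSupport ψ → tsupport ψ ⊆ spaceTime M →
      (∀ z, 0 ≤ ψ z) →
      ∫ z in spaceTime M, ψ z * u z ^ q * V z ∂(weightedSpaceTimeMeasure N a) ≤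
        (∫ z in spaceTime M,
          inner ℝ (spaceGrad ψ z) (X z) * u z ^ (m - 1) * ‖X z‖ ^ (p - 2) * Φ ‖X z‖
            ∂(weightedSpaceTimeMeasure N a))
        - ∫ z in spaceTime M, timeDeriv ψ z * u z ∂(weightedSpaceTimeMeasure N a))
    (x₀ : M) {θ : ℝ} (hθ : 0 < θ) :
    HasCutoffEnergyInequality p q m x₀ θ (weightedSpaceTimeMeasure N a) u V (fun z => ‖X z‖)
      (fun z => Φ ‖X z‖) := by
  intro n hn s hs e ε he he1 hε
  have hac : (weightedSpaceTimeMeasure N a).restrict (spaceTime M) ≪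
      (μHE[N] : Measure M).prod volume :=
    Measure.restrict_le_self.absolutelyContinuous.trans
      (weightedSpaceTimeMeasure_absolutelyContinuous a)
  exact energy_inequality hp hm hK ha hΦ hΦK h hu0 hV0 huV hup hXu hw
    (locallyLipschitz_cutoff x₀ θ n s) (hasCompactSupport_cutoff x₀ hθ hn hs)
    (tsupport_cutoff_subset_spaceTime x₀ hθ hn hs) (cutoff_nonneg x₀ θ n s)
    (hac.ae_le (norm_spaceGrad_cutoff_le (N := N) x₀ θ hn s))
    (hac.ae_le (neg_timeDeriv_cutoff_le (μHE[N] : Measure M) x₀ hθ hn s)) he he1 hε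

theorem absolutelyContinuous_weightedSpaceTimeMeasure {a : M → ℝ} (ha : Continuous a)
    (ha_pos : ∀ᵐ x ∂(μHE[N] : Measure M), 0 < a x) :
    (μHE[N] : Measure M).prod volume ≪ weightedSpaceTimeMeasure N a := by
  refine Measure.AbsolutelyContinuous.prod ?_ Measure.AbsolutelyContinuous.rfl
  refine withDensity_absolutelyContinuous' ha.measurable.ennreal_ofReal.aemeasurable ?_
  filter_upwards [ha_pos] with x hx using (ENNReal.ofReal_pos.2 hx).ne'

end

end DoublyNonlinear

end

theorem corollary3 (N : ℕ) {M : Type*} [MetricSpace M]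
    [ChartedSpace (EuclideanSpace ℝ (Fin N)) M] [IsManifold (𝓡 N) ∞ M]
    [RiemannianBundle (fun x : M => TangentSpace (𝓡 N) x)]
    [IsContMDiffRiemannianBundle (𝓡 N) ∞ (EuclideanSpace ℝ (Fin N))
      (fun x : M => TangentSpace (𝓡 N) x)]
    [IsRiemannianManifold (𝓡 N) M] [CompleteSpace M] [NoncompactSpace M]
    [MeasurableSpace M] [BorelSpace M]
    (x₀ : M) (p q m : ℝ) (hp : 1 < p) (hm : 1 ≤ m) (hq : max (p + m - 2) 1 < q)
    (a : M → ℝ) (ha : LocallyLipschitz a) (ha_pos : ∀ᵐ x ∂(μHE[N] : Measure M), 0 < a x)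
    (Φ : ℝ → ℝ) (hΦ : Measurable Φ) (K : ℝ) (hK : 0 < K) (hΦK : ∀ s, 0 ≤ s → 0 ≤ Φ s ∧ Φ s ≤ K)
    (V : M × ℝ → ℝ)
    (hV : LocallyIntegrableOn V (DoublyNonlinear.spaceTime M)
      ((μHE[N] : Measure M).prod volume))
    (h : M → ℝ) (hh : AEMeasurable h (μHE[N] : Measure M))
    (f : ℝ → ℝ) (hf : AEMeasurable f (volume.restrict (Ioi 0)))
    (hVhf : ∀ᵐ z ∂(((μHE[N] : Measure M).prod volume).restrict (DoublyNonlinear.spaceTime M)),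
      f z.2 * h z.1 ≤ V z)
    (C α₁ α₂ σ₁ σ₂ σ₃ σ₄ δ₁ δ₂ δ₃ δ₄ : ℝ) (hC : 0 < C) (hα₁ : 0 ≤ α₁) (hα₂ : 0 ≤ α₂)
    (hσ₁ : 0 ≤ σ₁) (hσ₂ : 0 ≤ σ₂) (hσ₃ : 0 ≤ σ₃) (hσ₄ : 0 ≤ σ₄)
    (hδ₁ : 0 ≤ δ₁) (hδ₂ : 0 ≤ δ₂) (hδ₃ : 0 ≤ δ₃) (hδ₄ : 0 ≤ δ₄)
    (h_bounds : ∀ᵐ x ∂(μHE[N] : Measure M),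
      C⁻¹ * (1 + dist x₀ x) ^ (-α₁) ≤ h x ∧ h x ≤ C * (1 + dist x₀ x) ^ α₁)
    (f_bounds : ∀ᵐ t ∂(volume.restrict (Ioi (0 : ℝ))),
      C⁻¹ * (1 + t) ^ (-α₂) ≤ f t ∧ f t ≤ C * (1 + t) ^ α₂)
    (h_int₁ : ∀ᶠ R : ℝ in atTop,
      ∫⁻ x in Metric.ball x₀ R, ENNReal.ofReal (h x ^ (-(1 / (q - 1))))
          ∂(DoublyNonlinear.weightedMeasure N a)
        ≤ ENNReal.ofReal (C * R ^ σ₁ * Real.log R ^ δ₁))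
    (f_int₁ : ∀ᶠ T : ℝ in atTop,
      ∫⁻ t in Ioc 0 T, ENNReal.ofReal (f t ^ (-(1 / (q - 1))))
        ≤ ENNReal.ofReal (C * T ^ σ₂ * Real.log T ^ δ₂))
    (h_int₂ : ∀ᶠ R : ℝ in atTop,
      ∫⁻ x in Metric.ball x₀ R, ENNReal.ofReal (h x ^ (-((p + m - 2) / (q - p - m + 2))))
          ∂(DoublyNonlinear.weightedMeasure N a)
        ≤ ENNReal.ofReal (C * R ^ σ₃ * Real.log R ^ δ₃))
    (f_int₂ : ∀ᶠ T : ℝ in atTop,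
      ∫⁻ t in Ioc 0 T, ENNReal.ofReal (f t ^ (-((p + m - 2) / (q - p - m + 2))))
        ≤ ENNReal.ofReal (C * T ^ σ₄ * Real.log T ^ δ₄))
    (hi : δ₁ + δ₂ ≤ 1 / (q - 1) ∧ δ₃ + δ₄ ≤ (p + m - 2) / (q - p - m + 2))
    (hii : σ₂ ≤ q / (q - 1) ∧ σ₃ ≤ p * q / (q - p - m + 2))
    (hiii : (σ₂ = q / (q - 1) → σ₁ = 0) ∧ (σ₃ = p * q / (q - p - m + 2) → σ₄ = 0))
    (hiv : σ₁ * σ₄ ≤ (q / (q - 1) - σ₂) * (p * q / (q - p - m + 2) - σ₃)) :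
    ¬ ∃ u : M × ℝ → ℝ,
      DoublyNonlinear.IsWeakSolution (N := N) p q m a Φ V u ∧
      ¬ (∀ᵐ z ∂(((μHE[N] : Measure M).prod volume).restrict (DoublyNonlinear.spaceTime M)),
          u z = 0) := by
  rintro ⟨u, ⟨X, v, hD, hu0, huV, hup, hXu, -, hw⟩, hne⟩
  refine hne ?_
  obtain ⟨hq', hq1⟩ := max_lt_iff.1 hq
  have hb0 : 0 < p + m - 2 := by linarith
  have hΔ0 : 0 < q - p - m + 2 := by linarith
  have hq0 : 0 < q - 1 := by linarith
  have hac : Continuous a := ha.continuous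
  have : ProperSpace M := DoublyNonlinear.properSpace_of_complete N M
  have : SecondCountableTopology M := secondCountable_of_proper
  have : IsContinuousRiemannianBundle (EuclideanSpace ℝ (Fin N))
      (fun x : M => TangentSpace (𝓡 N) x) :=
    DoublyNonlinear.isContinuousRiemannianBundle (N := N) (M := M)
  have : IsLocallyFiniteMeasure (μHE[N] : Measure M) :=
    DoublyNonlinear.isLocallyFiniteMeasure_euclideanHausdorffMeasure
  have : IsLocallyFiniteMeasure (DoublyNonlinear.weightedSpaceTimeMeasure N a) :=
    DoublyNonlinear.isLocallyFiniteMeasure_weightedSpaceTimeMeasure hac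
  have : SFinite (DoublyNonlinear.weightedMeasure N a) := by
    unfold DoublyNonlinear.weightedMeasure
    infer_instance
  have hwac : DoublyNonlinear.weightedMeasure N a ≪ (μHE[N] : Measure M) :=
    withDensity_absolutelyContinuous _ _
  have hνac := (DoublyNonlinear.weightedSpaceTimeMeasure_absolutelyContinuous (N := N) a).restrict
    (DoublyNonlinear.spaceTime M)
  have hbounds := hνac.ae_le (DoublyNonlinear.ae_restrict_spaceTime h_bounds f_bounds)
  have hpos : ∀ᵐ z ∂(DoublyNonlinear.weightedSpaceTimeMeasure N a).restrict
      (DoublyNonlinear.spaceTime M), 0 < h z.1 ∧ 0 < f z.2 := by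
    filter_upwards [hbounds, ae_restrict_mem DoublyNonlinear.measurableSet_spaceTime] with z hz hzS
    have ht : 0 < z.2 := hzS.2
    have hr : 0 ≤ dist x₀ z.1 := dist_nonneg
    exact ⟨lt_of_lt_of_le (by positivity) hz.1.1, lt_of_lt_of_le (by positivity) hz.2.1⟩
  have hWV : ∀ᵐ z ∂(DoublyNonlinear.weightedSpaceTimeMeasure N a).restrict
      (DoublyNonlinear.spaceTime M), 0 < f z.2 * h z.1 ∧ f z.2 * h z.1 ≤ V z := by
    filter_upwards [hpos, hνac.ae_le hVhf] with z hz hz'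
    exact ⟨mul_pos hz.2 hz.1, hz'⟩
  have hV0 : ∀ᵐ z ∂(DoublyNonlinear.weightedSpaceTimeMeasure N a).restrict
      (DoublyNonlinear.spaceTime M), 0 ≤ V z := by
    filter_upwards [hWV] with z hz using hz.1.le.trans hz.2
  obtain ⟨θ, hθ, hθ₁, hθ₂⟩ := DoublyNonlinear.exists_time_scale hσ₁ hσ₄ (sub_nonneg.2 hii.1)
    (sub_nonneg.2 hii.2) (fun h0 => hiii.1 (sub_eq_zero.1 h0).symm)
    (fun h0 => hiii.2 (sub_eq_zero.1 h0).symm) hiv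
  -- These identities match the thresholds of (ii)–(iv) with the exponents θ(1 + β₁) and p(1 + β₂)
  -- of the capacity terms.
  have hQ₁ : 1 + 1 / (q - 1) = q / (q - 1) := by
    field_simp
    ring
  have hQ₂ : p * (1 + (p + m - 2) / (q - p - m + 2)) = p * q / (q - p - m + 2) := by
    field_simp
    ring
  obtain ⟨C', hC'⟩ := DoublyNonlinear.exists_lintegral_capacityWeight_le (p := p) (hh.mono_ac hwac)
    hf hpos (by linarith) hC.le hθ h_int₁ f_int₁ h_int₂ f_int₂ (by rw [hQ₁]; linarith)
    (by rw [hQ₂]; linarith) hi.1 hi.2 (one_div_pos.2 hq0).le (div_pos hb0 hΔ0).le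
  obtain ⟨L₂, hL₂⟩ := DoublyNonlinear.exists_abs_log_le (x₀ := x₀) (h := h) (f := f) hθ hC hα₁ hα₂
    (show (0 : ℝ) < 2 ^ p by positivity) (show 0 ≤ p by linarith)
  obtain ⟨L₁, hL₁⟩ := DoublyNonlinear.exists_abs_log_le (x₀ := x₀) (h := h) (f := f) hθ hC hα₁ hα₂
    (show (0 : ℝ) < 2 / θ by positivity) hθ.le
  have hE := DoublyNonlinear.hasCutoffEnergyInequality hp hm hK.le hac hΦ hΦK hD hu0 hV0 huV hup hXu
    hw x₀ hθ
  have hXm := DoublyNonlinear.aemeasurable_norm_section hD.aestronglyMeasurable_grad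
  have hzero := DoublyNonlinear.lintegral_source_eq_zero (L := max L₁ L₂) (Δ := q - p - m + 2) hp hm
    hq1 hK rfl (by ring) hb0 hΔ0 hθ hu0 (fun z => norm_nonneg (X z))
    (fun z => hΦK _ (norm_nonneg (X z))) hD.aestronglyMeasurable.aemeasurable
    huV.aestronglyMeasurable.aemeasurable hXm (hΦ.comp_aemeasurable hXm) hWV ?_ hE ?_ hC'
  · have hae : ∀ᵐ z ∂(DoublyNonlinear.weightedSpaceTimeMeasure N a).restrict
        (DoublyNonlinear.spaceTime M), u z = 0 := by
      rw [lintegral_eq_zero_iff' huV.aestronglyMeasurable.aemeasurable.ennreal_ofReal] at hzero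
      filter_upwards [hzero, hu0, hWV] with z hz hz0 hzV
      have h1 : u z ^ q * V z ≤ 0 := ENNReal.ofReal_eq_zero.1 hz
      by_contra hne
      have hpos := Real.rpow_pos_of_pos (lt_of_le_of_ne hz0 (Ne.symm hne)) q
      exact absurd (mul_pos hpos (hzV.1.trans_le hzV.2)) (not_lt.2 h1)
    -- Since a > 0 a.e., the weighted and unweighted measures have the same null sets.
    exact ((DoublyNonlinear.absolutelyContinuous_weightedSpaceTimeMeasure hac ha_pos).restrict
      _).ae_le hae
  · intro n hn
    filter_upwards [hbounds, ae_restrict_mem DoublyNonlinear.measurableSet_spaceTime]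
      with z hz hzS hzD
    rw [DoublyNonlinear.gradBound_rpow hn hzD, DoublyNonlinear.timeBound_eq hzD]
    exact ⟨(hL₂ n hn z ⟨hzS, hzD⟩ hz.1.1 hz.1.2 hz.2.1 hz.2.2).trans (le_max_right _ _),
      (hL₁ n hn z ⟨hzS, hzD⟩ hz.1.1 hz.1.2 hz.2.1 hz.2.2).trans (le_max_left _ _)⟩
  · intro n s hn hs
    exact (DoublyNonlinear.hasCompactSupport_cutoff x₀ hθ hn hs).isCompact.measure_lt_top.ne
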